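/- Let $M$ be a closed (compact, without boundary) smooth 3-manifold and let $f:M\to M$ be a $C^1$ diffeomorphism that is partially hyperbolic: $TM=E^s\oplus E^c\oplus E^u$, where $E^s,E^c,E^u$ are continuous $Df$-invariant line bundles, and for some smooth Riemannian metric on $M$, all $x\in M$ and all unit vectors $v^s\in E^s_x$, $v^c\in E^c_x$, $v^u\in E^u_x$, $$\|Df(x)v^s\|<1<\|Df(x)v^u\|,\qquad \|Df(x)v^s\|<\|Df(x)v^c\|<\|Df(x)v^u\|.$$ The accessibility class $AC(x)$ of a point $x$ is the set of all $y\in M$ for which there are a path $c:[0,1]\to M$ with $c(0)=x$, $c(1)=y$ and a subdivision $0=t_0<\dots<t_N=1$ such that each restriction $c|_{[t_i,t_{i+1}]}$ is either a $C^1$ curve tangent to $E^s$ or a $C^1$ curve tangent to $E^u$ (vanishing derivatives being allowed). A local center curve $W^c_{loc}(x)$ is an embedded open $C^1$ arc through $x$ that is tangent to $E^c$ at each of its points; it exists but need not be unique. For any point $x\in M$, the following statements are equivalent: 1. $AC(x)$ is open in $M$. 2. $AC(x)$ has non-empty interior in $M$. 3. For every choice of local center curve $W^c_{loc}(x)$,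 the set $AC(x)\cap W^c_{loc}(x)$ has non-empty interior in $W^c_{loc}(x)$. 4. For some choice of local center curve $W^c_{loc}(x)$, the set $AC(x)\cap W^c_{loc}(x)$ has non-empty interior in $W^c_{loc}(x)$. -/

import Mathlib

open Set Topology
open scoped Manifold ContDiff

/-- The model space of 3-manifolds. -/
abbrev E3 : Type := EuclideanSpace ℝ (Fin 3)

/-- A field of tangent subspaces `x ↦ E x ⊆ T_x M` on a 3-manifold. -/
abbrev TangentField (M : Type*) [TopologicalSpace M] [ChartedSpace E3 M] :=
  ∀ x : M, Submodule ℝ (TangentSpace (𝓡 3) x)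

section

variable {M : Type*} [TopologicalSpace M] [ChartedSpace E3 M] [IsManifold (𝓡 3) ∞ M]

/-- `E` is a continuous line subbundle of `TM`: near every point it is spanned by a
nowhere vanishing continuous vector field. -/
def IsContinuousLineBundle (E : TangentField M) : Prop :=
  ∀ x₀ : M, ∃ U ∈ 𝓝 x₀, ∃ V : (x : M) → TangentSpace (𝓡 3) x,
    ContinuousOn (fun x => (⟨x, V x⟩ : TangentBundle (𝓡 3) M)) U ∧
    ∀ x ∈ U, V x ≠ 0 ∧ E x = Submodule.span ℝ {V x}

/-- A smooth Riemannian metric on `M`. -/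
abbrev SmoothMetric (M : Type*) [TopologicalSpace M] [ChartedSpace E3 M]
    [IsManifold (𝓡 3) ∞ M] :=
  Bundle.ContMDiffRiemannianMetric (𝓡 3) ∞ E3 (fun x : M => TangentSpace (𝓡 3) x)

/-- The norm of a tangent vector for a Riemannian metric. -/
noncomputable def SmoothMetric.tnorm (g : SmoothMetric M) (x : M)
    (v : TangentSpace (𝓡 3) x) : ℝ :=
  Real.sqrt (g.inner x v v)

/-- The diffeomorphism `f` of the 3-manifold `M` is partially hyperbolic with invariant splitting
`TM = Es ⊕ Ec ⊕ Eu` into continuous line bundles. -/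
structure IsPartiallyHyperbolic (f : M ≃ₘ^1⟮𝓡 3, 𝓡 3⟯ M) (Es Ec Eu : TangentField M) : Prop where
  lineBundle_s : IsContinuousLineBundle Es
  lineBundle_c : IsContinuousLineBundle Ec
  lineBundle_u : IsContinuousLineBundle Eu
  splitting : ∀ x : M, DirectSum.IsInternal ![Es x, Ec x, Eu x]
  invariant_s : ∀ x : M, (Es x).map (mfderiv (𝓡 3) (𝓡 3) f x).toLinearMap = Es (f x)
  invariant_c : ∀ x : M, (Ec x).map (mfderiv (𝓡 3) (𝓡 3) f x).toLinearMap = Ec (f x)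
  invariant_u : ∀ x : M, (Eu x).map (mfderiv (𝓡 3) (𝓡 3) f x).toLinearMap = Eu (f x)
  hyperbolicity : ∃ g : SmoothMetric M, ∀ x : M, ∀ vs ∈ Es x, ∀ vc ∈ Ec x, ∀ vu ∈ Eu x,
    g.tnorm x vs = 1 → g.tnorm x vc = 1 → g.tnorm x vu = 1 →
    g.tnorm (f x) (mfderiv (𝓡 3) (𝓡 3) f x vs) < 1 ∧
    1 < g.tnorm (f x) (mfderiv (𝓡 3) (𝓡 3) f x vu) ∧
    g.tnorm (f x) (mfderiv (𝓡 3) (𝓡 3) f x vs) < g.tnorm (f x) (mfderiv (𝓡 3) (𝓡 3) f x vc) ∧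
    g.tnorm (f x) (mfderiv (𝓡 3) (𝓡 3) f x vc) < g.tnorm (f x) (mfderiv (𝓡 3) (𝓡 3) f x vu)

/-- `c` is a `C¹` curve on `[a, b]` (one-sided derivatives at the ends) tangent to `E`. -/
def IsTangentArc (E : TangentField M) (c : ℝ → M) (a b : ℝ) : Prop :=
  ContMDiffOn 𝓘(ℝ, ℝ) (𝓡 3) 1 c (Icc a b) ∧
  ∀ t ∈ Icc a b, mfderivWithin 𝓘(ℝ, ℝ) (𝓡 3) c (Icc a b) t (1 : ℝ) ∈ E (c t)

/-- `c : [0, 1] → M` is an su-path: there is a subdivision `0 = t 0 < ⋯ < t N = 1` such that each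
restriction of `c` to `[t i, t (i + 1)]` is a `C¹` curve tangent to `Es` or a `C¹` curve tangent
to `Eu`. Only the values of `c` on `[0, 1]` matter. -/
def IsSuPath (Es Eu : TangentField M) (c : ℝ → M) : Prop :=
  ∃ (N : ℕ) (t : ℕ → ℝ), t 0 = 0 ∧ t N = 1 ∧ ∀ i < N, t i < t (i + 1) ∧
    (IsTangentArc Es c (t i) (t (i + 1)) ∨ IsTangentArc Eu c (t i) (t (i + 1)))

/-- The accessibility class of `x`. -/
def accessibilityClass (Es Eu : TangentField M) (x : M) : Set M :=
  {y | ∃ c : ℝ → M, IsSuPath Es Eu c ∧ c 0 = x ∧ c 1 = y}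

/-- `W` is a local center curve through `x`: an embedded open `C¹` arc through `x` that is
tangent to `Ec` at each of its points. -/
def IsLocalCenterCurve (Ec : TangentField M) (x : M) (W : Set M) : Prop :=
  ∃ (ε : ℝ) (γ : ℝ → M), 0 < ε ∧ γ 0 = x ∧ W = γ '' Ioo (-ε) ε ∧
    ContMDiffOn 𝓘(ℝ, ℝ) (𝓡 3) 1 γ (Ioo (-ε) ε) ∧
    IsEmbedding ((Ioo (-ε) ε).domRestrict γ) ∧
    ∀ t ∈ Ioo (-ε) ε, mfderiv 𝓘(ℝ, ℝ) (𝓡 3) γ t (1 : ℝ) ≠ 0 ∧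
      mfderiv 𝓘(ℝ, ℝ) (𝓡 3) γ t (1 : ℝ) ∈ Ec (γ t)

/-- `A ∩ W` has non-empty interior in the subspace topology of `W`. -/
def HasInteriorIn (A W : Set M) : Prop :=
  (interior ((Subtype.val : W → M) ⁻¹' A)).Nonempty

end

/-!
The two strong bundles are uniquely integrable. Embed `M` in some `ℝⁿ` and expand the secant
`e q - e p` in the frame of the splitting at `p`. Two short curves tangent to `Es` that leave the
same point and end over the same `Es`-coordinate differ only in the `Ec`- and `Eu`-components; under
forward iteration of `f` those components shrink more slowly than the `Es`-lengths of the curves, so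
they must vanish. Hence Peano's solutions along `Es` (and along `Eu`, by passing to `f⁻¹`) are
unique and form continuous local flows, although the bundles are only continuous.

By continuity of these flows the interior of an accessibility class spreads along strong curves, so
a nonempty interior is everything. If a class contains a piece of a center curve `γ` through `p`,
then from any point near `p` one reaches `γ` by moving along `Eu` and then along `Es`, for times
found by the two-dimensional Poincaré–Miranda theorem; so the class is a neighbourhood of `p`.
-/

open Filter

section ODE

variable {E : Type*} [NormedAddCommGroup E] [NormedSpace ℝ E] {V : E → E} {L ε : ℝ}
  {y : ℝ → E} {S : Set ℝ}

/-- `y` solves `y' = V y` on `S` up to an error `ε` in the velocity. The one-sided derivatives at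
the boundary of `S` are allowed for, so that solutions on compact intervals qualify. -/
def IsApproxSolution (V : E → E) (ε : ℝ) (y : ℝ → E) (S : Set ℝ) : Prop :=
  ∀ r ∈ S, ∃ v, ‖v - V (y r)‖ ≤ ε ∧ HasDerivWithinAt y v S r

theorem isApproxSolution_of_isIntegralCurve (hy : IsIntegralCurve y fun _ => V) (hε : 0 ≤ ε)
    (S : Set ℝ) : IsApproxSolution V ε y S :=
  fun r _ => ⟨V (y r), by simpa using hε, (hy r).hasDerivWithinAt⟩

theorem IsApproxSolution.norm_sub_le (hy : IsApproxSolution V ε y S) (hS : Convex ℝ S)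
    (hL : ∀ x, ‖V x‖ ≤ L) {s t : ℝ} (hs : s ∈ S) (ht : t ∈ S) :
    ‖y t - y s‖ ≤ (L + ε) * |t - s| := by
  choose! v hv hd using hy
  refine hS.norm_image_sub_le_of_norm_hasDerivWithin_le hd (fun r hr => ?_) hs ht
  calc ‖v r‖ = ‖V (y r) + (v r - V (y r))‖ := by rw [add_sub_cancel]
    _ ≤ L + ε := norm_add_le_of_le (hL _) (hv r hr)

theorem IsApproxSolution.norm_sub_sub_smul_le (hy : IsApproxSolution V ε y S) (hS : Convex ℝ S)
    {s t η : ℝ} (hs : s ∈ S) (ht : t ∈ S) (hη : ∀ r ∈ uIcc s t, ‖V (y r) - V (y s)‖ ≤ η) :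
    ‖y t - y s - (t - s) • V (y s)‖ ≤ (ε + η) * |t - s| := by
  choose! v hv hd using hy
  have hsub : uIcc s t ⊆ S := hS.ordConnected.uIcc_subset hs ht
  have key := (convex_uIcc s t).norm_image_sub_le_of_norm_hasDerivWithin_le
    (f := fun r => y r - (r - s) • V (y s)) (f' := fun r => v r - (1 : ℝ) • V (y s)) (C := ε + η)
    (fun r hr => ((hd r (hsub hr)).mono hsub).sub
      (((hasDerivAt_id r).sub_const s).smul_const (V (y s))).hasDerivWithinAt)
    (fun r hr => ?_) left_mem_uIcc right_mem_uIcc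
  · simpa [sub_right_comm] using key
  · calc ‖v r - (1 : ℝ) • V (y s)‖ = ‖(v r - V (y r)) + (V (y r) - V (y s))‖ := by
          rw [one_smul, sub_add_sub_cancel]
      _ ≤ ε + η := norm_add_le_of_le (hv r (hsub hr)) (hη r hr)

theorem norm_sub_le_of_isIntegralCurve (hy : IsIntegralCurve y fun _ => V) (hL : ∀ x, ‖V x‖ ≤ L)
    (s t : ℝ) : ‖y t - y s‖ ≤ L * |t - s| := by
  simpa using (isApproxSolution_of_isIntegralCurve hy le_rfl univ).norm_sub_le convex_univ hL
    (mem_univ s) (mem_univ t)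

theorem IsApproxSolution.exists_forall_norm_sub_sub_smul_le (hV : UniformContinuous V)
    (hL : ∀ x, ‖V x‖ ≤ L) (hε : 0 < ε) :
    ∃ δ > 0, ∀ (y : ℝ → E) (S : Set ℝ), IsApproxSolution V ε y S → Convex ℝ S →
      ∀ s ∈ S, ∀ t ∈ S, |t - s| ≤ δ →
        ‖y t - y s - (t - s) • V (y s)‖ ≤ (ε + ε) * |t - s| := by
  obtain ⟨δ, hδ, hVδ⟩ := Metric.uniformContinuous_iff_le.1 hV ε hε
  simp only [dist_eq_norm] at hVδ
  have hL₀ : 0 ≤ L := (norm_nonneg _).trans (hL 0)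
  refine ⟨δ / (L + ε), by positivity, fun y S hy hS s hs t ht hst =>
    hy.norm_sub_sub_smul_le hS hs ht fun r hr => hVδ ?_⟩
  calc ‖y r - y s‖ ≤ (L + ε) * |r - s| :=
        hy.norm_sub_le hS hL hs (hS.ordConnected.uIcc_subset hs ht hr)
    _ ≤ (L + ε) * (δ / (L + ε)) := by
        gcongr
        exact (abs_sub_left_of_mem_uIcc hr).trans hst
    _ = δ := mul_div_cancel₀ δ (by positivity)

section Limit

variable {ι : Type*} {l : Ultrafilter ι} {Y : ι → ℝ → E} {x : E}

theorem isIntegralCurve_of_tendsto (hV : UniformContinuous V) (hL : ∀ x, ‖V x‖ ≤ L)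
    (hY : ∀ T, ∀ ε > 0, ∀ᶠ i in l, IsApproxSolution V ε (Y i) (Icc (-T) T))
    (hlim : ∀ t, Tendsto (Y · t) l (𝓝 (y t))) : IsIntegralCurve y fun _ => V := by
  intro s
  rw [hasDerivAt_iff_isLittleO, Asymptotics.isLittleO_iff]
  intro ε hε
  obtain ⟨δ, hδ, hdiff⟩ := IsApproxSolution.exists_forall_norm_sub_sub_smul_le hV hL (half_pos hε)
  filter_upwards [Metric.closedBall_mem_nhds s hδ] with t ht
  have hs : s ∈ Icc (-max |s| |t|) (max |s| |t|) := abs_le.1 (le_max_left _ _)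
  have ht' : t ∈ Icc (-max |s| |t|) (max |s| |t|) := abs_le.1 (le_max_right _ _)
  have htends := (((hlim t).sub (hlim s)).sub
    (((hV.continuous.tendsto _).comp (hlim s)).const_smul (t - s))).norm
  refine le_of_tendsto htends ?_
  filter_upwards [hY (max |s| |t|) (ε / 2) (half_pos hε)] with i hi
  simpa using hdiff (Y i) _ hi (convex_Icc _ _) s hs t ht' ht

theorem exists_isIntegralCurve_tendsto [ProperSpace E] (hV : UniformContinuous V)
    (hL : ∀ x, ‖V x‖ ≤ L)
    (hY : ∀ T, ∀ ε > 0, ∀ᶠ i in l, IsApproxSolution V ε (Y i) (Icc (-T) T))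
    (hx : Tendsto (Y · 0) l (𝓝 x)) :
    ∃ y : ℝ → E, y 0 = x ∧ IsIntegralCurve y (fun _ => V) ∧ ∀ t, Tendsto (Y · t) l (𝓝 (y t)) := by
  have hbdd : ∀ t, ∃ z, Tendsto (Y · t) l (𝓝 z) := fun t => by
    have hmem : ∀ᶠ i in l, Y i t ∈ Metric.closedBall x (1 + (L + 1) * |t|) := by
      filter_upwards [hY |t| 1 one_pos, hx.eventually (Metric.closedBall_mem_nhds x one_pos)]
        with i hi hxi
      have hmove := hi.norm_sub_le (convex_Icc _ _) hL (s := 0) (t := t) (by simp)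
        (abs_le.1 le_rfl)
      rw [sub_zero] at hmove
      rw [mem_closedBall_iff_norm]
      calc ‖Y i t - x‖ = ‖(Y i 0 - x) + (Y i t - Y i 0)‖ := by rw [sub_add_sub_cancel']
        _ ≤ 1 + (L + 1) * |t| := norm_add_le_of_le (by rwa [← dist_eq_norm]) hmove
    obtain ⟨z, -, hz⟩ := (isCompact_closedBall x _).ultrafilter_le_nhds' (l.map (Y · t)) hmem
    exact ⟨z, hz⟩
  choose y hy using hbdd
  exact ⟨y, tendsto_nhds_unique (hy 0) hx, isIntegralCurve_of_tendsto hV hL hY hy, hy⟩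

end Limit

variable [FiniteDimensional ℝ E]

theorem exists_isIntegralCurveOn_Icc (hV : ContDiff ℝ 1 V) (hL : ∀ x, ‖V x‖ ≤ L) (x : E) {T : ℝ}
    (hT : 0 ≤ T) : ∃ y : ℝ → E, y 0 = x ∧ IsIntegralCurveOn y (fun _ => V) (Icc (-T) T) := by
  lift L to NNReal using (norm_nonneg _).trans (hL 0)
  lift T to NNReal using hT
  obtain ⟨K, hK⟩ := hV.contDiffOn.exists_lipschitzOnWith one_ne_zero
    (convex_closedBall x (L * T)) (isCompact_closedBall x (L * T))
  have hPL : IsPicardLindelof (fun _ => V) (⟨0, by simp⟩ : Icc (-T : ℝ) T) x (L * T) 0 L K :=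
    IsPicardLindelof.of_time_independent (fun z _ => hL z) (by simpa using hK) (by simp)
  exact hPL.exists_eq_forall_mem_Icc_hasDerivWithinAt₀

theorem exists_isIntegralCurve (hV : UniformContinuous V) (hL : ∀ x, ‖V x‖ ≤ L) (x : E) :
    ∃ y : ℝ → E, y 0 = x ∧ IsIntegralCurve y fun _ => V := by
  have happrox : ∀ n : ℕ, ∃ y : ℝ → E, y 0 = x ∧
      IsApproxSolution V (1 / ((n : ℝ) + 1)) y (Icc (-n : ℝ) n) := fun n => by
    have hn : 0 < 1 / ((n : ℝ) + 1) := Nat.one_div_pos_of_nat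
    obtain ⟨W, hW, hWV⟩ := hV.exists_contDiff_dist_le hn
    simp only [dist_eq_norm] at hWV
    obtain ⟨y, hy₀, hy⟩ := exists_isIntegralCurveOn_Icc (hW.of_le (by simp))
      (fun z => (norm_le_norm_add_norm_sub' _ (V z)).trans (add_le_add (hL z) (hWV z).le))
      x n.cast_nonneg
    exact ⟨y, hy₀, fun t ht => ⟨W (y t), (hWV _).le, hy t ht⟩⟩
  choose Y hY₀ hY using happrox
  have hYl : ∀ T, ∀ ε > 0, ∀ᶠ n in hyperfilter ℕ, IsApproxSolution V ε (Y n) (Icc (-T) T) := by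
    intro T ε hε
    have hlarge : ∀ᶠ n : ℕ in atTop, T ≤ n ∧ 1 / ((n : ℝ) + 1) ≤ ε :=
      (tendsto_natCast_atTop_atTop.eventually_ge_atTop T).and
        (tendsto_one_div_add_atTop_nhds_zero_nat.eventually_le_const hε)
    filter_upwards [Nat.hyperfilter_le_atTop hlarge] with n hn t ht
    have hsub : Icc (-T) T ⊆ Icc (-n : ℝ) n := Icc_subset_Icc (neg_le_neg hn.1) hn.1
    obtain ⟨v, hv, hd⟩ := hY n t (hsub ht)
    exact ⟨v, hv.trans hn.2, hd.mono hsub⟩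
  obtain ⟨y, hy₀, hy, -⟩ := exists_isIntegralCurve_tendsto hV hL hYl
    (tendsto_const_nhds.congr fun n => (hY₀ n).symm)
  exact ⟨y, hy₀, hy⟩

theorem continuousAt_solution_of_unique (hV : UniformContinuous V) (hL : ∀ x, ‖V x‖ ≤ L)
    {Y : E → ℝ → E} (hY₀ : ∀ x, Y x 0 = x) (hY : ∀ x, IsIntegralCurve (Y x) fun _ => V)
    {x₀ : E} {t₀ : ℝ}
    (huniq : ∀ y : ℝ → E, y 0 = x₀ → IsIntegralCurve y (fun _ => V) → y t₀ = Y x₀ t₀) :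
    ContinuousAt (fun z : E × ℝ => Y z.1 z.2) (x₀, t₀) := by
  have hspace : Tendsto (fun x => Y x t₀) (𝓝 x₀) (𝓝 (Y x₀ t₀)) := by
    rw [tendsto_iff_ultrafilter]
    intro l hl
    obtain ⟨y, hy₀, hy, hlim⟩ := exists_isIntegralCurve_tendsto (l := l) (x := x₀) hV hL
      (fun T ε hε => .of_forall fun x => isApproxSolution_of_isIntegralCurve (hY x) hε.le _)
      (by simp only [hY₀]; exact hl)
    exact huniq y hy₀ hy ▸ hlim t₀
  have htime : Tendsto (fun z : E × ℝ => L * |z.2 - t₀|) (𝓝 (x₀, t₀)) (𝓝 0) := by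
    have hcont : Continuous fun z : E × ℝ => L * |z.2 - t₀| := by fun_prop
    simpa using hcont.tendsto (x₀, t₀)
  have hdiff : Tendsto (fun z : E × ℝ => Y z.1 z.2 - Y z.1 t₀) (𝓝 (x₀, t₀)) (𝓝 0) :=
    squeeze_zero_norm (fun z => norm_sub_le_of_isIntegralCurve (hY z.1) hL t₀ z.2) htime
  simpa [ContinuousAt] using hdiff.add (hspace.comp (continuous_fst.tendsto (x₀, t₀)))

end ODE

section Miranda

theorem abs_sub_lt_pi_of_cos_pos {X : Type*} [TopologicalSpace X] {S : Set X}
    (hS : IsPreconnected S) {θ : X → ℝ} (hθ : ContinuousOn θ S) {c : ℝ}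
    (hcos : ∀ z ∈ S, 0 < Real.cos (θ z - c)) {z w : X} (hz : z ∈ S) (hw : w ∈ S) :
    |θ z - θ w| < Real.pi := by
  wlog hle : θ w ≤ θ z generalizing z w
  · rw [abs_sub_comm]
    exact this hw hz (le_of_not_ge hle)
  rw [abs_of_nonneg (sub_nonneg.2 hle)]
  by_contra! hpi
  obtain ⟨x, hxS, hx⟩ := hS.intermediate_value hw hz hθ
    (show θ w + Real.pi ∈ Icc (θ w) (θ z) from ⟨by linarith [Real.pi_pos], by linarith⟩)
  have hcos_x := hcos x hxS
  rw [hx, add_sub_right_comm, Real.cos_add_pi] at hcos_x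
  linarith [hcos w hw]

theorem pos_of_sin_pos_of_abs_lt_pi {x : ℝ} (hsin : 0 < Real.sin x) (hx : |x| < Real.pi) :
    0 < x := by
  by_contra! hle
  linarith [Real.sin_nonpos_of_nonpos_of_neg_pi_le hle (abs_lt.1 hx).1.le]

theorem exists_continuous_polar_angle {X : Type*} [TopologicalSpace X]
    [LocallyPathConnectedSpace X] (hX : IsSimplyConnected (univ : Set X)) {F G : X → ℝ}
    (hF : Continuous F) (hG : Continuous G) (hFG : ∀ z, F z = 0 → G z ≠ 0) :
    ∃ θ : X → ℝ, Continuous θ ∧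
      ∀ z, ∃ r > 0, F z = r * Real.cos (θ z) ∧ G z = r * Real.sin (θ z) := by
  obtain ⟨L, hL, hexp⟩ := Complex.exists_continuousOn_eqOn_exp_comp hX isOpen_univ
    (g := fun z => (F z : ℂ) + (G z : ℂ) * Complex.I) (by fun_prop) (by
      rintro ⟨z, -, hz⟩
      exact hFG z (by simpa using congrArg Complex.re hz) (by simpa using congrArg Complex.im hz))
  refine ⟨fun z => (L z).im, Complex.continuous_im.comp (continuousOn_univ.1 hL),
    fun z => ⟨Real.exp (L z).re, Real.exp_pos _, ?_, ?_⟩⟩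
  · simpa [Complex.exp_re] using (congrArg Complex.re (hexp (mem_univ z))).symm
  · simpa [Complex.exp_im] using (congrArg Complex.im (hexp (mem_univ z))).symm

/-- A continuous angle turns by less than `π` along each side of the rectangle, so the quadrants of
its values at the corners force it to increase along all four sides of the boundary loop. -/
theorem not_forall_side_half_plane {a b c d : ℝ} (hab : a ≤ b) (hcd : c ≤ d) {θ : ℝ × ℝ → ℝ}
    (hθ : Continuous θ) (hleft : ∀ y ∈ Icc c d, Real.cos (θ (a, y)) < 0)
    (hright : ∀ y ∈ Icc c d, 0 < Real.cos (θ (b, y)))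
    (hbot : ∀ x ∈ Icc a b, Real.sin (θ (x, c)) < 0)
    (htop : ∀ x ∈ Icc a b, 0 < Real.sin (θ (x, d))) : False := by
  have ha := left_mem_Icc.2 hab
  have hb := right_mem_Icc.2 hab
  have hc := left_mem_Icc.2 hcd
  have hd := right_mem_Icc.2 hcd
  have vertical (x : ℝ) : ContinuousOn (fun y => θ (x, y)) (Icc c d) := by fun_prop
  have horizontal (y : ℝ) : ContinuousOn (fun x => θ (x, y)) (Icc a b) := by fun_prop
  have turn_right : 0 < θ (b, d) - θ (b, c) := pos_of_sin_pos_of_abs_lt_pi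
    (by rw [Real.sin_sub]; nlinarith [hright c hc, hright d hd, hbot b hb, htop b hb])
    (abs_sub_lt_pi_of_cos_pos isPreconnected_Icc (vertical b) (c := 0) (by simpa using hright)
      hd hc)
  have turn_top : 0 < θ (a, d) - θ (b, d) := pos_of_sin_pos_of_abs_lt_pi
    (by rw [Real.sin_sub]; nlinarith [hleft d hd, hright d hd, htop a ha, htop b hb])
    (abs_sub_lt_pi_of_cos_pos isPreconnected_Icc (horizontal d) (c := Real.pi / 2)
      (by simpa [Real.cos_sub_pi_div_two] using htop) ha hb)
  have turn_left : 0 < θ (a, c) - θ (a, d) := pos_of_sin_pos_of_abs_lt_pi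
    (by rw [Real.sin_sub]; nlinarith [hleft c hc, hleft d hd, hbot a ha, htop a ha])
    (abs_sub_lt_pi_of_cos_pos isPreconnected_Icc (vertical a) (c := Real.pi)
      (by simpa using hleft) hc hd)
  have turn_bot : 0 < θ (b, c) - θ (a, c) := pos_of_sin_pos_of_abs_lt_pi
    (by rw [Real.sin_sub]; nlinarith [hleft c hc, hright c hc, hbot a ha, hbot b hb])
    (abs_sub_lt_pi_of_cos_pos isPreconnected_Icc (horizontal c) (c := -(Real.pi / 2))
      (by simpa [Real.cos_add_pi_div_two] using hbot) hb ha)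
  linarith

theorem exists_zero_of_sign_changes {a b c d : ℝ} (hab : a ≤ b) (hcd : c ≤ d)
    {F G : ℝ × ℝ → ℝ} (hF : ContinuousOn F (Icc a b ×ˢ Icc c d))
    (hG : ContinuousOn G (Icc a b ×ˢ Icc c d))
    (hleft : ∀ y ∈ Icc c d, F (a, y) < 0) (hright : ∀ y ∈ Icc c d, 0 < F (b, y))
    (hbot : ∀ x ∈ Icc a b, G (x, c) < 0) (htop : ∀ x ∈ Icc a b, 0 < G (x, d)) :
    ∃ z ∈ Icc a b ×ˢ Icc c d, F z = 0 ∧ G z = 0 := by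
  by_contra! hne
  set P : ℝ × ℝ → ℝ × ℝ := fun z => (projIcc a b hab z.1, projIcc c d hcd z.2) with hP
  have hPcont : Continuous P := by fun_prop
  have hPmem (z) : P z ∈ Icc a b ×ˢ Icc c d := ⟨Subtype.prop _, Subtype.prop _⟩
  have hPid {x y} (hx : x ∈ Icc a b) (hy : y ∈ Icc c d) : P (x, y) = (x, y) := by
    simp only [hP, projIcc_of_mem hab hx, projIcc_of_mem hcd hy]
  have hsc : IsSimplyConnected (univ : Set (ℝ × ℝ)) := by
    have := (convex_univ (𝕜 := ℝ) (E := ℝ × ℝ)).contractibleSpace univ_nonempty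
    exact inferInstanceAs (SimplyConnectedSpace (univ : Set (ℝ × ℝ)))
  obtain ⟨θ, hθ, hpolar⟩ := exists_continuous_polar_angle hsc (hF.comp_continuous hPcont hPmem)
    (hG.comp_continuous hPcont hPmem) fun z => hne (P z) (hPmem z)
  have polar {x y} (hx : x ∈ Icc a b) (hy : y ∈ Icc c d) : ∃ r > 0,
      F (x, y) = r * Real.cos (θ (x, y)) ∧ G (x, y) = r * Real.sin (θ (x, y)) := by
    simpa only [Function.comp_apply, hPid hx hy] using hpolar (x, y)
  refine not_forall_side_half_plane hab hcd hθ (fun y hy => ?_) (fun y hy => ?_)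
    (fun x hx => ?_) (fun x hx => ?_)
  · obtain ⟨r, hr, hcos, -⟩ := polar (left_mem_Icc.2 hab) hy
    exact (pos_iff_neg_of_mul_neg (hcos ▸ hleft y hy)).1 hr
  · obtain ⟨r, hr, hcos, -⟩ := polar (right_mem_Icc.2 hab) hy
    exact (mul_pos_iff_of_pos_left hr).1 (hcos ▸ hright y hy)
  · obtain ⟨r, hr, -, hsin⟩ := polar hx (left_mem_Icc.2 hcd)
    exact (pos_iff_neg_of_mul_neg (hsin ▸ hbot x hx)).1 hr
  · obtain ⟨r, hr, -, hsin⟩ := polar hx (right_mem_Icc.2 hcd)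
    exact (mul_pos_iff_of_pos_left hr).1 (hsin ▸ htop x hx)

end Miranda

section TangentSpaces

variable {M : Type*} [TopologicalSpace M] [ChartedSpace E3 M]
  {F : Type*} [NormedAddCommGroup F] [NormedSpace ℝ F]

/-- The derivative at `q` of a vector-valued function on `M`. Tangent spaces are definitionally the
model space `E3`, which makes derivatives at different points comparable. -/
noncomputable def chartDeriv (h : M → F) (q : M) : E3 →L[ℝ] F := mfderiv (𝓡 3) 𝓘(ℝ, F) h q

theorem chartDeriv_eq_fderiv {h : M → F} {r : M} (hh : MDifferentiableAt (𝓡 3) 𝓘(ℝ, F) h r) :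
    chartDeriv h r = fderiv ℝ (h ∘ (extChartAt (𝓡 3) r).symm) (extChartAt (𝓡 3) r r) := by
  have hderiv : HasFDerivWithinAt (h ∘ (extChartAt (𝓡 3) r).symm) (chartDeriv h r) (range (𝓡 3))
      (extChartAt (𝓡 3) r r) := hh.hasMFDerivAt.2
  simp only [mfld_simps, hasFDerivWithinAt_univ] at hderiv
  exact hderiv.fderiv.symm

theorem chartDeriv_isLittleO_sub {h : M → F} {r : M} (hh : ContMDiffAt (𝓡 3) 𝓘(ℝ, F) 1 h r) :
    (fun z : M × M => h z.2 - h z.1 - chartDeriv h r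
      (extChartAt (𝓡 3) r z.2 - extChartAt (𝓡 3) r z.1)) =o[𝓝 (r, r)]
    fun z : M × M => extChartAt (𝓡 3) r z.2 - extChartAt (𝓡 3) r z.1 := by
  set φ := extChartAt (𝓡 3) r
  have hstrict : HasStrictFDerivAt (h ∘ φ.symm) (chartDeriv h r) (φ r) := by
    rw [chartDeriv_eq_fderiv (hh.mdifferentiableAt one_ne_zero)]
    have hread : ContDiffAt ℝ 1 (h ∘ φ.symm) (φ r) := by
      simpa [contDiffWithinAt_univ] using! (contMDiffAt_iff.1 hh).2
    exact hread.hasStrictFDerivAt one_ne_zero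
  have hφ : Tendsto (fun z : M × M => (φ z.2, φ z.1)) (𝓝 (r, r)) (𝓝 (φ r, φ r)) := by
    have hc := continuousAt_extChartAt (I := 𝓡 3) r
    exact (hc.comp_of_eq (f := Prod.snd) (x := (r, r)) continuousAt_snd rfl).prodMk_nhds
      (hc.comp_of_eq (f := Prod.fst) (x := (r, r)) continuousAt_fst rfl)
  refine (hstrict.isLittleO.comp_tendsto hφ).congr' ?_ EventuallyEq.rfl
  have hsource := extChartAt_source_mem_nhds (I := 𝓡 3) r
  filter_upwards [prod_mem_nhds hsource hsource] with z hz
  simp only [Function.comp_apply, φ.left_inv hz.1, φ.left_inv hz.2]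

variable [IsManifold (𝓡 3) ∞ M]

open scoped Bundle in
theorem SmoothMetric.continuous_inner_self (g : SmoothMetric M) :
    Continuous (fun z : TangentBundle (𝓡 3) M => g.inner z.1 z.2 z.2) := by
  let _ : Bundle.RiemannianBundle (fun x : M => TangentSpace (𝓡 3) x) := ⟨g.toRiemannianMetric⟩
  have : IsContinuousRiemannianBundle E3 (fun x : M => TangentSpace (𝓡 3) x) :=
    ⟨g.inner, g.contMDiff.continuous, fun _ _ _ => rfl⟩
  exact Continuous.inner_bundle (F := E3) (E := fun x : M => TangentSpace (𝓡 3) x)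
    (b := fun z : TangentBundle (𝓡 3) M => z.1) (v := fun z => z.2) (w := fun z => z.2)
    continuous_id continuous_id

theorem SmoothMetric.continuous_tnorm (g : SmoothMetric M) :
    Continuous (fun z : TangentBundle (𝓡 3) M => g.tnorm z.1 z.2) :=
  Real.continuous_sqrt.comp g.continuous_inner_self

theorem SmoothMetric.tnorm_nonneg (g : SmoothMetric M) (x : M) (v : TangentSpace (𝓡 3) x) :
    0 ≤ g.tnorm x v := Real.sqrt_nonneg _

theorem SmoothMetric.tnorm_pos (g : SmoothMetric M) (x : M) {v : TangentSpace (𝓡 3) x}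
    (hv : v ≠ 0) : 0 < g.tnorm x v := Real.sqrt_pos.2 (g.pos x v hv)

theorem SmoothMetric.tnorm_smul (g : SmoothMetric M) (x : M) (a : ℝ) (v : TangentSpace (𝓡 3) x) :
    g.tnorm x (a • v) = |a| * g.tnorm x v := by
  unfold SmoothMetric.tnorm
  simp only [map_smul, _root_.smul_apply, smul_eq_mul]
  rw [← mul_assoc, Real.sqrt_mul (mul_self_nonneg a), Real.sqrt_mul_self_eq_abs]

theorem continuousAt_chartDeriv_apply {h : M → F} {U : Set M} (hU : IsOpen U)
    (hh : ContMDiffOn (𝓡 3) 𝓘(ℝ, F) 1 h U) {V : (x : M) → TangentSpace (𝓡 3) x} {q : M}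
    (hq : q ∈ U) (hV : ContinuousAt (fun x => (⟨x, V x⟩ : TangentBundle (𝓡 3) M)) q) :
    ContinuousAt (fun x => chartDeriv h x (V x)) q := by
  have hT : ContinuousAt (tangentMapWithin (𝓡 3) 𝓘(ℝ, F) h U) ⟨q, V q⟩ :=
    (hh.continuousOn_tangentMapWithin le_rfl hU.uniqueMDiffOn).continuousAt
      ((hU.preimage (FiberBundle.continuous_proj E3 _)).mem_nhds hq)
  have hsnd : Continuous (fun z : TangentBundle 𝓘(ℝ, F) F => (z.2 : F)) :=
    (contMDiff_snd_tangentBundle_modelSpace F 𝓘(ℝ, F) (n := 0)).continuous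
  refine (hsnd.continuousAt.comp (ContinuousAt.comp
    (f := fun x => (⟨x, V x⟩ : TangentBundle (𝓡 3) M)) hT hV)).congr ?_
  filter_upwards [hU.mem_nhds hq] with x hx
  simp only [Function.comp, tangentMapWithin, mfderivWithin_of_isOpen hU hx]
  rfl

theorem IsContinuousLineBundle.exists_local_section {E : TangentField M}
    (hE : IsContinuousLineBundle E) (x₀ : M) :
    ∃ V : (x : M) → TangentSpace (𝓡 3) x, ∀ᶠ x in 𝓝 x₀,
      ContinuousAt (fun x => (⟨x, V x⟩ : TangentBundle (𝓡 3) M)) x ∧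
      V x ≠ 0 ∧ E x = Submodule.span ℝ {V x} := by
  obtain ⟨U, hU, V, hV, hVE⟩ := hE x₀
  refine ⟨V, ?_⟩
  filter_upwards [eventually_mem_nhds_iff.2 hU] with x hx
  exact ⟨hV.continuousAt hx, hVE x (mem_of_mem_nhds hx)⟩

end TangentSpaces

section DualFunctionals

variable {ι F : Type*} [Fintype ι] [DecidableEq ι] [NormedAddCommGroup F] [InnerProductSpace ℝ F]

/-- For linearly independent `v`, the functional dual to `v i`: it vanishes at the other `v j` and
on the orthogonal complement of their span. The Gram matrix makes its dependence on `v` explicit. -/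
noncomputable def dualFunctional (v : ι → F) (i : ι) : F →L[ℝ] ℝ :=
  ∑ j, (Matrix.gram ℝ v)⁻¹ i j • innerSL ℝ (v j)

theorem dualFunctional_apply_self {v : ι → F} (hv : LinearIndependent ℝ v) (i j : ι) :
    dualFunctional v i (v j) = if i = j then 1 else 0 := by
  have hunit : IsUnit (Matrix.gram ℝ v).det :=
    (Matrix.posDef_gram_of_linearIndependent hv).det_pos.ne'.isUnit
  rw [← Matrix.one_apply, ← Matrix.nonsing_inv_mul _ hunit]
  simp [dualFunctional, Matrix.mul_apply, Matrix.gram]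

theorem dualFunctional_sum {v : ι → F} (hv : LinearIndependent ℝ v) (i : ι) (a : ι → ℝ) :
    dualFunctional v i (∑ j, a j • v j) = a i := by
  simp [dualFunctional_apply_self hv]

theorem sum_dualFunctional {v : ι → F} (hv : LinearIndependent ℝ v) {w : F}
    (hw : w ∈ Submodule.span ℝ (range v)) : ∑ i, dualFunctional v i w • v i = w := by
  obtain ⟨a, rfl⟩ := (Submodule.mem_span_range_iff_exists_fun ℝ).1 hw
  simp only [dualFunctional_sum hv]

theorem norm_le_mul_sum_abs_dualFunctional {v : ι → F} (hv : LinearIndependent ℝ v) {w : F}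
    (hw : w ∈ Submodule.span ℝ (range v)) :
    ‖w‖ ≤ (∑ i, ‖v i‖) * ∑ i, |dualFunctional v i w| := by
  calc ‖w‖ = ‖∑ i, dualFunctional v i w • v i‖ := by rw [sum_dualFunctional hv hw]
    _ ≤ ∑ i, (∑ j, ‖v j‖) * |dualFunctional v i w| := by
      refine norm_sum_le_of_le _ fun i hi => ?_
      rw [norm_smul, Real.norm_eq_abs, mul_comm]
      gcongr
      exact Finset.single_le_sum (f := fun j => ‖v j‖) (fun _ _ => norm_nonneg _) hi
    _ = _ := (Finset.mul_sum _ _ _).symm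

theorem continuousAt_dualFunctional {v : ι → F} (hv : LinearIndependent ℝ v) (i : ι) :
    ContinuousAt (fun v => dualFunctional v i) v := by
  have hgram : Continuous fun v : ι → F => Matrix.gram ℝ v := by
    unfold Matrix.gram
    fun_prop
  have hinv : ContinuousAt (fun v : ι → F => (Matrix.gram ℝ v)⁻¹) v := by
    refine (continuousAt_matrix_inv _ ?_).comp hgram.continuousAt
    simpa only [Ring.inverse_eq_inv'] using
      continuousAt_inv₀ (Matrix.posDef_gram_of_linearIndependent hv).det_pos.ne'
  refine tendsto_finsetSum _ fun j _ => Tendsto.smul ?_ ?_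
  · exact ((continuous_apply_apply i j).tendsto _).comp hinv
  · exact ((innerSL ℝ).continuous.comp (continuous_apply j)).tendsto v

theorem dualFunctional_smul (s : ι → ℝˣ) (v : ι → F) (i : ι) :
    dualFunctional (fun j => s j • v j) i = (s i)⁻¹ • dualFunctional v i := by
  have hgram : Matrix.gram ℝ (fun j => s j • v j) =
      Matrix.diagonal (fun j => (s j : ℝ)) * Matrix.gram ℝ v *
        Matrix.diagonal (fun j => (s j : ℝ)) := by
    ext j k
    simp only [Matrix.gram_apply, Units.smul_def, inner_smul_left, inner_smul_right,
      Matrix.mul_diagonal, Matrix.diagonal_mul, conj_trivial]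
    ring
  have hdiag : (Matrix.diagonal fun j => (s j : ℝ))⁻¹ = Matrix.diagonal fun j => (s j : ℝ)⁻¹ :=
    Matrix.inv_eq_left_inv (by simp)
  unfold dualFunctional
  rw [hgram, Matrix.mul_inv_rev, Matrix.mul_inv_rev, hdiag, Finset.smul_sum]
  refine Finset.sum_congr rfl fun j _ => ?_
  simp only [Matrix.diagonal_mul, Matrix.mul_diagonal, Units.smul_def, map_smul, smul_smul,
    Units.val_inv_eq_inv_val]
  rw [mul_assoc, mul_assoc, inv_mul_cancel₀ (s j).ne_zero, mul_one]

theorem abs_dualFunctional_smul {s : ι → ℝˣ} {i : ι} (hs : |(s i : ℝ)| = 1) (v : ι → F) (w : F) :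
    |dualFunctional (fun j => s j • v j) i w| = |dualFunctional v i w| := by
  rw [dualFunctional_smul, _root_.smul_apply, Units.smul_def, smul_eq_mul, abs_mul,
    Units.val_inv_eq_inv_val, abs_inv, hs, inv_one, one_mul]

end DualFunctionals

section Frames

variable {M : Type*} [TopologicalSpace M] [ChartedSpace E3 M]

/-- The subspace `E x`, seen in the model space. -/
def modelFiber (E : TangentField M) (x : M) : Submodule ℝ E3 := E x

/-- The derivative at `q` of a self-map of `M`, as a map of the model space. -/
noncomputable def chartMapDeriv (f : M → M) (q : M) : E3 →L[ℝ] E3 := mfderiv (𝓡 3) (𝓡 3) f q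

theorem chartMapDeriv_id (r : M) : chartMapDeriv (id : M → M) r = ContinuousLinearMap.id ℝ E3 :=
  mfderiv_id

theorem chartDeriv_comp {F : Type*} [NormedAddCommGroup F] [NormedSpace ℝ F] {e : M → F}
    {f : M → M} {r : M} (he : ContMDiffAt (𝓡 3) 𝓘(ℝ, F) 1 e (f r))
    (hf : ContMDiffAt (𝓡 3) (𝓡 3) 1 f r) :
    chartDeriv (e ∘ f) r = chartDeriv e (f r) ∘L chartMapDeriv f r :=
  mfderiv_comp r (he.mdifferentiableAt one_ne_zero) (hf.mdifferentiableAt one_ne_zero)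

variable [IsManifold (𝓡 3) ∞ M]

theorem continuousAt_smul_section {c : M → ℝ} {V : (x : M) → TangentSpace (𝓡 3) x} {q : M}
    (hc : ContinuousAt c q)
    (hV : ContinuousAt (fun x => (⟨x, V x⟩ : TangentBundle (𝓡 3) M)) q) :
    ContinuousAt (fun x => (⟨x, c x • V x⟩ : TangentBundle (𝓡 3) M)) q := by
  rw [FiberBundle.continuousAt_totalSpace] at hV ⊢
  refine ⟨continuousAt_id, (hc.smul hV.2).congr ?_⟩
  filter_upwards [(trivializationAt E3 (TangentSpace (𝓡 3)) q).open_baseSet.mem_nhds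
    (mem_baseSet_trivializationAt E3 (TangentSpace (𝓡 3)) q)] with x hx
  exact (((trivializationAt E3 (TangentSpace (𝓡 3)) q).linear ℝ hx).map_smul _ _).symm

/-- The norm of a tangent vector, seen as a vector of the model space. -/
noncomputable def SmoothMetric.modelNorm (g : SmoothMetric M) (x : M) (v : E3) : ℝ := g.tnorm x v

theorem SmoothMetric.modelNorm_smul (g : SmoothMetric M) (x : M) (a : ℝ) (v : E3) :
    g.modelNorm x (a • v) = |a| * g.modelNorm x v := g.tnorm_smul x a v

/-- `b` consists of unit vectors spanning the continuous line fields `E i`. Such a frame is unique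
up to signs, for which there may be no continuous choice on `M`. -/
structure IsUnitFrame (g : SmoothMetric M) (E : Fin 3 → TangentField M) (b : M → Fin 3 → E3) :
    Prop where
  lineBundle : ∀ i, IsContinuousLineBundle (E i)
  span_eq : ∀ x i, modelFiber (E i) x = Submodule.span ℝ {b x i}
  norm_eq : ∀ x i, g.modelNorm x (b x i) = 1
  linearIndependent : ∀ x, LinearIndependent ℝ (b x)

theorem IsContinuousLineBundle.exists_unit_generator {E : TangentField M}
    (hE : IsContinuousLineBundle E) (g : SmoothMetric M) (x : M) :
    ∃ v : TangentSpace (𝓡 3) x, g.tnorm x v = 1 ∧ E x = Submodule.span ℝ {v} := by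
  obtain ⟨V, hV⟩ := hE.exists_local_section x
  obtain ⟨-, hne, hspan⟩ := hV.self_of_nhds
  have hpos := g.tnorm_pos x hne
  refine ⟨(g.tnorm x (V x))⁻¹ • V x, ?_, ?_⟩
  · rw [g.tnorm_smul, abs_of_pos (inv_pos.2 hpos), inv_mul_cancel₀ hpos.ne']
  · rw [hspan, Submodule.span_singleton_smul_eq (IsUnit.mk0 _ (inv_ne_zero hpos.ne'))]

theorem exists_isUnitFrame (g : SmoothMetric M) {E : Fin 3 → TangentField M}
    (hE : ∀ i, IsContinuousLineBundle (E i))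
    (hsplit : ∀ x, DirectSum.IsInternal (fun i => E i x)) :
    ∃ b : M → Fin 3 → E3, IsUnitFrame g E b := by
  choose b hnorm hspan using fun x i => (hE i).exists_unit_generator g x
  refine ⟨b, hE, hspan, hnorm, fun x => ?_⟩
  refine (hsplit x).submodule_iSupIndep.linearIndependent (fun i => E i x) (v := b x)
    (fun i => ?_) fun i hzero => ?_
  · rw [hspan x i]
    exact Submodule.mem_span_singleton_self _
  · simpa [hzero, SmoothMetric.tnorm] using hnorm x i

variable {g : SmoothMetric M} {E : Fin 3 → TangentField M} {b : M → Fin 3 → E3}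

namespace IsUnitFrame

theorem mem (hb : IsUnitFrame g E b) (x : M) (i : Fin 3) : b x i ∈ modelFiber (E i) x := by
  rw [hb.span_eq]
  exact Submodule.mem_span_singleton_self _

theorem exists_smul (hb : IsUnitFrame g E b) {x : M} {i : Fin 3} {v : E3}
    (hv : v ∈ modelFiber (E i) x) : ∃ a : ℝ, v = a • b x i ∧ g.modelNorm x v = |a| := by
  rw [hb.span_eq] at hv
  obtain ⟨a, rfl⟩ := Submodule.mem_span_singleton.1 hv
  exact ⟨a, rfl, by rw [g.modelNorm_smul, hb.norm_eq, mul_one]⟩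

theorem span_range (hb : IsUnitFrame g E b) (x : M) : Submodule.span ℝ (range (b x)) = ⊤ :=
  (hb.linearIndependent x).span_eq_top_of_card_eq_finrank' (by simp)

theorem exists_sign_smul_eq (hb : IsUnitFrame g E b) {x : M} {i : Fin 3}
    {v : TangentSpace (𝓡 3) x} (hv : v ∈ E i x) (hne : v ≠ 0) :
    ∃ s : ℝˣ, |(s : ℝ)| = 1 ∧ (s • b x i : E3) = (g.tnorm x v)⁻¹ • v := by
  obtain ⟨a, hva, hnorm⟩ := hb.exists_smul (v := v) hv
  have habs : g.tnorm x v = |a| := hnorm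
  have ha : a ≠ 0 := abs_pos.1 (habs ▸ g.tnorm_pos x hne)
  refine ⟨Units.mk0 (|a|⁻¹ * a) (by positivity), ?_, ?_⟩
  · rw [Units.val_mk0, abs_mul, abs_inv, abs_abs, inv_mul_cancel₀ (abs_ne_zero.2 ha)]
  · rw [habs, Units.smul_mk0, mul_smul]
    exact congrArg (fun w : E3 => |a|⁻¹ • w) hva.symm

theorem exists_continuousAt_signs (hb : IsUnitFrame g E b) (r : M) :
    ∃ s : M → Fin 3 → ℝˣ, ∀ᶠ q in 𝓝 r, ∀ i, |(s q i : ℝ)| = 1 ∧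
      ContinuousAt (fun x => (⟨x, (s x i • b x i : E3)⟩ : TangentBundle (𝓡 3) M)) q := by
  choose V hV using fun i => (hb.lineBundle i).exists_local_section r
  have hsign (q : M) (i : Fin 3) : ∃ s : ℝˣ, V i q ≠ 0 ∧ E i q = Submodule.span ℝ {V i q} →
      |(s : ℝ)| = 1 ∧ (s • b q i : E3) = (g.tnorm q (V i q))⁻¹ • V i q := by
    by_cases hgood : V i q ≠ 0 ∧ E i q = Submodule.span ℝ {V i q}
    · obtain ⟨s, hs⟩ := hb.exists_sign_smul_eq (i := i) (v := V i q)
        (by rw [hgood.2]; exact Submodule.mem_span_singleton_self _) hgood.1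
      exact ⟨s, fun _ => hs⟩
    · exact ⟨1, fun h => absurd h hgood⟩
  choose s hs using hsign
  refine ⟨s, eventually_all.2 fun i => ?_⟩
  filter_upwards [(hV i).eventually_nhds] with q hq
  obtain ⟨hcont, hne, hspan⟩ := hq.self_of_nhds
  refine ⟨(hs q i ⟨hne, hspan⟩).1, ?_⟩
  have hnorm : ContinuousAt (fun x => g.tnorm x (V i x)) q :=
    ContinuousAt.comp (g := fun z : TangentBundle (𝓡 3) M => g.tnorm z.1 z.2)
      g.continuous_tnorm.continuousAt hcont
  refine (continuousAt_smul_section (hnorm.inv₀ (g.tnorm_pos q hne).ne') hcont).congr ?_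
  filter_upwards [hq] with x hx
  exact congrArg (Bundle.TotalSpace.mk x) (hs x i hx.2).2.symm

theorem continuousAt_norm_chartDeriv {F : Type*} [NormedAddCommGroup F] [NormedSpace ℝ F]
    (hb : IsUnitFrame g E b) {h : M → F} {U : Set M} (hU : IsOpen U)
    (hh : ContMDiffOn (𝓡 3) 𝓘(ℝ, F) 1 h U) {r : M} (hr : r ∈ U) (i : Fin 3) :
    ContinuousAt (fun q => ‖chartDeriv h q (b q i)‖) r := by
  obtain ⟨s, hs⟩ := hb.exists_continuousAt_signs r
  refine (continuousAt_chartDeriv_apply hU hh hr (hs.self_of_nhds i).2).norm.congr ?_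
  filter_upwards [hs] with q hq
  change ‖chartDeriv h q ((s q i : ℝ) • b q i)‖ = _
  rw [map_smul, norm_smul, Real.norm_eq_abs, (hq i).1, one_mul]

theorem exists_norm_chartDeriv_le [CompactSpace M] {F : Type*} [NormedAddCommGroup F]
    [NormedSpace ℝ F] (hb : IsUnitFrame g E b) {h : M → F} (hh : ContMDiff (𝓡 3) 𝓘(ℝ, F) 1 h)
    (i : Fin 3) :
    ∃ C, 0 ≤ C ∧ ∀ q, ∀ v ∈ modelFiber (E i) q, ‖chartDeriv h q v‖ ≤ C * g.modelNorm q v := by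
  obtain ⟨C, hC⟩ := isCompact_univ.exists_bound_of_continuousOn
    (f := fun q => ‖chartDeriv h q (b q i)‖) fun q _ =>
      (hb.continuousAt_norm_chartDeriv isOpen_univ hh.contMDiffOn (mem_univ q) i).continuousWithinAt
  refine ⟨max C 0, le_max_right _ _, fun q v hv => ?_⟩
  obtain ⟨a, rfl, hnorm⟩ := hb.exists_smul hv
  rw [hnorm, map_smul, norm_smul, Real.norm_eq_abs, mul_comm]
  gcongr
  exact (norm_norm (chartDeriv h q (b q i)) ▸ hC q (mem_univ q)).trans (le_max_left _ _)

end IsUnitFrame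

end Frames

section Separation

theorem isLittleO_apply_sub_of_tendsto {α F G W : Type*} [NormedAddCommGroup F] [NormedSpace ℝ F]
    [NormedAddCommGroup G] [NormedSpace ℝ G] [NormedAddCommGroup W] {l : Filter α}
    {B : α → F →L[ℝ] G} {B₀ : F →L[ℝ] G} {δ δ₀ : α → F} {w : α → W} (hB : Tendsto B l (𝓝 B₀))
    (hδ₀ : δ₀ =O[l] w) (hδ : (fun z => δ z - δ₀ z) =o[l] w) :
    (fun z => B z (δ z) - B₀ (δ₀ z)) =o[l] w := by
  have hδw : δ =O[l] w := by simpa using hδ.isBigO.add hδ₀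
  have hB' : (fun z => B z - B₀) =o[l] fun _ => (1 : ℝ) :=
    (Asymptotics.isLittleO_one_iff ℝ).2 (by simpa using hB.sub_const B₀)
  have hoperator : (fun z => (B z - B₀) (δ z)) =o[l] w := by
    have hprod : (fun z => ‖B z - B₀‖ * ‖δ z‖) =o[l] fun z => (1 : ℝ) * ‖w z‖ :=
      hB'.norm_left.mul_isBigO hδw.norm_norm
    simp only [one_mul] at hprod
    refine (Asymptotics.IsBigO.of_bound 1 (Eventually.of_forall fun z => ?_)).trans_isLittleO
      hprod.of_norm_right
    rw [one_mul, norm_mul, norm_norm, norm_norm]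
    exact ContinuousLinearMap.le_opNorm _ _
  refine (hoperator.add ((B₀.isBigO_comp _ _).trans_isLittleO hδ)).congr_left fun z => ?_
  simp

variable {M : Type*} [TopologicalSpace M] [ChartedSpace E3 M] {F : Type*} [NormedAddCommGroup F]

/-- A `C¹` immersion of `M` into a vector space. An immersion into a Euclidean space is used to
compare nearby points of `M` globally. -/
structure IsC1Immersion [NormedSpace ℝ F] (e : M → F) : Prop where
  contMDiff : ContMDiff (𝓡 3) 𝓘(ℝ, F) 1 e
  injective_chartDeriv : ∀ x, Function.Injective (chartDeriv e x)

/-- Difference of the positions of two points in the chart at `r`. -/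
noncomputable def chartDiff (r : M) (z : M × M) : E3 :=
  extChartAt (𝓡 3) r z.2 - extChartAt (𝓡 3) r z.1

variable [InnerProductSpace ℝ F] {e : M → F} {b : M → Fin 3 → E3} {f : M → M} {k : Fin 3}

/-- The image of the frame under the derivative of `e`. -/
noncomputable def pushedFrame (e : M → F) (b : M → Fin 3 → E3) (q : M) : Fin 3 → F :=
  fun j => chartDeriv e q (b q j)

/-- The size of the `i`-th component of the displacement from `p` to `q`, measured through `e`. -/
noncomputable def separation (e : M → F) (b : M → Fin 3 → E3) (i : Fin 3) (p q : M) : ℝ :=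
  |dualFunctional (pushedFrame e b p) i (e q - e p)|

theorem separation_nonneg (i : Fin 3) (p q : M) : 0 ≤ separation e b i p q := abs_nonneg _

/-- The total separation in the directions other than `k`. -/
noncomputable def transverseSeparation (e : M → F) (b : M → Fin 3 → E3) (k : Fin 3) (p q : M) : ℝ :=
  ∑ j ∈ Finset.univ.erase k, separation e b j p q

theorem sum_separation (k : Fin 3) (p q : M) :
    ∑ i, separation e b i p q = separation e b k p q + transverseSeparation e b k p q :=
  (Finset.add_sum_erase _ _ (Finset.mem_univ k)).symm

theorem transverseSeparation_nonneg (k : Fin 3) (p q : M) : 0 ≤ transverseSeparation e b k p q :=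
  Finset.sum_nonneg fun _ _ => separation_nonneg _ _ _

variable [IsManifold (𝓡 3) ∞ M] {g : SmoothMetric M} {E : Fin 3 → TangentField M}

namespace IsUnitFrame

theorem linearIndependent_pushedFrame (hb : IsUnitFrame g E b) (he : IsC1Immersion e) (q : M) :
    LinearIndependent ℝ (pushedFrame e b q) :=
  (hb.linearIndependent q).map' (chartDeriv e q).toLinearMap
    (LinearMap.ker_eq_bot.2 (he.injective_chartDeriv q))

theorem dualFunctional_pushedFrame (hb : IsUnitFrame g E b) (he : IsC1Immersion e) (q : M)
    (i : Fin 3) (w : E3) :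
    dualFunctional (pushedFrame e b q) i (chartDeriv e q w) = dualFunctional (b q) i w := by
  have hw : chartDeriv e q w = ∑ j, dualFunctional (b q) j w • pushedFrame e b q j := by
    conv_lhs => rw [← sum_dualFunctional (hb.linearIndependent q) (w := w)
      (hb.span_range q ▸ Submodule.mem_top)]
    simp only [map_sum, map_smul, pushedFrame]
  rw [hw, dualFunctional_sum (hb.linearIndependent_pushedFrame he q)]

theorem exists_signs_tendsto_dualFunctional (hb : IsUnitFrame g E b) (he : IsC1Immersion e) (r : M)
    (i : Fin 3) :
    ∃ s : M → Fin 3 → ℝˣ, (∀ᶠ q in 𝓝 r, |(s q i : ℝ)| = 1) ∧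
      ContinuousAt (fun q => dualFunctional (fun j => s q j • pushedFrame e b q j) i) r := by
  obtain ⟨s, hs⟩ := hb.exists_continuousAt_signs r
  refine ⟨s, hs.mono fun q hq => (hq i).1, ?_⟩
  have hframe : ContinuousAt (fun q j => s q j • pushedFrame e b q j) r := by
    refine continuousAt_pi.2 fun j => ?_
    refine (continuousAt_chartDeriv_apply isOpen_univ he.contMDiff.contMDiffOn (mem_univ r)
      (hs.self_of_nhds j).2).congr (Eventually.of_forall fun q => ?_)
    exact map_smul (chartDeriv e q) (s q j : ℝ) (b q j)
  exact (continuousAt_dualFunctional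
    ((hb.linearIndependent_pushedFrame he r).units_smul (s r)) i).comp_of_eq hframe rfl

theorem separation_isLittleO (hb : IsUnitFrame g E b) (he : IsC1Immersion e) {r : M}
    (hf : ContMDiffAt (𝓡 3) (𝓡 3) 1 f r) (i : Fin 3) :
    (fun z : M × M => separation e b i (f z.1) (f z.2) -
      |dualFunctional (b (f r)) i (chartMapDeriv f r (chartDiff r z))|) =o[𝓝 (r, r)]
      chartDiff r := by
  obtain ⟨s, hs, hcont⟩ := hb.exists_signs_tendsto_dualFunctional he (f r) i
  have hfst : Tendsto (fun z : M × M => f z.1) (𝓝 (r, r)) (𝓝 (f r)) :=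
    ContinuousAt.comp (x := (r, r)) (f := Prod.fst) (g := f) hf.continuousAt continuousAt_fst
  have hsigned := isLittleO_apply_sub_of_tendsto (hcont.tendsto.comp hfst)
    ((chartDeriv (e ∘ f) r).isBigO_comp (chartDiff r) _)
    (chartDeriv_isLittleO_sub (he.contMDiff.contMDiffAt.comp r hf))
  refine (Asymptotics.IsBigO.of_bound 1 ?_).trans_isLittleO hsigned
  filter_upwards [hfst.eventually hs] with z hz
  have hdisplacement : separation e b i (f z.1) (f z.2) = |dualFunctional
      (fun j => s (f z.1) j • pushedFrame e b (f z.1) j) i (e (f z.2) - e (f z.1))| :=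
    (abs_dualFunctional_smul hz _ _).symm
  have hlinear : |dualFunctional (b (f r)) i (chartMapDeriv f r (chartDiff r z))| =
      |dualFunctional (fun j => s (f r) j • pushedFrame e b (f r) j) i
        (chartDeriv (e ∘ f) r (chartDiff r z))| := by
    rw [abs_dualFunctional_smul hs.self_of_nhds, chartDeriv_comp he.contMDiff.contMDiffAt hf,
      ContinuousLinearMap.comp_apply, hb.dualFunctional_pushedFrame he]
  rw [hdisplacement, hlinear, one_mul, Real.norm_eq_abs, Real.norm_eq_abs]
  exact abs_abs_sub_abs_le _ _

theorem separation_sub_isLittleO (hb : IsUnitFrame g E b) (he : IsC1Immersion e) (r : M)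
    (i : Fin 3) :
    (fun z : M × M => separation e b i z.1 z.2 - |dualFunctional (b r) i (chartDiff r z)|)
      =o[𝓝 (r, r)] chartDiff r := by
  simpa [chartMapDeriv_id] using hb.separation_isLittleO he (f := id) (r := r) contMDiffAt_id i

theorem exists_chartDiff_le (hb : IsUnitFrame g E b) (he : IsC1Immersion e) (r : M) :
    ∃ C > 0, ∀ᶠ z in 𝓝 (r, r), ‖chartDiff r z‖ ≤ C * ∑ i, separation e b i z.1 z.2 := by
  have hnorm (w : E3) : ‖w‖ ≤ (∑ i, ‖b r i‖) * ∑ i, |dualFunctional (b r) i w| :=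
    norm_le_mul_sum_abs_dualFunctional (hb.linearIndependent r)
      (hb.span_range r ▸ Submodule.mem_top)
  set C := ∑ i, ‖b r i‖
  have hC : 0 < C := Finset.sum_pos
    (fun i _ => norm_pos_iff.2 ((hb.linearIndependent r).ne_zero i)) Finset.univ_nonempty
  refine ⟨2 * C, by positivity, ?_⟩
  have hclose (i : Fin 3) : ∀ᶠ z in 𝓝 (r, r),
      abs (separation e b i z.1 z.2 - |dualFunctional (b r) i (chartDiff r z)|)
        ≤ 1 / (6 * C) * ‖chartDiff r z‖ :=
    Asymptotics.isLittleO_iff.1 (hb.separation_sub_isLittleO he r i) (by positivity)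
  filter_upwards [eventually_all.2 hclose] with z hz
  have hsum : ∑ i, |dualFunctional (b r) i (chartDiff r z)| ≤
      ∑ i, separation e b i z.1 z.2 + 3 * (1 / (6 * C) * ‖chartDiff r z‖) := by
    simp only [Fin.sum_univ_three]
    linarith [(abs_le.1 (hz 0)).1, (abs_le.1 (hz 1)).1, (abs_le.1 (hz 2)).1]
  have herror : C * (3 * (1 / (6 * C) * ‖chartDiff r z‖)) = ‖chartDiff r z‖ / 2 := by
    field_simp
    ring
  linarith [hnorm (chartDiff r z), mul_le_mul_of_nonneg_left hsum hC.le]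

theorem exists_separation_le [CompactSpace M] (hb : IsUnitFrame g E b) (he : IsC1Immersion e) :
    ∃ K, 0 ≤ K ∧ ∀ p i q, separation e b i p q ≤ K * ‖e q - e p‖ := by
  have hcont (i : Fin 3) : Continuous fun p => ‖dualFunctional (pushedFrame e b p) i‖ := by
    refine continuous_iff_continuousAt.2 fun r => ?_
    obtain ⟨s, hs, hs_cont⟩ := hb.exists_signs_tendsto_dualFunctional he r i
    refine hs_cont.norm.congr (hs.mono fun q hq => ?_)
    change ‖dualFunctional (fun j => s q j • pushedFrame e b q j) i‖ = _
    rw [dualFunctional_smul, Units.smul_def, norm_smul, Units.val_inv_eq_inv_val, norm_inv,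
      Real.norm_eq_abs, hq, inv_one, one_mul]
  obtain ⟨K, hK⟩ := isCompact_univ.exists_bound_of_continuousOn
    (continuous_finsetSum Finset.univ fun i _ => hcont i).continuousOn
  refine ⟨max K 0, le_max_right _ _, fun p i q => ?_⟩
  rw [separation, ← Real.norm_eq_abs]
  refine ContinuousLinearMap.le_of_opNorm_le _ ?_ _
  calc ‖dualFunctional (pushedFrame e b p) i‖
      ≤ ∑ i, ‖dualFunctional (pushedFrame e b p) i‖ :=
        Finset.single_le_sum (f := fun i => ‖dualFunctional (pushedFrame e b p) i‖)
          (fun _ _ => norm_nonneg _) (Finset.mem_univ i)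
    _ ≤ K := (le_abs_self _).trans (hK p (mem_univ p))
    _ ≤ max K 0 := le_max_left _ _

end IsUnitFrame

end Separation

section Domination

variable {M : Type*} [TopologicalSpace M] [ChartedSpace E3 M] [IsManifold (𝓡 3) ∞ M]
  {g : SmoothMetric M} {E : Fin 3 → TangentField M} {b : M → Fin 3 → E3} {f : M → M} {k : Fin 3}

/-- The factor by which the derivative of `f` stretches the unit vector `b x i`. -/
noncomputable def stretch (g : SmoothMetric M) (b : M → Fin 3 → E3) (f : M → M) (i : Fin 3)
    (x : M) : ℝ := g.modelNorm (f x) (chartMapDeriv f x (b x i))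

theorem stretch_nonneg (i : Fin 3) (x : M) : 0 ≤ stretch g b f i x := g.tnorm_nonneg _ _

theorem IsUnitFrame.continuous_stretch (hb : IsUnitFrame g E b) (hf : ContMDiff (𝓡 3) (𝓡 3) 1 f)
    (i : Fin 3) : Continuous (stretch g b f i) := by
  refine continuous_iff_continuousAt.2 fun r => ?_
  obtain ⟨s, hs⟩ := hb.exists_continuousAt_signs r
  have hcont := (g.continuous_tnorm.comp (hf.continuous_tangentMap le_rfl)).continuousAt.comp
    (f := fun x => (⟨x, (s x i • b x i : E3)⟩ : TangentBundle (𝓡 3) M)) (hs.self_of_nhds i).2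
  refine hcont.congr ?_
  filter_upwards [hs] with q hq
  change g.modelNorm (f q) (chartMapDeriv f q ((s q i : ℝ) • b q i)) = _
  rw [map_smul, g.modelNorm_smul, (hq i).1, one_mul, stretch]

/-- `f` contracts the line field `E k`, and more strongly than the other two. -/
structure ContractsDominated (g : SmoothMetric M) (E : Fin 3 → TangentField M)
    (b : M → Fin 3 → E3) (f : M → M) (k : Fin 3) : Prop where
  contMDiff : ContMDiff (𝓡 3) (𝓡 3) 1 f
  map_mem : ∀ x i, ∀ v ∈ modelFiber (E i) x, chartMapDeriv f x v ∈ modelFiber (E i) (f x)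
  stretch_lt_one : ∀ x, stretch g b f k x < 1
  stretch_lt : ∀ x, ∀ j ≠ k, stretch g b f k x < stretch g b f j x

namespace ContractsDominated

theorem abs_dualFunctional_chartMapDeriv (hf : ContractsDominated g E b f k)
    (hb : IsUnitFrame g E b) (r : M) (i : Fin 3) (w : E3) :
    |dualFunctional (b (f r)) i (chartMapDeriv f r w)|
      = stretch g b f i r * |dualFunctional (b r) i w| := by
  choose a ha hnorm using fun j => hb.exists_smul (hf.map_mem r j (b r j) (hb.mem r j))
  have hw : chartMapDeriv f r w = ∑ j, (dualFunctional (b r) j w * a j) • b (f r) j := by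
    conv_lhs => rw [← sum_dualFunctional (hb.linearIndependent r) (w := w)
      (hb.span_range r ▸ Submodule.mem_top)]
    simp only [map_sum, map_smul, ha, smul_smul]
  rw [hw, dualFunctional_sum (hb.linearIndependent (f r)), stretch, hnorm i, abs_mul, mul_comm]

variable {F : Type*} [NormedAddCommGroup F] [InnerProductSpace ℝ F] {e : M → F}

theorem separation_map_isLittleO (hf : ContractsDominated g E b f k) (hb : IsUnitFrame g E b)
    (he : IsC1Immersion e) (r : M) (i : Fin 3) :
    (fun z : M × M => separation e b i (f z.1) (f z.2)
      - stretch g b f i r * separation e b i z.1 z.2) =o[𝓝 (r, r)] chartDiff r := by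
  have hdiff := (hb.separation_isLittleO he hf.contMDiff.contMDiffAt (r := r) i).sub
    ((hb.separation_sub_isLittleO he r i).const_mul_left (stretch g b f i r))
  refine hdiff.congr_left fun z => ?_
  rw [hf.abs_dualFunctional_chartMapDeriv hb]
  ring

theorem eventually_abs_separation_map_sub_le (hf : ContractsDominated g E b f k)
    (hb : IsUnitFrame g E b) (he : IsC1Immersion e) (r : M) {ε : ℝ} (hε : 0 < ε) :
    ∀ᶠ z in 𝓝 (r, r), ∀ i, |separation e b i (f z.1) (f z.2) -
      stretch g b f i r * separation e b i z.1 z.2| ≤ ε * ∑ j, separation e b j z.1 z.2 := by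
  obtain ⟨C, hC, hdiff⟩ := hb.exists_chartDiff_le he r
  have hmap (i : Fin 3) := Asymptotics.isLittleO_iff.1 (hf.separation_map_isLittleO hb he r i)
    (div_pos hε hC)
  filter_upwards [hdiff, eventually_all.2 hmap] with z hz hz' i
  refine (hz' i).trans ((mul_le_mul_of_nonneg_left hz (div_pos hε hC).le).trans_eq ?_)
  field_simp

theorem exists_rate_gap (hf : ContractsDominated g E b f k) (r : M) :
    ∃ l μ m, stretch g b f k r < l ∧ l < μ ∧ μ < m ∧ m < 1 ∧
      ∀ j ≠ k, m < stretch g b f j r := by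
  have hm : ∀ᶠ m in 𝓝 (stretch g b f k r), m < 1 ∧ ∀ j ≠ k, m < stretch g b f j r :=
    (eventually_lt_nhds (hf.stretch_lt_one r)).and <| eventually_all.2 fun j =>
      eventually_imp_distrib_left.2 fun hj => eventually_lt_nhds (hf.stretch_lt r j hj)
  obtain ⟨m, ⟨hm_one, hm_lt⟩, hkm⟩ :=
    ((hm.filter_mono nhdsWithin_le_nhds).and (self_mem_nhdsWithin
      (a := stretch g b f k r) (s := Ioi (stretch g b f k r)))).exists
  obtain ⟨μ, hkμ, hμm⟩ := exists_between hkm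
  obtain ⟨l, hkl, hlμ⟩ := exists_between hkμ
  exact ⟨l, μ, m, hkl, hlμ, hμm, hm_one, hm_lt⟩

theorem exists_cone_step (hf : ContractsDominated g E b f k) (hb : IsUnitFrame g E b)
    (he : IsC1Immersion e) (r : M) :
    ∃ l ρ : ℝ, stretch g b f k r < l ∧ l < 1 ∧ 1 < ρ ∧ ∀ᶠ z in 𝓝 (r, r),
      separation e b k z.1 z.2 ≤ transverseSeparation e b k z.1 z.2 →
        separation e b k (f z.1) (f z.2) ≤ transverseSeparation e b k (f z.1) (f z.2) ∧
        ρ * l * transverseSeparation e b k z.1 z.2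
          ≤ transverseSeparation e b k (f z.1) (f z.2) := by
  obtain ⟨l, μ, m, hkl, hlμ, hμm, hm_one, hm_lt⟩ := hf.exists_rate_gap r
  have hk : 0 ≤ stretch g b f k r := stretch_nonneg k r
  have hl : 0 < l := hk.trans_lt hkl
  refine ⟨l, μ / l, hkl, by linarith, (one_lt_div hl).2 hlμ, ?_⟩
  rw [div_mul_cancel₀ _ hl.ne']
  obtain ⟨ε, hε, hε_m, hε_k⟩ : ∃ ε > 0, 4 * ε ≤ m - μ ∧ 4 * ε ≤ μ - stretch g b f k r := by
    refine ⟨min (m - μ) (μ - stretch g b f k r) / 4, ?_, ?_, ?_⟩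
    · exact div_pos (lt_min (sub_pos.2 hμm) (sub_pos.2 (hkl.trans hlμ))) four_pos
    · linarith [min_le_left (m - μ) (μ - stretch g b f k r)]
    · linarith [min_le_right (m - μ) (μ - stretch g b f k r)]
  filter_upwards [hf.eventually_abs_separation_map_sub_le hb he r hε] with z hz hcone
  rw [sum_separation k] at hz
  set T := transverseSeparation e b k z.1 z.2 with hT
  have hT_nonneg : 0 ≤ T := transverseSeparation_nonneg k _ _
  have hk_le : separation e b k (f z.1) (f z.2) ≤ μ * T := by
    have hupper := (abs_le.1 (hz k)).2
    have hstretch := mul_le_mul_of_nonneg_left hcone hk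
    nlinarith
  have hT_le : μ * T ≤ transverseSeparation e b k (f z.1) (f z.2) := by
    have hlower : ∑ j ∈ Finset.univ.erase k, (m * separation e b j z.1 z.2 - 2 * ε * T)
        ≤ transverseSeparation e b k (f z.1) (f z.2) := by
      refine Finset.sum_le_sum fun j hj => ?_
      have hstretch := mul_le_mul_of_nonneg_right (hm_lt j (Finset.ne_of_mem_erase hj)).le
        (separation_nonneg (e := e) (b := b) j z.1 z.2)
      nlinarith [(abs_le.1 (hz j)).1]
    rw [Finset.sum_sub_distrib, ← Finset.mul_sum, ← transverseSeparation, ← hT, Finset.sum_const,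
      Finset.card_erase_of_mem (Finset.mem_univ k), Finset.card_univ, Fintype.card_fin,
      nsmul_eq_mul] at hlower
    norm_num at hlower
    nlinarith
  exact ⟨hk_le.trans hT_le, hT_le⟩

end ContractsDominated

end Domination

section Velocity

variable {M : Type*} [TopologicalSpace M] [ChartedSpace E3 M]

/-- The curve `c` has velocity `v` at time `t` within `s`. -/
def HasVelocityWithinAt (c : ℝ → M) (s : Set ℝ) (t : ℝ) (v : E3) : Prop :=
  HasMFDerivWithinAt 𝓘(ℝ, ℝ) (𝓡 3) c s t (ContinuousLinearMap.toSpanSingleton ℝ v : ℝ →L[ℝ] E3)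

namespace HasVelocityWithinAt

theorem comp_map {c : ℝ → M} {s : Set ℝ} {t : ℝ} {v : E3} (hc : HasVelocityWithinAt c s t v)
    {f : M → M} (hf : MDifferentiableAt (𝓡 3) (𝓡 3) f (c t)) :
    HasVelocityWithinAt (f ∘ c) s t (chartMapDeriv f (c t) v) := by
  rw [HasVelocityWithinAt, ← ContinuousLinearMap.comp_toSpanSingleton]
  exact hf.hasMFDerivAt.comp_hasMFDerivWithinAt t hc

theorem comp_fun {F : Type*} [NormedAddCommGroup F] [NormedSpace ℝ F] {c : ℝ → M} {s : Set ℝ}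
    {t : ℝ} {v : E3} (hc : HasVelocityWithinAt c s t v) {h : M → F}
    (hh : MDifferentiableAt (𝓡 3) 𝓘(ℝ, F) h (c t)) :
    HasDerivWithinAt (h ∘ c) (chartDeriv h (c t) v) s t := by
  rw [hasDerivWithinAt_iff_hasFDerivWithinAt, ← ContinuousLinearMap.comp_toSpanSingleton]
  exact (hh.hasMFDerivAt.comp_hasMFDerivWithinAt t hc).hasFDerivWithinAt

theorem comp_real {c : ℝ → M} {s s' : Set ℝ} {θ a : ℝ} {v : E3} {σ : ℝ → ℝ}
    (hc : HasVelocityWithinAt c s (σ θ) v) (hσ : HasDerivWithinAt σ a s' θ)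
    (hs : MapsTo σ s' s) : HasVelocityWithinAt (c ∘ σ) s' θ (a • v) := by
  have hspan : ContinuousLinearMap.toSpanSingleton ℝ (a • v) =
      (ContinuousLinearMap.toSpanSingleton ℝ v) ∘L (ContinuousLinearMap.toSpanSingleton ℝ a) := by
    ext1
    simp
  rw [HasVelocityWithinAt, hspan]
  exact hc.comp θ hσ.hasFDerivWithinAt.hasMFDerivWithinAt hs

end HasVelocityWithinAt

variable [IsManifold (𝓡 3) ∞ M] {g : SmoothMetric M}

/-- A curve on `[0, 1]` tangent to `E` with speed at most `l`. -/
def IsSlowArc (g : SmoothMetric M) (E : TangentField M) (c : ℝ → M) (l : ℝ) : Prop :=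
  ∀ t ∈ Icc (0 : ℝ) 1, ∃ v ∈ modelFiber E (c t), g.modelNorm (c t) v ≤ l ∧
    HasVelocityWithinAt c (Icc 0 1) t v

namespace IsSlowArc

theorem speed_nonneg {D : TangentField M} {c : ℝ → M} {l : ℝ} (hc : IsSlowArc g D c l) :
    0 ≤ l := by
  obtain ⟨v, -, hv, -⟩ := hc 0 (left_mem_Icc.2 zero_le_one)
  exact (g.tnorm_nonneg _ _).trans hv

theorem map {E : Fin 3 → TangentField M} {b : M → Fin 3 → E3} {f : M → M} {k : Fin 3}
    (hb : IsUnitFrame g E b) (hf : ContractsDominated g E b f k) {c : ℝ → M}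
    {l s : ℝ} (hc : IsSlowArc g (E k) c l)
    (hs : ∀ t ∈ Icc (0 : ℝ) 1, stretch g b f k (c t) ≤ s) :
    IsSlowArc g (E k) (f ∘ c) (s * l) := by
  intro t ht
  obtain ⟨v, hv, hvl, hvelocity⟩ := hc t ht
  refine ⟨_, hf.map_mem _ _ v hv, ?_,
    hvelocity.comp_map (hf.contMDiff.mdifferentiable one_ne_zero (c t))⟩
  obtain ⟨a, rfl, hnorm⟩ := hb.exists_smul hv
  rw [hnorm] at hvl
  rw [map_smul, g.modelNorm_smul, mul_comm]
  exact mul_le_mul (hs t ht) hvl (abs_nonneg a) ((stretch_nonneg k _).trans (hs t ht))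

theorem norm_sub_le {F : Type*} [NormedAddCommGroup F] [NormedSpace ℝ F] {D : TangentField M}
    {c : ℝ → M} {l C : ℝ} (hc : IsSlowArc g D c l) {h : M → F}
    (hh : ContMDiff (𝓡 3) 𝓘(ℝ, F) 1 h) (hC : 0 ≤ C)
    (hderiv : ∀ q, ∀ v ∈ modelFiber D q, ‖chartDeriv h q v‖ ≤ C * g.modelNorm q v) {t : ℝ}
    (ht : t ∈ Icc (0 : ℝ) 1) : ‖h (c t) - h (c 0)‖ ≤ C * l := by
  have hl := mul_nonneg hC hc.speed_nonneg
  choose! v hv hvl hvelocity using hc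
  have hdist := Convex.norm_image_sub_le_of_norm_hasDerivWithin_le
    (fun t ht => (hvelocity t ht).comp_fun (hh.mdifferentiable one_ne_zero _))
    (fun t ht => (hderiv _ _ (hv t ht)).trans (mul_le_mul_of_nonneg_left (hvl t ht) hC))
    (convex_Icc 0 1) (left_mem_Icc.2 zero_le_one) ht
  refine hdist.trans (mul_le_of_le_one_right hl ?_)
  rw [sub_zero, Real.norm_of_nonneg ht.1]
  exact ht.2

end IsSlowArc

end Velocity

section Endpoints

variable {M : Type*} [TopologicalSpace M] [ChartedSpace E3 M] [IsManifold (𝓡 3) ∞ M]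
  {g : SmoothMetric M} {E : Fin 3 → TangentField M} {b : M → Fin 3 → E3}
  {F : Type*} [NormedAddCommGroup F] [InnerProductSpace ℝ F] {e : M → F} {f : M → M} {k : Fin 3}

/-- A set on which `f` stretches `E k` by at most `l`, preserves the cone of pairs separated mainly
in the directions other than `k`, and stretches their transverse separation by at least `ρ * l`.
It is small enough for distinct points to be separated. -/
structure IsConeRegion (g : SmoothMetric M) (e : M → F) (b : M → Fin 3 → E3) (f : M → M)
    (k : Fin 3) (ρ l : ℝ) (S : Set M) : Prop where
  pos : 0 < l
  lt_one : l < 1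
  stretch_le : ∀ p ∈ S, stretch g b f k p ≤ l
  eq_of_separation : ∀ p ∈ S, ∀ q ∈ S, ∑ i, separation e b i p q = 0 → p = q
  map_cone : ∀ p ∈ S, ∀ q ∈ S, separation e b k p q ≤ transverseSeparation e b k p q →
    separation e b k (f p) (f q) ≤ transverseSeparation e b k (f p) (f q)
  expand : ∀ p ∈ S, ∀ q ∈ S, separation e b k p q ≤ transverseSeparation e b k p q →
    ρ * l * transverseSeparation e b k p q ≤ transverseSeparation e b k (f p) (f q)

theorem IsConeRegion.mono {ρ ρ' l : ℝ} {S S' : Set M} (hS : IsConeRegion g e b f k ρ l S)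
    (hρ : ρ' ≤ ρ) (hSS' : S' ⊆ S) : IsConeRegion g e b f k ρ' l S' where
  pos := hS.pos
  lt_one := hS.lt_one
  stretch_le p hp := hS.stretch_le p (hSS' hp)
  eq_of_separation p hp q hq := hS.eq_of_separation p (hSS' hp) q (hSS' hq)
  map_cone p hp q hq := hS.map_cone p (hSS' hp) q (hSS' hq)
  expand p hp q hq hcone :=
    (mul_le_mul_of_nonneg_right (mul_le_mul_of_nonneg_right hρ hS.pos.le)
      (transverseSeparation_nonneg k p q)).trans (hS.expand p (hSS' hp) q (hSS' hq) hcone)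

theorem IsUnitFrame.exists_eq_of_separation_eq_zero (hb : IsUnitFrame g E b)
    (he : IsC1Immersion e) (r : M) :
    ∀ᶠ z in 𝓝 (r, r), ∑ i, separation e b i z.1 z.2 = 0 → z.1 = z.2 := by
  obtain ⟨A, -, hA⟩ := hb.exists_chartDiff_le he r
  have hsource := extChartAt_source_mem_nhds (I := 𝓡 3) r
  filter_upwards [hA, prod_mem_nhds hsource hsource] with z hz hz_source hzero
  rw [hzero, mul_zero, norm_le_zero_iff, chartDiff, sub_eq_zero] at hz
  exact ((extChartAt (𝓡 3) r).injOn hz_source.2 hz_source.1 hz).symm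

theorem transverseSeparation_le_of_isSlowArc {D : TangentField M} (he : ContMDiff (𝓡 3) 𝓘(ℝ, F) 1 e)
    {C K l : ℝ} (hC : 0 ≤ C)
    (hderiv : ∀ q, ∀ v ∈ modelFiber D q, ‖chartDeriv e q v‖ ≤ C * g.modelNorm q v)
    (hK : 0 ≤ K) (hseparation : ∀ p i q, separation e b i p q ≤ K * ‖e q - e p‖)
    {c₁ c₂ : ℝ → M} (hc₁ : IsSlowArc g D c₁ l) (hc₂ : IsSlowArc g D c₂ l) (hstart : c₁ 0 = c₂ 0) :
    transverseSeparation e b k (c₁ 1) (c₂ 1) ≤ 6 * K * C * l := by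
  have h1 : (1 : ℝ) ∈ Icc (0 : ℝ) 1 := right_mem_Icc.2 zero_le_one
  have hdist : ‖e (c₂ 1) - e (c₁ 1)‖ ≤ C * l + C * l := by
    refine (norm_sub_le_norm_sub_add_norm_sub _ (e (c₁ 0)) _).trans (add_le_add ?_ ?_)
    · rw [hstart]
      exact hc₂.norm_sub_le he hC hderiv h1
    · rw [norm_sub_rev]
      exact hc₁.norm_sub_le he hC hderiv h1
  calc transverseSeparation e b k (c₁ 1) (c₂ 1)
      ≤ ∑ i, separation e b i (c₁ 1) (c₂ 1) := by
        rw [sum_separation k]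
        exact le_add_of_nonneg_left (separation_nonneg k _ _)
    _ ≤ ∑ _i : Fin 3, K * (C * l + C * l) := Finset.sum_le_sum fun i _ =>
        (hseparation _ i _).trans (mul_le_mul_of_nonneg_left hdist hK)
    _ = 6 * K * C * l := by simp only [Fin.sum_univ_three]; ring

namespace ContractsDominated

theorem exists_isConeRegion_nhds (hf : ContractsDominated g E b f k) (hb : IsUnitFrame g E b)
    (he : IsC1Immersion e) (r : M) :
    ∃ l ρ, 1 < ρ ∧ ∃ U ∈ 𝓝 r, IsConeRegion g e b f k ρ l U := by
  obtain ⟨l, ρ, hkl, hl, hρ, hstep⟩ := hf.exists_cone_step hb he r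
  have hpairs := (hb.exists_eq_of_separation_eq_zero he r).and hstep
  rw [nhds_prod_eq, eventually_prod_self_iff'] at hpairs
  obtain ⟨U, hU, hpairs⟩ := hpairs
  have hstretch := (hb.continuous_stretch hf.contMDiff k).continuousAt.eventually_lt_const hkl
  exact ⟨l, ρ, hρ, _, inter_mem hU hstretch, (stretch_nonneg k r).trans_lt hkl, hl,
    fun p hp => le_of_lt hp.2,
    fun p hp q hq => (hpairs p hp.1 q hq.1).1,
    fun p hp q hq hcone => ((hpairs p hp.1 q hq.1).2 hcone).1,
    fun p hp q hq hcone => ((hpairs p hp.1 q hq.1).2 hcone).2⟩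

theorem exists_isConeRegion_ball [CompactSpace M] (hf : ContractsDominated g E b f k)
    (hb : IsUnitFrame g E b) (he : IsC1Immersion e) (hemb : IsEmbedding e) :
    ∃ δ > 0, ∃ ρ > 1, ∀ x, ∃ l, IsConeRegion g e b f k ρ l (e ⁻¹' Metric.ball (e x) δ) := by
  choose l ρ hρ U hU hregion using hf.exists_isConeRegion_nhds hb he
  have hO (r : M) : ∃ O : Set F, IsOpen O ∧ e r ∈ O ∧ e ⁻¹' O ⊆ U r := by
    obtain ⟨O, hO, hOU⟩ := mem_comap.1 (hemb.nhds_eq_comap r ▸ hU r)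
    obtain ⟨O', hO'O, hO', hrO'⟩ := mem_nhds_iff.1 hO
    exact ⟨O', hO', hrO', (preimage_mono hO'O).trans hOU⟩
  choose O hO hrO hOU using hO
  obtain ⟨t, ht⟩ := isCompact_univ.elim_nhds_subcover (fun r => e ⁻¹' O r)
    (fun r _ => ((hO r).preimage hemb.continuous).mem_nhds (hrO r))
  obtain ⟨ρ₀, hρ₀_le, hρ₀⟩ : ∃ ρ₀, (∀ r ∈ t, ρ₀ ≤ ρ r) ∧ 1 < ρ₀ := by
    have hle : ∀ᶠ x in 𝓝[>] (1 : ℝ), ∀ r ∈ t, x ≤ ρ r :=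
      (eventually_all_finset t).2 fun r _ => nhdsWithin_le_nhds (Iic_mem_nhds (hρ r))
    exact (hle.and self_mem_nhdsWithin).exists
  obtain ⟨δ, hδ, hball⟩ := lebesgue_number_lemma_of_metric (isCompact_range hemb.continuous)
    (c := fun r : t => O r) (fun r => hO r) (by
      rintro _ ⟨q, rfl⟩
      obtain ⟨r, hr, hq⟩ := mem_iUnion₂.1 (ht.2 (mem_univ q))
      exact mem_iUnion.2 ⟨⟨r, hr⟩, hq⟩)
  refine ⟨δ, hδ, ρ₀, hρ₀, fun x => ?_⟩
  obtain ⟨r, hr⟩ := hball (e x) (mem_range_self x)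
  exact ⟨l r, (hregion r).mono (hρ₀_le r r.2) ((preimage_mono hr).trans (hOU r))⟩

theorem transverseSeparation_mul_pow_le (hf : ContractsDominated g E b f k)
    (hb : IsUnitFrame g E b) (he : ContMDiff (𝓡 3) 𝓘(ℝ, F) 1 e) {C K ρ δ : ℝ} (hC : 0 ≤ C)
    (hderiv : ∀ q, ∀ v ∈ modelFiber (E k) q, ‖chartDeriv e q v‖ ≤ C * g.modelNorm q v)
    (hK : 0 ≤ K) (hseparation : ∀ p i q, separation e b i p q ≤ K * ‖e q - e p‖) (hρ : 0 ≤ ρ)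
    (hregion : ∀ x, ∃ l, IsConeRegion g e b f k ρ l (e ⁻¹' Metric.ball (e x) δ)) (N : ℕ) {l : ℝ}
    (hl : C * l < δ) {c₁ c₂ : ℝ → M} (hc₁ : IsSlowArc g (E k) c₁ l) (hc₂ : IsSlowArc g (E k) c₂ l)
    (hstart : c₁ 0 = c₂ 0)
    (hcone : separation e b k (c₁ 1) (c₂ 1) ≤ transverseSeparation e b k (c₁ 1) (c₂ 1)) :
    transverseSeparation e b k (c₁ 1) (c₂ 1) * ρ ^ N ≤ 6 * K * C * l := by
  have h1 : (1 : ℝ) ∈ Icc (0 : ℝ) 1 := right_mem_Icc.2 zero_le_one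
  induction N generalizing l c₁ c₂ with
  | zero =>
    rw [pow_zero, mul_one]
    exact transverseSeparation_le_of_isSlowArc he hC hderiv hK hseparation hc₁ hc₂ hstart
  | succ N ih =>
    obtain ⟨s, hs⟩ := hregion (c₁ 0)
    have hmem₁ (t : ℝ) (ht : t ∈ Icc (0 : ℝ) 1) : c₁ t ∈ e ⁻¹' Metric.ball (e (c₁ 0)) δ :=
      mem_ball_iff_norm.2 ((hc₁.norm_sub_le he hC hderiv ht).trans_lt hl)
    have hmem₂ (t : ℝ) (ht : t ∈ Icc (0 : ℝ) 1) : c₂ t ∈ e ⁻¹' Metric.ball (e (c₁ 0)) δ := by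
      rw [mem_preimage, hstart]
      exact mem_ball_iff_norm.2 ((hc₂.norm_sub_le he hC hderiv ht).trans_lt hl)
    have himage : transverseSeparation e b k (f (c₁ 1)) (f (c₂ 1)) * ρ ^ N ≤
        6 * K * C * (s * l) :=
      ih (l := s * l) (c₁ := f ∘ c₁) (c₂ := f ∘ c₂) (lt_of_le_of_lt (mul_le_mul_of_nonneg_left
          (mul_le_of_le_one_left hc₁.speed_nonneg hs.lt_one.le) hC) hl)
        (hc₁.map hb hf fun t ht => hs.stretch_le _ (hmem₁ t ht))
        (hc₂.map hb hf fun t ht => hs.stretch_le _ (hmem₂ t ht)) (congrArg f hstart)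
        (hs.map_cone _ (hmem₁ 1 h1) _ (hmem₂ 1 h1) hcone)
    refine le_of_mul_le_mul_left ?_ hs.pos
    calc s * (transverseSeparation e b k (c₁ 1) (c₂ 1) * ρ ^ (N + 1))
        = ρ * s * transverseSeparation e b k (c₁ 1) (c₂ 1) * ρ ^ N := by ring
      _ ≤ transverseSeparation e b k (f (c₁ 1)) (f (c₂ 1)) * ρ ^ N :=
          mul_le_mul_of_nonneg_right (hs.expand _ (hmem₁ 1 h1) _ (hmem₂ 1 h1) hcone)
            (pow_nonneg hρ N)
      _ ≤ 6 * K * C * (s * l) := himage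
      _ = s * (6 * K * C * l) := by ring

theorem exists_endpoint_eq_of_cone [CompactSpace M] (hf : ContractsDominated g E b f k)
    (hb : IsUnitFrame g E b) (he : IsC1Immersion e) (hemb : IsEmbedding e) :
    ∃ l > 0, ∀ c₁ c₂ : ℝ → M, IsSlowArc g (E k) c₁ l → IsSlowArc g (E k) c₂ l → c₁ 0 = c₂ 0 →
      separation e b k (c₁ 1) (c₂ 1) ≤ transverseSeparation e b k (c₁ 1) (c₂ 1) →
      c₁ 1 = c₂ 1 := by
  obtain ⟨C, hC, hderiv⟩ := hb.exists_norm_chartDeriv_le he.contMDiff k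
  obtain ⟨K, hK, hseparation⟩ := hb.exists_separation_le he
  obtain ⟨δ, hδ, ρ, hρ, hregion⟩ := hf.exists_isConeRegion_ball hb he hemb
  obtain ⟨l, hl, hCl⟩ : ∃ l > 0, C * l < δ := by
    refine ⟨δ / (C + 1), by positivity, ?_⟩
    rw [mul_div_assoc', div_lt_iff₀ (by positivity)]
    linarith
  refine ⟨l, hl, fun c₁ c₂ hc₁ hc₂ hstart hcone => ?_⟩
  have htransverse : transverseSeparation e b k (c₁ 1) (c₂ 1) ≤ 0 := by
    by_contra! hpos
    obtain ⟨N, hN⟩ := pow_unbounded_of_one_lt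
      (6 * K * C * l / transverseSeparation e b k (c₁ 1) (c₂ 1)) hρ
    rw [div_lt_iff₀' hpos] at hN
    exact hN.not_ge (hf.transverseSeparation_mul_pow_le hb he.contMDiff hC hderiv hK hseparation
      (zero_le_one.trans hρ.le) hregion N hCl hc₁ hc₂ hstart hcone)
  obtain ⟨s, hs⟩ := hregion (c₁ 0)
  have h1 : (1 : ℝ) ∈ Icc (0 : ℝ) 1 := right_mem_Icc.2 zero_le_one
  refine hs.eq_of_separation _ ?_ _ ?_ ?_
  · exact mem_ball_iff_norm.2 ((hc₁.norm_sub_le he.contMDiff hC hderiv h1).trans_lt hCl)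
  · rw [mem_preimage, hstart]
    exact mem_ball_iff_norm.2 ((hc₂.norm_sub_le he.contMDiff hC hderiv h1).trans_lt hCl)
  · rw [sum_separation k]
    linarith [separation_nonneg (e := e) (b := b) k (c₁ 1) (c₂ 1),
      transverseSeparation_nonneg (e := e) (b := b) k (c₁ 1) (c₂ 1)]

end ContractsDominated

theorem IsUnitFrame.eventually_cone_of_coord_eq (hb : IsUnitFrame g E b) (he : IsC1Immersion e)
    (p : M) : ∀ᶠ z in 𝓝 (p, p), dualFunctional (b p) k (chartDiff p z) = 0 →
      separation e b k z.1 z.2 ≤ transverseSeparation e b k z.1 z.2 := by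
  obtain ⟨C, hC, hdiff⟩ := hb.exists_chartDiff_le he p
  have hclose := Asymptotics.isLittleO_iff.1 (hb.separation_sub_isLittleO he p k)
    (show 0 < 1 / (2 * C) by positivity)
  filter_upwards [hdiff, hclose] with z hz hz_close hcoord
  rw [hcoord, abs_zero, sub_zero, Real.norm_of_nonneg (separation_nonneg _ _ _)] at hz_close
  rw [sum_separation k] at hz
  have hhalf : 1 / (2 * C) * ‖chartDiff p z‖ ≤
      1 / 2 * (separation e b k z.1 z.2 + transverseSeparation e b k z.1 z.2) := by
    refine (mul_le_mul_of_nonneg_left hz (by positivity)).trans_eq ?_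
    field_simp
  linarith

theorem ContractsDominated.exists_endpoint_eq_of_coord_eq [CompactSpace M] [T2Space M]
    (hf : ContractsDominated g E b f k) (hb : IsUnitFrame g E b) :
    ∃ l > 0, ∀ p : M, ∃ U ∈ 𝓝 p, ∀ c₁ c₂ : ℝ → M, IsSlowArc g (E k) c₁ l →
      IsSlowArc g (E k) c₂ l → c₁ 0 = c₂ 0 → c₁ 1 ∈ U → c₂ 1 ∈ U →
      dualFunctional (b p) k (extChartAt (𝓡 3) p (c₁ 1))
        = dualFunctional (b p) k (extChartAt (𝓡 3) p (c₂ 1)) → c₁ 1 = c₂ 1 := by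
  obtain ⟨n, e, he_smooth, hemb, hinj⟩ := exists_embedding_euclidean_of_compact (I := 𝓡 3) (M := M)
  have he : IsC1Immersion e := ⟨he_smooth.of_le (by norm_cast), hinj⟩
  obtain ⟨l, hl, hendpoint⟩ := hf.exists_endpoint_eq_of_cone hb he hemb.isEmbedding
  refine ⟨l, hl, fun p => ?_⟩
  have hcone := hb.eventually_cone_of_coord_eq he (k := k) p
  rw [nhds_prod_eq, eventually_prod_self_iff'] at hcone
  obtain ⟨U, hU, hcone⟩ := hcone
  refine ⟨U, hU, fun c₁ c₂ hc₁ hc₂ hstart hc₁U hc₂U hcoord =>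
    hendpoint c₁ c₂ hc₁ hc₂ hstart (hcone _ hc₁U _ hc₂U ?_)⟩
  rw [chartDiff, map_sub, hcoord, sub_self]

end Endpoints

section ChartField

theorem exists_uniformContinuous_eqOn_closedBall {E F : Type*} [NormedAddCommGroup E]
    [NormedSpace ℝ E] [FiniteDimensional ℝ E] [HasContDiffBump E] [NormedAddCommGroup F]
    [NormedSpace ℝ F] {Y : E → F} {c : E} {r R : ℝ} (hr : 0 < r) (hrR : r < R)
    (hY : ContinuousOn Y (Metric.ball c R)) :
    ∃ X L, UniformContinuous X ∧ (∀ y, ‖X y‖ ≤ L) ∧ EqOn X Y (Metric.closedBall c r) := by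
  obtain ⟨r', hrr', hr'R⟩ := exists_between hrR
  let χ : ContDiffBump c := ⟨r, r', hr, hrr'⟩
  have hcont : Continuous fun y => χ y • Y y := by
    refine (χ.continuous.continuousOn.smul hY).continuous_of_tsupport_subset Metric.isOpen_ball ?_
    exact ((tsupport_smul_subset_left _ _).trans_eq χ.tsupport_eq).trans
      (Metric.closedBall_subset_ball hr'R)
  have hsupp : HasCompactSupport fun y => χ y • Y y := χ.hasCompactSupport.smul_right
  obtain ⟨L, hL⟩ := hsupp.exists_bound_of_continuous hcont
  refine ⟨_, L, hsupp.uniformContinuous_of_continuous hcont, hL, fun y hy => ?_⟩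
  simp only [χ.one_of_mem_closedBall hy, one_smul]

variable {M : Type*} [TopologicalSpace M] [ChartedSpace E3 M] {D : TangentField M}

theorem isTangentArc_of_hasVelocityWithinAt {c : ℝ → M} {a b : ℝ} (hab : a < b)
    (hc : ContMDiffOn 𝓘(ℝ, ℝ) (𝓡 3) 1 c (Icc a b))
    (hv : ∀ t ∈ Icc a b, ∃ v ∈ modelFiber D (c t), HasVelocityWithinAt c (Icc a b) t v) :
    IsTangentArc D c a b := by
  refine ⟨hc, fun t ht => ?_⟩
  obtain ⟨v, hvD, hvelocity⟩ := hv t ht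
  rw [hvelocity.mfderivWithin ((uniqueDiffOn_Icc hab).uniqueMDiffOn t ht)]
  exact (ContinuousLinearMap.toSpanSingleton_apply_one ℝ v).symm ▸ hvD

variable [IsManifold (𝓡 3) ∞ M] {g : SmoothMetric M} {E : Fin 3 → TangentField M}
  {b : M → Fin 3 → E3}

theorem chartDeriv_extChartAt_self (p : M) :
    chartDeriv (extChartAt (𝓡 3) p) p = ContinuousLinearMap.id ℝ E3 :=
  mfderiv_extChartAt_self

theorem hasVelocityWithinAt_extChartAt_symm_comp {p : M} {y : ℝ → E3} {s : Set ℝ} {t : ℝ}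
    {w v : E3} (hy : HasDerivWithinAt y w s t) (hyt : y t ∈ (extChartAt (𝓡 3) p).target)
    (hv : chartDeriv (extChartAt (𝓡 3) p) ((extChartAt (𝓡 3) p).symm (y t)) v = w) :
    HasVelocityWithinAt ((extChartAt (𝓡 3) p).symm ∘ y) s t v := by
  have hdiff : MDifferentiableAt 𝓘(ℝ, E3) (𝓡 3) (extChartAt (𝓡 3) p).symm (y t) :=
    (mdifferentiableOn_extChartAt_symm (y t) hyt).mdifferentiableAt
      ((isOpen_extChartAt_target p).mem_nhds hyt)
  have hinverse := mfderivWithin_extChartAt_symm_comp_mfderiv_extChartAt (I := 𝓡 3) (x := p) hyt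
  rw [(𝓡 3).range_eq_univ, mfderivWithin_univ] at hinverse
  have hwv : mfderiv 𝓘(ℝ, E3) (𝓡 3) (extChartAt (𝓡 3) p).symm (y t) w = v := by
    rw [← hv]
    exact congrArg (fun T : E3 →L[ℝ] E3 => T v) hinverse
  rw [HasVelocityWithinAt, ← hwv]
  exact (ContinuousLinearMap.comp_toSpanSingleton
    (mfderiv 𝓘(ℝ, E3) (𝓡 3) (extChartAt (𝓡 3) p).symm (y t) : E3 →L[ℝ] E3) w) ▸
    hdiff.hasMFDerivAt.comp_hasMFDerivWithinAt t hy.hasFDerivWithinAt.hasMFDerivWithinAt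

/-- The direction of `E i` in the chart at `p`, normalised to have `i`-th coordinate `1` in the
frame at `p`. Unlike `b` itself, it does not depend on the choice of signs in the frame. -/
noncomputable def chartDirection (b : M → Fin 3 → E3) (p : M) (i : Fin 3) (q : M) : E3 :=
  (dualFunctional (b p) i (chartDeriv (extChartAt (𝓡 3) p) q (b q i)))⁻¹ •
    chartDeriv (extChartAt (𝓡 3) p) q (b q i)

namespace IsUnitFrame

theorem chartDirection_self (hb : IsUnitFrame g E b) (p : M) (i : Fin 3) :
    chartDirection b p i p = b p i := by
  rw [chartDirection, chartDeriv_extChartAt_self, ContinuousLinearMap.id_apply,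
    dualFunctional_apply_self (hb.linearIndependent p), if_pos rfl, inv_one, one_smul]

theorem exists_signs_continuousAt_chartDeriv (hb : IsUnitFrame g E b) {p q : M}
    (hq : q ∈ (extChartAt (𝓡 3) p).source) (i : Fin 3) :
    ∃ s : M → ℝ, (∀ᶠ x in 𝓝 q, |s x| = 1) ∧
      ContinuousAt (fun x => s x • chartDeriv (extChartAt (𝓡 3) p) x (b x i)) q := by
  obtain ⟨s, hs⟩ := hb.exists_continuousAt_signs q
  refine ⟨fun x => s x i, hs.mono fun x hx => (hx i).1, ?_⟩
  refine (continuousAt_chartDeriv_apply (isOpen_extChartAt_source p)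
    (extChartAt_source (𝓡 3) p ▸ contMDiffOn_extChartAt) hq (hs.self_of_nhds i).2).congr
    (Eventually.of_forall fun x => ?_)
  exact map_smul (chartDeriv (extChartAt (𝓡 3) p) x) (s x i : ℝ) (b x i)

theorem continuousAt_chartDirection (hb : IsUnitFrame g E b) {p q : M} {i : Fin 3}
    (hq : q ∈ (extChartAt (𝓡 3) p).source)
    (hne : dualFunctional (b p) i (chartDeriv (extChartAt (𝓡 3) p) q (b q i)) ≠ 0) :
    ContinuousAt (chartDirection b p i) q := by
  obtain ⟨s, hs, hcont⟩ := hb.exists_signs_continuousAt_chartDeriv hq i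
  have hs_ne (x : M) (hx : |s x| = 1) : s x ≠ 0 := abs_ne_zero.1 (hx ▸ one_ne_zero)
  have hcoord := (dualFunctional (b p) i).continuous.continuousAt.comp hcont
  have hcoord_ne : dualFunctional (b p) i
      (s q • chartDeriv (extChartAt (𝓡 3) p) q (b q i)) ≠ 0 := by
    rw [map_smul]
    exact smul_ne_zero (hs_ne q hs.self_of_nhds) hne
  refine ((hcoord.inv₀ hcoord_ne).smul hcont).congr ?_
  filter_upwards [hs] with x hx
  change (dualFunctional (b p) i (s x • chartDeriv (extChartAt (𝓡 3) p) x (b x i)))⁻¹ •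
    s x • chartDeriv (extChartAt (𝓡 3) p) x (b x i) = chartDirection b p i x
  rw [map_smul, smul_eq_mul, smul_smul, mul_inv, mul_right_comm, inv_mul_cancel₀ (hs_ne x hx),
    one_mul, chartDirection]

theorem eventually_lt_abs_dualFunctional_chartDeriv (hb : IsUnitFrame g E b) (p : M) (i : Fin 3) :
    ∀ᶠ q in 𝓝 p,
      1 / 2 < |dualFunctional (b p) i (chartDeriv (extChartAt (𝓡 3) p) q (b q i))| := by
  obtain ⟨s, hs, hcont⟩ :=
    hb.exists_signs_continuousAt_chartDeriv (mem_extChartAt_source (I := 𝓡 3) p) i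
  have habs (x : M) (hx : |s x| = 1) :
      |dualFunctional (b p) i (s x • chartDeriv (extChartAt (𝓡 3) p) x (b x i))| =
        |dualFunctional (b p) i (chartDeriv (extChartAt (𝓡 3) p) x (b x i))| := by
    rw [map_smul, smul_eq_mul, abs_mul, hx, one_mul]
  have hself : |dualFunctional (b p) i (chartDeriv (extChartAt (𝓡 3) p) p (b p i))| = 1 := by
    rw [chartDeriv_extChartAt_self, ContinuousLinearMap.id_apply,
      dualFunctional_apply_self (hb.linearIndependent p), if_pos rfl, abs_one]
  have hcoord := ((dualFunctional (b p) i).continuous.continuousAt.comp hcont).abs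
  filter_upwards [hs, hcoord.eventually_const_lt (u := 1 / 2) (by
    change 1 / 2 < |dualFunctional (b p) i (s p • chartDeriv (extChartAt (𝓡 3) p) p (b p i))|
    rw [habs p hs.self_of_nhds, hself]
    norm_num)] with q hq hlt
  exact habs q hq ▸ hlt

theorem eventually_norm_chartDirection_sub_lt (hb : IsUnitFrame g E b) (p : M) (i : Fin 3) {ε : ℝ}
    (hε : 0 < ε) : ∀ᶠ q in 𝓝 p, ‖chartDirection b p i q - b p i‖ < ε := by
  have hlarge := (hb.eventually_lt_abs_dualFunctional_chartDeriv p i).self_of_nhds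
  have hcont := hb.continuousAt_chartDirection (mem_extChartAt_source p)
    (abs_pos.1 (one_half_pos.trans hlarge))
  refine (hcont.sub continuousAt_const).norm.eventually_lt_const ?_
  change ‖chartDirection b p i p - b p i‖ < ε
  rwa [hb.chartDirection_self, sub_self, norm_zero]

end IsUnitFrame

/-- A vector field `X` in the chart at `p` which is tangent to `D`, normalised by `ℓ X = 1` and
`ε`-close to `u` on a ball around `p`. It is extended to the whole model space so that all its
integral curves are defined for all times. -/
structure IsChartField (g : SmoothMetric M) (D : TangentField M) (p : M) (ℓ : E3 →L[ℝ] ℝ) (u : E3)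
    (ε : ℝ) (X : E3 → E3) (L R : ℝ) : Prop where
  uniformContinuous : UniformContinuous X
  norm_le : ∀ y, ‖X y‖ ≤ L
  radius_pos : 0 < R
  ball_subset : Metric.closedBall (extChartAt (𝓡 3) p p) R ⊆ (extChartAt (𝓡 3) p).target
  coord_eq_one : ∀ y ∈ Metric.closedBall (extChartAt (𝓡 3) p p) R, ℓ (X y) = 1
  near : ∀ y ∈ Metric.closedBall (extChartAt (𝓡 3) p p) R, ‖X y - u‖ ≤ ε
  tangent : ∀ y ∈ Metric.closedBall (extChartAt (𝓡 3) p p) R,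
    ∃ v ∈ modelFiber D ((extChartAt (𝓡 3) p).symm y),
      g.modelNorm ((extChartAt (𝓡 3) p).symm y) v ≤ 2 ∧
      chartDeriv (extChartAt (𝓡 3) p) ((extChartAt (𝓡 3) p).symm y) v = X y

theorem IsUnitFrame.exists_isChartField (hb : IsUnitFrame g E b) (p : M) (i : Fin 3) {ε : ℝ}
    (hε : 0 < ε) {U : Set M} (hU : U ∈ 𝓝 p) :
    ∃ X L R, IsChartField g (E i) p (dualFunctional (b p) i) (b p i) ε X L R ∧
      (extChartAt (𝓡 3) p).symm '' Metric.closedBall (extChartAt (𝓡 3) p p) R ⊆ U := by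
  set φ := extChartAt (𝓡 3) p
  have hφp : φ.symm (φ p) = p := φ.left_inv (mem_extChartAt_source p)
  have hlarge := hb.eventually_lt_abs_dualFunctional_chartDeriv p i
  have hnear := hb.eventually_norm_chartDirection_sub_lt p i hε
  have hne {q : M} (hq : 1 / 2 < |dualFunctional (b p) i (chartDeriv φ q (b q i))|) :
      dualFunctional (b p) i (chartDeriv φ q (b q i)) ≠ 0 := abs_pos.1 (one_half_pos.trans hq)
  have hpullback {S : M → Prop} (hS : ∀ᶠ q in 𝓝 p, S q) : ∀ᶠ y in 𝓝 (φ p), S (φ.symm y) :=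
    (continuousAt_extChartAt_symm p).eventually (hφp.symm ▸ hS)
  have hgood : ∀ᶠ y in 𝓝 (φ p), (y ∈ φ.target ∧ φ.symm y ∈ U) ∧
      1 / 2 < |dualFunctional (b p) i (chartDeriv φ (φ.symm y) (b (φ.symm y) i))| ∧
      ‖chartDirection b p i (φ.symm y) - b p i‖ < ε :=
    (Eventually.and (extChartAt_target_mem_nhds p) (hpullback hU)).and
      ((hpullback hlarge).and (hpullback hnear))
  obtain ⟨R₀, hR₀, hball⟩ := Metric.eventually_nhds_iff_ball.1 hgood
  have hcont : ContinuousOn (chartDirection b p i ∘ φ.symm) (Metric.ball (φ p) R₀) := by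
    intro y hy
    obtain ⟨⟨hy_target, -⟩, hy_large, -⟩ := hball y hy
    exact ((hb.continuousAt_chartDirection (φ.map_target hy_target) (hne hy_large)).comp
      (continuousAt_extChartAt_symm'' hy_target)).continuousWithinAt
  obtain ⟨X, L, hX, hL, hXY⟩ :=
    exists_uniformContinuous_eqOn_closedBall (half_pos hR₀) (half_lt_self hR₀) hcont
  have hball' (y : E3) (hy : y ∈ Metric.closedBall (φ p) (R₀ / 2)) :=
    hball y (Metric.closedBall_subset_ball (half_lt_self hR₀) hy)
  refine ⟨X, L, R₀ / 2, ⟨hX, hL, half_pos hR₀, fun y hy => (hball' y hy).1.1, fun y hy => ?_,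
    fun y hy => ?_, fun y hy => ?_⟩, image_subset_iff.2 fun y hy => (hball' y hy).1.2⟩
  · rw [hXY hy, Function.comp_apply, chartDirection, map_smul, smul_eq_mul,
      inv_mul_cancel₀ (hne (hball' y hy).2.1)]
  · exact hXY hy ▸ (hball' y hy).2.2.le
  · refine ⟨(dualFunctional (b p) i (chartDeriv φ (φ.symm y) (b (φ.symm y) i)))⁻¹ •
      b (φ.symm y) i, Submodule.smul_mem _ _ (hb.mem _ i), ?_, ?_⟩
    · rw [g.modelNorm_smul, hb.norm_eq, mul_one, abs_inv]
      exact inv_le_of_inv_le₀ two_pos (by linarith [(hball' y hy).2.1])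
    · rw [map_smul, hXY hy]
      rfl

namespace IsChartField

variable {p : M} {ℓ : E3 →L[ℝ] ℝ} {u : E3} {ε : ℝ} {X : E3 → E3} {L R : ℝ} {y : ℝ → E3}

theorem coord_eq_add (hX : IsChartField g D p ℓ u ε X L R) (hy : IsIntegralCurve y fun _ => X)
    {s : Set ℝ} (hs : Convex ℝ s) (h0 : (0 : ℝ) ∈ s)
    (hmem : ∀ t ∈ s, y t ∈ Metric.closedBall (extChartAt (𝓡 3) p p) R) {τ : ℝ} (hτ : τ ∈ s) :
    ℓ (y τ) = ℓ (y 0) + τ := by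
  have hconst := hs.norm_image_sub_le_of_norm_hasDerivWithin_le (f := fun t => ℓ (y t) - t) (C := 0)
    (fun t _ => ((ℓ.hasFDerivAt.comp_hasDerivAt t (hy t)).sub (hasDerivAt_id t)).hasDerivWithinAt)
    (fun t ht => by rw [hX.coord_eq_one _ (hmem t ht), sub_self, norm_zero]) h0 hτ
  rw [zero_mul, norm_le_zero_iff] at hconst
  linarith

theorem norm_displacement_le (hX : IsChartField g D p ℓ u ε X L R)
    (hy : IsIntegralCurve y fun _ => X) {s : Set ℝ} (hs : Convex ℝ s) (h0 : (0 : ℝ) ∈ s)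
    (hmem : ∀ t ∈ s, y t ∈ Metric.closedBall (extChartAt (𝓡 3) p p) R) {τ : ℝ} (hτ : τ ∈ s) :
    ‖y τ - y 0 - τ • u‖ ≤ ε * |τ| := by
  have hbound := hs.norm_image_sub_le_of_norm_hasDerivWithin_le (f := fun t => y t - t • u) (C := ε)
    (fun t _ => ((hy t).sub ((hasDerivAt_id t).smul_const u)).hasDerivWithinAt)
    (fun t ht => by rw [one_smul]; exact hX.near _ (hmem t ht)) h0 hτ
  simp only [zero_smul, sub_zero, Real.norm_eq_abs] at hbound
  rwa [sub_right_comm] at hbound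

theorem isSlowArc (hX : IsChartField g D p ℓ u ε X L R) (hy : IsIntegralCurve y fun _ => X)
    {τ l : ℝ} (hl : 2 * |τ| ≤ l)
    (hmem : ∀ θ ∈ Icc (0 : ℝ) 1, y (θ * τ) ∈ Metric.closedBall (extChartAt (𝓡 3) p p) R) :
    IsSlowArc g D (fun θ => (extChartAt (𝓡 3) p).symm (y (θ * τ))) l := by
  intro θ hθ
  obtain ⟨v, hv, hv_norm, hvX⟩ := hX.tangent _ (hmem θ hθ)
  refine ⟨τ • v, Submodule.smul_mem _ _ hv, ?_, ?_⟩
  · rw [g.modelNorm_smul]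
    exact (mul_le_mul_of_nonneg_left hv_norm (abs_nonneg τ)).trans (mul_comm |τ| 2 ▸ hl)
  · have hderiv : HasDerivAt (fun θ : ℝ => y (θ * τ)) (τ • X (y (θ * τ))) θ :=
      (hy (θ * τ)).scomp θ (hasDerivAt_mul_const τ)
    exact hasVelocityWithinAt_extChartAt_symm_comp hderiv.hasDerivWithinAt
      (hX.ball_subset (hmem θ hθ)) (by rw [map_smul, hvX])

theorem contMDiffOn (hX : IsChartField g D p ℓ u ε X L R) (hy : IsIntegralCurve y fun _ => X)
    {τ : ℝ} {s : Set ℝ}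
    (hmem : ∀ θ ∈ s, y (θ * τ) ∈ Metric.closedBall (extChartAt (𝓡 3) p p) R) :
    ContMDiffOn 𝓘(ℝ, ℝ) (𝓡 3) 1 (fun θ => (extChartAt (𝓡 3) p).symm (y (θ * τ))) s := by
  have hy_smooth : ContDiff ℝ 1 y := by
    rw [contDiff_one_iff_deriv]
    refine ⟨fun t => (hy t).differentiableAt, ?_⟩
    rw [show deriv y = fun t => X (y t) from funext fun t => (hy t).deriv]
    exact hX.uniformContinuous.continuous.comp
      (continuous_iff_continuousAt.2 fun t => (hy t).continuousAt)
  have hscaled : ContDiff ℝ 1 fun θ : ℝ => y (θ * τ) :=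
    hy_smooth.comp (contDiff_id.mul contDiff_const)
  exact (contMDiffOn_extChartAt_symm p).comp hscaled.contMDiff.contMDiffOn
    fun θ hθ => hX.ball_subset (hmem θ hθ)

end IsChartField

end ChartField

section Flow

variable {M : Type*} [TopologicalSpace M] [ChartedSpace E3 M]

/-- The points `x` and `y` are joined by a single `C¹` arc tangent to `D`. -/
def JoinedByArc (D : TangentField M) (x y : M) : Prop :=
  ∃ c : ℝ → M, IsTangentArc D c 0 1 ∧ c 0 = x ∧ c 1 = y

variable [IsManifold (𝓡 3) ∞ M] {g : SmoothMetric M} {D : TangentField M} {p : M}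
  {ℓ : E3 →L[ℝ] ℝ} {u : E3} {ε l : ℝ}

/-- A local flow `Φ` along the line field `D` near `p`, parametrised by the coordinate `ℓ` in the
chart at `p`, whose orbits contain all slow arcs tangent to `D`. -/
structure IsLocalFlow (g : SmoothMetric M) (D : TangentField M) (p : M) (ℓ : E3 →L[ℝ] ℝ) (u : E3)
    (ε l : ℝ) (U : Set M) (T : ℝ) (Φ : ℝ → M → M) : Prop where
  isOpen : IsOpen U
  mem : p ∈ U
  time_pos : 0 < T
  subset_source : U ⊆ (extChartAt (𝓡 3) p).source
  mem_source : ∀ q ∈ U, ∀ τ ∈ Icc (-T) T, Φ τ q ∈ (extChartAt (𝓡 3) p).source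
  joined : ∀ q ∈ U, ∀ τ ∈ Icc (-T) T, JoinedByArc D q (Φ τ q)
  continuousOn : ContinuousOn (fun z : ℝ × M => Φ z.1 z.2) (Icc (-T) T ×ˢ U)
  coord : ∀ q ∈ U, ∀ τ ∈ Icc (-T) T,
    ℓ (extChartAt (𝓡 3) p (Φ τ q)) = ℓ (extChartAt (𝓡 3) p q) + τ
  displacement : ∀ q ∈ U, ∀ τ ∈ Icc (-T) T,
    ‖extChartAt (𝓡 3) p (Φ τ q) - extChartAt (𝓡 3) p q - τ • u‖ ≤ ε * |τ|
  slowArc : ∀ c : ℝ → M, IsSlowArc g D c l → c 0 ∈ U → c 1 ∈ U →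
    ∃ τ ∈ Icc (-T) T, Φ τ (c 0) = c 1

/-- The data from which a local flow is built: a chart field `X`, a uniqueness property for the
endpoints of slow arcs, and a time `T` and radius `δ` so small that solutions of `y' = X y`
starting in the `δ`-ball are slow arcs and stay in the `R`-ball up to time `T`. -/
structure IsFlowBox (g : SmoothMetric M) (D : TangentField M) (p : M) (ℓ : E3 →L[ℝ] ℝ) (u : E3)
    (ε l : ℝ) (X : E3 → E3) (L R T δ : ℝ) : Prop where
  chartField : IsChartField g D p ℓ u ε X L R
  time_pos : 0 < T
  radius_pos : 0 < δ
  two_mul_time_le : 2 * T ≤ l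
  speed_mul_time_le : L * T ≤ R / 2
  radius_le : δ ≤ R / 2
  norm_mul_le : ‖ℓ‖ * (2 * δ) ≤ T
  endpoint_unique : ∀ c₁ c₂ : ℝ → M, IsSlowArc g D c₁ l → IsSlowArc g D c₂ l → c₁ 0 = c₂ 0 →
    c₁ 1 ∈ (extChartAt (𝓡 3) p).symm '' Metric.closedBall (extChartAt (𝓡 3) p p) R →
    c₂ 1 ∈ (extChartAt (𝓡 3) p).symm '' Metric.closedBall (extChartAt (𝓡 3) p p) R →
    ℓ (extChartAt (𝓡 3) p (c₁ 1)) = ℓ (extChartAt (𝓡 3) p (c₂ 1)) → c₁ 1 = c₂ 1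

theorem exists_time_radius {l R A L : ℝ} (hl : 0 < l) (hR : 0 < R) (hA : 0 ≤ A) (hL : 0 ≤ L) :
    ∃ T > 0, ∃ δ > 0, 2 * T ≤ l ∧ L * T ≤ R / 2 ∧ δ ≤ R / 2 ∧ A * (2 * δ) ≤ T := by
  have hsmall {B K : ℝ} (hB : 0 < B) (hK : 0 ≤ K) : K * (B / (K + 1)) ≤ B := by
    rw [mul_div_assoc', div_le_iff₀ (by linarith)]
    nlinarith
  refine ⟨min (l / 2) (R / 2 / (L + 1)), by positivity,
    min (R / 2) (min (l / 2) (R / 2 / (L + 1)) / 2 / (A + 1)), by positivity, ?_, ?_,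
    min_le_left _ _, ?_⟩
  · linarith [min_le_left (l / 2) (R / 2 / (L + 1))]
  · exact (mul_le_mul_of_nonneg_left (min_le_right _ _) hL).trans (hsmall (half_pos hR) hL)
  · have hT : 0 < min (l / 2) (R / 2 / (L + 1)) := by positivity
    have hδ := (mul_le_mul_of_nonneg_left (min_le_right (R / 2) _) hA).trans
      (hsmall (half_pos hT) hA)
    linarith

namespace IsFlowBox

variable {X : E3 → E3} {L R T δ : ℝ} {y : ℝ → E3} {τ : ℝ}

theorem mem_closedBall (h : IsFlowBox g D p ℓ u ε l X L R T δ) (hy : IsIntegralCurve y fun _ => X)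
    (h0 : y 0 ∈ Metric.ball (extChartAt (𝓡 3) p p) δ) (hτ : τ ∈ Icc (-T) T) :
    y τ ∈ Metric.closedBall (extChartAt (𝓡 3) p p) R := by
  have hL : 0 ≤ L := (norm_nonneg _).trans (h.chartField.norm_le 0)
  have hmove : dist (y τ) (y 0) ≤ R / 2 := by
    rw [dist_eq_norm]
    refine (norm_sub_le_of_isIntegralCurve hy h.chartField.norm_le 0 τ).trans ?_
    rw [sub_zero]
    exact (mul_le_mul_of_nonneg_left (abs_le.2 hτ) hL).trans h.speed_mul_time_le
  calc dist (y τ) (extChartAt (𝓡 3) p p)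
      ≤ dist (y τ) (y 0) + dist (y 0) (extChartAt (𝓡 3) p p) := dist_triangle _ _ _
    _ ≤ R / 2 + R / 2 := add_le_add hmove ((Metric.mem_ball.1 h0).le.trans h.radius_le)
    _ = R := add_halves R

theorem zero_mem_Icc (h : IsFlowBox g D p ℓ u ε l X L R T δ) : (0 : ℝ) ∈ Icc (-T) T :=
  ⟨neg_nonpos.2 h.time_pos.le, h.time_pos.le⟩

theorem mul_mem_Icc (h : IsFlowBox g D p ℓ u ε l X L R T δ) (hτ : τ ∈ Icc (-T) T) {θ : ℝ}
    (hθ : θ ∈ Icc (0 : ℝ) 1) : θ * τ ∈ Icc (-T) T :=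
  (convex_Icc (-T) T).smul_mem_of_zero_mem h.zero_mem_Icc hτ hθ

theorem coord_eq_add (h : IsFlowBox g D p ℓ u ε l X L R T δ) (hy : IsIntegralCurve y fun _ => X)
    (h0 : y 0 ∈ Metric.ball (extChartAt (𝓡 3) p p) δ) (hτ : τ ∈ Icc (-T) T) :
    ℓ (y τ) = ℓ (y 0) + τ :=
  h.chartField.coord_eq_add hy (convex_Icc (-T) T) h.zero_mem_Icc
    (fun _ ht => h.mem_closedBall hy h0 ht) hτ

theorem norm_displacement_le (h : IsFlowBox g D p ℓ u ε l X L R T δ)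
    (hy : IsIntegralCurve y fun _ => X) (h0 : y 0 ∈ Metric.ball (extChartAt (𝓡 3) p p) δ)
    (hτ : τ ∈ Icc (-T) T) : ‖y τ - y 0 - τ • u‖ ≤ ε * |τ| :=
  h.chartField.norm_displacement_le hy (convex_Icc (-T) T) h.zero_mem_Icc
    (fun _ ht => h.mem_closedBall hy h0 ht) hτ

theorem isSlowArc (h : IsFlowBox g D p ℓ u ε l X L R T δ) (hy : IsIntegralCurve y fun _ => X)
    (h0 : y 0 ∈ Metric.ball (extChartAt (𝓡 3) p p) δ) (hτ : τ ∈ Icc (-T) T) :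
    IsSlowArc g D (fun θ => (extChartAt (𝓡 3) p).symm (y (θ * τ))) l :=
  h.chartField.isSlowArc hy (by linarith [abs_le.2 hτ, h.two_mul_time_le])
    fun _ hθ => h.mem_closedBall hy h0 (h.mul_mem_Icc hτ hθ)

theorem isTangentArc (h : IsFlowBox g D p ℓ u ε l X L R T δ) (hy : IsIntegralCurve y fun _ => X)
    (h0 : y 0 ∈ Metric.ball (extChartAt (𝓡 3) p p) δ) (hτ : τ ∈ Icc (-T) T) :
    IsTangentArc D (fun θ => (extChartAt (𝓡 3) p).symm (y (θ * τ))) 0 1 := by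
  refine isTangentArc_of_hasVelocityWithinAt zero_lt_one (h.chartField.contMDiffOn hy
    fun _ hθ => h.mem_closedBall hy h0 (h.mul_mem_Icc hτ hθ)) fun θ hθ => ?_
  obtain ⟨v, hv, -, hvelocity⟩ := h.isSlowArc hy h0 hτ θ hθ
  exact ⟨v, hv, hvelocity⟩

theorem extChartAt_symm_right_inv (h : IsFlowBox g D p ℓ u ε l X L R T δ)
    (hy : IsIntegralCurve y fun _ => X) (h0 : y 0 ∈ Metric.ball (extChartAt (𝓡 3) p p) δ)
    (hτ : τ ∈ Icc (-T) T) :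
    extChartAt (𝓡 3) p ((extChartAt (𝓡 3) p).symm (y τ)) = y τ :=
  (extChartAt (𝓡 3) p).right_inv (h.chartField.ball_subset (h.mem_closedBall hy h0 hτ))

theorem eq_endpoint (h : IsFlowBox g D p ℓ u ε l X L R T δ) (hy : IsIntegralCurve y fun _ => X)
    (h0 : y 0 ∈ Metric.ball (extChartAt (𝓡 3) p p) δ) (hτ : τ ∈ Icc (-T) T) {c : ℝ → M}
    (hc : IsSlowArc g D c l) (hstart : (extChartAt (𝓡 3) p).symm (y 0) = c 0)
    (hend : c 1 ∈ (extChartAt (𝓡 3) p).symm '' Metric.closedBall (extChartAt (𝓡 3) p p) R)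
    (hcoord : ℓ (y 0) + τ = ℓ (extChartAt (𝓡 3) p (c 1))) :
    (extChartAt (𝓡 3) p).symm (y τ) = c 1 := by
  have hunique := h.endpoint_unique _ c (h.isSlowArc hy h0 hτ) hc
  simp only [zero_mul, one_mul] at hunique
  refine hunique hstart (mem_image_of_mem _ (h.mem_closedBall hy h0 hτ)) hend ?_
  rw [h.extChartAt_symm_right_inv hy h0 hτ, h.coord_eq_add hy h0 hτ, hcoord]

theorem eq_of_isIntegralCurve (h : IsFlowBox g D p ℓ u ε l X L R T δ) {y' : ℝ → E3}
    (hy : IsIntegralCurve y fun _ => X) (hy' : IsIntegralCurve y' fun _ => X)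
    (h0 : y 0 ∈ Metric.ball (extChartAt (𝓡 3) p p) δ) (hstart : y' 0 = y 0)
    (hτ : τ ∈ Icc (-T) T) : y' τ = y τ := by
  have h0' : y' 0 ∈ Metric.ball (extChartAt (𝓡 3) p p) δ := hstart ▸ h0
  have hpoint := h.eq_endpoint hy' h0' hτ (h.isSlowArc hy h0 hτ)
  simp only [zero_mul, one_mul] at hpoint
  rw [← h.extChartAt_symm_right_inv hy' h0' hτ, ← h.extChartAt_symm_right_inv hy h0 hτ,
    hpoint (by rw [hstart]) (mem_image_of_mem _ (h.mem_closedBall hy h0 hτ))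
      (by rw [h.extChartAt_symm_right_inv hy h0 hτ, h.coord_eq_add hy h0 hτ, hstart])]

theorem continuousAt_flow (h : IsFlowBox g D p ℓ u ε l X L R T δ) {Y : E3 → ℝ → E3}
    (hY₀ : ∀ x, Y x 0 = x) (hY : ∀ x, IsIntegralCurve (Y x) fun _ => X) {q : M}
    (hq : q ∈ (extChartAt (𝓡 3) p).source)
    (hqδ : extChartAt (𝓡 3) p q ∈ Metric.ball (extChartAt (𝓡 3) p p) δ) (hτ : τ ∈ Icc (-T) T) :
    ContinuousAt
      (fun z : ℝ × M => (extChartAt (𝓡 3) p).symm (Y (extChartAt (𝓡 3) p z.2) z.1)) (τ, q) := by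
  have h0 : Y (extChartAt (𝓡 3) p q) 0 ∈ Metric.ball (extChartAt (𝓡 3) p p) δ := by rwa [hY₀]
  have hsolution : ContinuousAt (fun z : E3 × ℝ => Y z.1 z.2) (extChartAt (𝓡 3) p q, τ) :=
    continuousAt_solution_of_unique h.chartField.uniformContinuous h.chartField.norm_le hY₀ hY
      fun y hy0 hy => h.eq_of_isIntegralCurve (hY _) hy h0 (hy0.trans (hY₀ _).symm) hτ
  have hchart : ContinuousAt (fun z : ℝ × M => (extChartAt (𝓡 3) p z.2, z.1)) (τ, q) :=
    (ContinuousAt.comp (f := Prod.snd) (x := (τ, q)) (continuousAt_extChartAt' hq)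
      continuousAt_snd).prodMk continuousAt_fst
  have hsymm : ContinuousAt (extChartAt (𝓡 3) p).symm (Y (extChartAt (𝓡 3) p q) τ) :=
    continuousAt_extChartAt_symm'' (h.chartField.ball_subset (h.mem_closedBall (hY _) h0 hτ))
  exact ContinuousAt.comp (f := fun z : ℝ × M => Y (extChartAt (𝓡 3) p z.2) z.1) hsymm
    (ContinuousAt.comp (g := fun z : E3 × ℝ => Y z.1 z.2)
      (f := fun z : ℝ × M => (extChartAt (𝓡 3) p z.2, z.1)) hsolution hchart)

theorem coord_sub_mem_Icc (h : IsFlowBox g D p ℓ u ε l X L R T δ) {z w : E3}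
    (hz : z ∈ Metric.ball (extChartAt (𝓡 3) p p) δ)
    (hw : w ∈ Metric.ball (extChartAt (𝓡 3) p p) δ) : ℓ w - ℓ z ∈ Icc (-T) T := by
  rw [mem_Icc, ← abs_le, ← map_sub, ← Real.norm_eq_abs]
  refine (ℓ.le_opNorm _).trans ((mul_le_mul_of_nonneg_left ?_ (norm_nonneg ℓ)).trans h.norm_mul_le)
  rw [← dist_eq_norm, two_mul]
  exact (dist_triangle_right _ _ _).trans
    (add_le_add (Metric.mem_ball.1 hw).le (Metric.mem_ball.1 hz).le)

theorem isLocalFlow (h : IsFlowBox g D p ℓ u ε l X L R T δ) {Y : E3 → ℝ → E3}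
    (hY₀ : ∀ x, Y x 0 = x) (hY : ∀ x, IsIntegralCurve (Y x) fun _ => X) :
    IsLocalFlow g D p ℓ u ε l
      ((extChartAt (𝓡 3) p).source ∩
        extChartAt (𝓡 3) p ⁻¹' Metric.ball (extChartAt (𝓡 3) p p) δ) T
      (fun τ q => (extChartAt (𝓡 3) p).symm (Y (extChartAt (𝓡 3) p q) τ)) := by
  set φ := extChartAt (𝓡 3) p
  have h0 {q : M} (hq : q ∈ φ.source ∩ φ ⁻¹' Metric.ball (φ p) δ) :
      Y (φ q) 0 ∈ Metric.ball (φ p) δ := (hY₀ (φ q)).symm ▸ hq.2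
  have hstart {q : M} (hq : q ∈ φ.source) : φ.symm (Y (φ q) 0) = q := by
    rw [hY₀, φ.left_inv hq]
  refine
    { isOpen := (continuousOn_extChartAt p).isOpen_inter_preimage (isOpen_extChartAt_source p)
        Metric.isOpen_ball
      mem := ⟨mem_extChartAt_source p, Metric.mem_ball_self h.radius_pos⟩
      time_pos := h.time_pos
      subset_source := inter_subset_left
      mem_source := fun q hq τ hτ =>
        φ.map_target (h.chartField.ball_subset (h.mem_closedBall (hY _) (h0 hq) hτ))
      joined := fun q hq τ hτ => ⟨_, h.isTangentArc (hY (φ q)) (h0 hq) hτ, ?_, ?_⟩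
      continuousOn := fun z hz =>
        (h.continuousAt_flow hY₀ hY hz.2.1 hz.2.2 hz.1).continuousWithinAt
      coord := fun q hq τ hτ => ?_
      displacement := fun q hq τ hτ => ?_
      slowArc := fun c hc hc₀ hc₁ => ?_ }
  · rw [zero_mul, hstart hq.1]
  · rw [one_mul]
  · rw [h.extChartAt_symm_right_inv (hY _) (h0 hq) hτ, h.coord_eq_add (hY _) (h0 hq) hτ, hY₀]
  · have hdisplacement := h.norm_displacement_le (hY _) (h0 hq) hτ
    rwa [hY₀, ← h.extChartAt_symm_right_inv (hY _) (h0 hq) hτ] at hdisplacement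
  · refine ⟨_, h.coord_sub_mem_Icc hc₀.2 hc₁.2, h.eq_endpoint (hY _) (h0 hc₀)
      (h.coord_sub_mem_Icc hc₀.2 hc₁.2) hc (hstart hc₀.1) ⟨φ (c 1), ?_, φ.left_inv hc₁.1⟩ ?_⟩
    · have hR := h.chartField.radius_pos
      exact Metric.ball_subset_closedBall
        (Metric.ball_subset_ball (by linarith [h.radius_le]) hc₁.2)
    · rw [hY₀, add_sub_cancel]

end IsFlowBox

variable {E : Fin 3 → TangentField M} {b : M → Fin 3 → E3} {f : M → M} {k : Fin 3}

theorem ContractsDominated.exists_isLocalFlow [CompactSpace M] [T2Space M]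
    (hf : ContractsDominated g E b f k) (hb : IsUnitFrame g E b) :
    ∃ l > 0, ∀ p : M, ∀ ε > 0, ∃ U T Φ,
      IsLocalFlow g (E k) p (dualFunctional (b p) k) (b p k) ε l U T Φ := by
  obtain ⟨l, hl, hendpoint⟩ := hf.exists_endpoint_eq_of_coord_eq hb
  refine ⟨l, hl, fun p ε hε => ?_⟩
  obtain ⟨U, hU, hunique⟩ := hendpoint p
  obtain ⟨X, L, R, hX, hXU⟩ := hb.exists_isChartField p k hε hU
  obtain ⟨T, hT, δ, hδ, hTl, hLT, hδR, hδT⟩ := exists_time_radius hl hX.radius_pos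
    (norm_nonneg (dualFunctional (b p) k)) ((norm_nonneg _).trans (hX.norm_le 0))
  choose Y hY₀ hY using exists_isIntegralCurve hX.uniformContinuous hX.norm_le
  exact ⟨_, T, _, IsFlowBox.isLocalFlow
    ⟨hX, hT, hδ, hTl, hLT, hδR, hδT, fun c₁ c₂ hc₁ hc₂ hstart h₁ h₂ =>
      hunique c₁ c₂ hc₁ hc₂ hstart (hXU h₁) (hXU h₂)⟩ hY₀ hY⟩

end Flow

section Arcs

/-- The concatenation of the paths `c` and `d`, both parametrised by `[0, 1]`. -/
noncomputable def concatPath {X : Type*} (c d : ℝ → X) (s : ℝ) : X :=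
  if s ≤ 1 / 2 then c (2 * s + 0) else d (2 * s + -1)

theorem concatPath_eq_left {X : Type*} (c d : ℝ → X) {s : ℝ} (hs : s ≤ 1 / 2) :
    concatPath c d s = c (2 * s + 0) :=
  if_pos hs

theorem concatPath_eq_right {X : Type*} {c d : ℝ → X} (hcd : c 1 = d 0) {s : ℝ} (hs : 1 / 2 ≤ s) :
    concatPath c d s = d (2 * s + -1) := by
  rcases hs.eq_or_lt with rfl | hlt
  · rw [concatPath_eq_left c d le_rfl]
    norm_num [hcd]
  · exact if_neg hlt.not_ge

variable {M : Type*} [TopologicalSpace M] [ChartedSpace E3 M] {D Es Eu : TangentField M}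

theorem hasVelocityWithinAt_of_hasMFDerivWithinAt {c : ℝ → M} {s : Set ℝ} {t : ℝ} {A : ℝ →L[ℝ] E3}
    (h : HasMFDerivWithinAt 𝓘(ℝ, ℝ) (𝓡 3) c s t A) : HasVelocityWithinAt c s t (A 1) := by
  rwa [HasVelocityWithinAt, show ContinuousLinearMap.toSpanSingleton ℝ (A 1) = A by ext1; simp]

theorem mapsTo_sub_mul_add_Icc {a b s t : ℝ} (hs : s ∈ Icc a b) (ht : t ∈ Icc a b) :
    MapsTo (fun θ => (t - s) * θ + s) (Icc 0 1) (Icc a b) := fun θ hθ => by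
  have hmem := (convex_Icc a b).add_smul_sub_mem hs ht hθ
  rwa [smul_eq_mul, add_comm, mul_comm] at hmem

theorem hasDerivWithinAt_mul_add (α β : ℝ) (s : Set ℝ) (θ : ℝ) :
    HasDerivWithinAt (fun θ => α * θ + β) α s θ := by
  simpa using (((hasDerivAt_id θ).const_mul α).add_const β).hasDerivWithinAt

namespace IsTangentArc

variable {c : ℝ → M} {a b : ℝ}

theorem hasVelocityWithinAt (hc : IsTangentArc D c a b) {t : ℝ} (ht : t ∈ Icc a b) :
    HasVelocityWithinAt c (Icc a b) t (mfderivWithin 𝓘(ℝ, ℝ) (𝓡 3) c (Icc a b) t (1 : ℝ)) :=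
  hasVelocityWithinAt_of_hasMFDerivWithinAt
    (hc.1.mdifferentiableOn one_ne_zero t ht).hasMFDerivWithinAt

theorem congr {c' : ℝ → M} (hc : IsTangentArc D c a b) (hab : a < b)
    (heq : EqOn c' c (Icc a b)) : IsTangentArc D c' a b := by
  refine isTangentArc_of_hasVelocityWithinAt hab (hc.1.congr heq) fun t ht => ?_
  rw [heq ht]
  exact ⟨_, hc.2 t ht, (hc.hasVelocityWithinAt ht).congr_mono heq (heq ht) Subset.rfl⟩

theorem comp_mul_add (hc : IsTangentArc D c a b) {a' b' : ℝ} (hab : a' < b') {α β : ℝ}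
    (hmaps : MapsTo (fun θ => α * θ + β) (Icc a' b') (Icc a b)) :
    IsTangentArc D (fun θ => c (α * θ + β)) a' b' := by
  have hsmooth : ContDiff ℝ 1 fun θ : ℝ => α * θ + β :=
    (contDiff_const.mul contDiff_id).add contDiff_const
  exact isTangentArc_of_hasVelocityWithinAt hab (hc.1.comp hsmooth.contMDiff.contMDiffOn hmaps)
    fun θ hθ => ⟨_, Submodule.smul_mem _ α (hc.2 _ (hmaps hθ)),
      HasVelocityWithinAt.comp_real (σ := fun θ => α * θ + β) (hc.hasVelocityWithinAt (hmaps hθ))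
        (hasDerivWithinAt_mul_add α β _ θ) hmaps⟩

theorem joinedByArc (hc : IsTangentArc D c a b) {s t : ℝ} (hs : s ∈ Icc a b) (ht : t ∈ Icc a b) :
    JoinedByArc D (c s) (c t) :=
  ⟨fun θ => c ((t - s) * θ + s), hc.comp_mul_add zero_lt_one (mapsTo_sub_mul_add_Icc hs ht),
    by simp, by simp⟩

end IsTangentArc

theorem JoinedByArc.symm {x y : M} (h : JoinedByArc D x y) : JoinedByArc D y x := by
  obtain ⟨c, hc, rfl, rfl⟩ := h
  exact hc.joinedByArc (by simp) (by simp)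

theorem isTangentArc_const (x : M) {a b : ℝ} (hab : a < b) : IsTangentArc D (fun _ => x) a b := by
  refine isTangentArc_of_hasVelocityWithinAt hab contMDiffOn_const fun t _ =>
    ⟨0, Submodule.zero_mem _, ?_⟩
  rw [HasVelocityWithinAt, ContinuousLinearMap.toSpanSingleton_zero]
  exact hasMFDerivWithinAt_const x _ t

/-- The elementary steps of an su-path: the points `x` and `y` are joined by a single arc tangent
to `Es` or to `Eu`. -/
def SuStep (Es Eu : TangentField M) (x y : M) : Prop := JoinedByArc Es x y ∨ JoinedByArc Eu x y

theorem SuStep.symm {x y : M} (h : SuStep Es Eu x y) : SuStep Es Eu y x :=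
  h.imp JoinedByArc.symm JoinedByArc.symm

theorem IsTangentArc.concatPath_left {c : ℝ → M} {a b : ℝ} (hc : IsTangentArc D c a b)
    (hab : a < b) (hb : b ≤ 1) (d : ℝ → M) :
    IsTangentArc D (concatPath c d) (a / 2) (b / 2) :=
  (hc.comp_mul_add (by linarith) fun s hs => ⟨by linarith [hs.1], by linarith [hs.2]⟩).congr
    (by linarith) fun _ hs => concatPath_eq_left c d (by linarith [hs.2])

theorem IsTangentArc.concatPath_right {c d : ℝ → M} (hd : IsTangentArc D d 0 1)
    (hcd : c 1 = d 0) : IsTangentArc D (concatPath c d) (1 / 2) 1 :=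
  (hd.comp_mul_add (by norm_num) fun s hs => ⟨by linarith [hs.1], by linarith [hs.2]⟩).congr
    (by norm_num) fun _ hs => concatPath_eq_right hcd hs.1

theorem IsSuPath.concatPath {c d : ℝ → M} (hc : IsSuPath Es Eu c)
    (hd : IsTangentArc Es d 0 1 ∨ IsTangentArc Eu d 0 1) (hcd : c 1 = d 0) :
    IsSuPath Es Eu (concatPath c d) := by
  obtain ⟨N, t, ht_zero, ht_last, ht⟩ := hc
  have ht_le_one (i : ℕ) (hi : i ≤ N) : t i ≤ 1 := by
    induction hi using Nat.decreasingInduction with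
    | self => exact ht_last.le
    | of_succ j hj ih => exact (ht j hj).1.le.trans ih
  refine ⟨N + 1, fun i => if i ≤ N then t i / 2 else 1, by simp [ht_zero], by simp,
    fun i hi => ?_⟩
  rcases (Nat.lt_succ_iff.1 hi).lt_or_eq with hiN | rfl
  · simp only [hiN.le, if_true, Nat.succ_le_iff.2 hiN]
    obtain ⟨hlt, harc⟩ := ht i hiN
    have hle := ht_le_one (i + 1) hiN
    exact ⟨by linarith, harc.imp (fun h => h.concatPath_left hlt hle d)
      fun h => h.concatPath_left hlt hle d⟩
  · simp only [le_refl, if_true, ht_last, Nat.succ_le_iff, lt_self_iff_false, if_false]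
    exact ⟨by norm_num, hd.imp (fun h => h.concatPath_right hcd) fun h => h.concatPath_right hcd⟩

theorem SuStep.mem_accessibilityClass {x y z : M} (hyz : SuStep Es Eu y z)
    (hy : y ∈ accessibilityClass Es Eu x) : z ∈ accessibilityClass Es Eu x := by
  obtain ⟨c, hc, rfl, rfl⟩ := hy
  obtain ⟨d, hd, hcd, rfl⟩ : ∃ d : ℝ → M, (IsTangentArc Es d 0 1 ∨ IsTangentArc Eu d 0 1) ∧
      d 0 = c 1 ∧ d 1 = z := by
    rcases hyz with ⟨d, hd, hends⟩ | ⟨d, hd, hends⟩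
    exacts [⟨d, Or.inl hd, hends⟩, ⟨d, Or.inr hd, hends⟩]
  refine ⟨concatPath c d, hc.concatPath hd hcd.symm, ?_, ?_⟩
  · rw [concatPath_eq_left c d (by norm_num), mul_zero, zero_add]
  · rw [concatPath_eq_right hcd.symm (by norm_num)]
    norm_num

theorem mem_accessibilityClass_self (x : M) : x ∈ accessibilityClass Es Eu x := by
  refine ⟨fun _ => x, ⟨1, fun i => i, Nat.cast_zero, Nat.cast_one, fun i _ => ?_⟩, rfl, rfl⟩
  have hlt : (i : ℝ) < (i + 1 : ℕ) := Nat.cast_lt.2 i.lt_succ_self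
  exact ⟨hlt, Or.inl (isTangentArc_const x hlt)⟩

theorem mem_accessibilityClass_iff_reflTransGen {x y : M} :
    y ∈ accessibilityClass Es Eu x ↔ Relation.ReflTransGen (SuStep Es Eu) x y := by
  constructor
  · rintro ⟨c, ⟨N, t, ht_zero, ht_last, ht⟩, rfl, rfl⟩
    have hreach (i : ℕ) (hi : i ≤ N) : Relation.ReflTransGen (SuStep Es Eu) (c 0) (c (t i)) := by
      induction i with
      | zero => rw [ht_zero]
      | succ i ih =>
        obtain ⟨hlt, harc⟩ := ht i (Nat.lt_of_succ_le hi)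
        have hleft := left_mem_Icc.2 hlt.le
        have hright := right_mem_Icc.2 hlt.le
        exact (ih (Nat.le_of_succ_le hi)).tail
          (harc.imp (fun h => h.joinedByArc hleft hright) fun h => h.joinedByArc hleft hright)
    exact ht_last ▸ hreach N le_rfl
  · intro h
    induction h with
    | refl => exact mem_accessibilityClass_self x
    | tail _ hstep ih => exact hstep.mem_accessibilityClass ih

end Arcs

section Interior

variable {M : Type*} [TopologicalSpace M] [ChartedSpace E3 M] [IsManifold (𝓡 3) ∞ M]
  {g : SmoothMetric M} {D : TangentField M}

namespace IsTangentArc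

theorem exists_speed_le (g : SmoothMetric M) {c : ℝ → M} (hc : IsTangentArc D c 0 1) :
    ∃ K, ∀ t ∈ Icc (0 : ℝ) 1,
      g.modelNorm (c t) (mfderivWithin 𝓘(ℝ, ℝ) (𝓡 3) c (Icc 0 1) t (1 : ℝ)) ≤ K := by
  have htangent := hc.1.continuousOn_tangentMapWithin le_rfl
    (uniqueDiffOn_Icc zero_lt_one).uniqueMDiffOn
  have hunit : Continuous fun t : ℝ => (⟨t, (1 : ℝ)⟩ : TangentBundle 𝓘(ℝ, ℝ) ℝ) :=
    (tangentBundleModelSpaceHomeomorph 𝓘(ℝ, ℝ)).symm.continuous.comp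
      (continuous_id.prodMk continuous_const)
  have hspeed : ContinuousOn (fun t : ℝ => g.tnorm (c t)
      (mfderivWithin 𝓘(ℝ, ℝ) (𝓡 3) c (Icc 0 1) t (1 : ℝ))) (Icc 0 1) :=
    g.continuous_tnorm.comp_continuousOn (htangent.comp hunit.continuousOn fun t ht => ht)
  obtain ⟨K, hK⟩ := isCompact_Icc.exists_bound_of_continuousOn hspeed
  exact ⟨K, fun t ht => (le_abs_self _).trans (hK t ht)⟩

theorem isSlowArc_reparam {c : ℝ → M} (hc : IsTangentArc D c 0 1) {K l : ℝ}
    (hK : ∀ t ∈ Icc (0 : ℝ) 1,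
      g.modelNorm (c t) (mfderivWithin 𝓘(ℝ, ℝ) (𝓡 3) c (Icc 0 1) t (1 : ℝ)) ≤ K)
    {s t : ℝ} (hs : s ∈ Icc (0 : ℝ) 1) (ht : t ∈ Icc (0 : ℝ) 1) (hst : |t - s| * K ≤ l) :
    IsSlowArc g D (fun θ => c ((t - s) * θ + s)) l := by
  intro θ hθ
  have hmaps := mapsTo_sub_mul_add_Icc hs ht
  refine ⟨_, Submodule.smul_mem _ (t - s) (hc.2 _ (hmaps hθ)), ?_,
    HasVelocityWithinAt.comp_real (σ := fun θ => (t - s) * θ + s)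
      (hc.hasVelocityWithinAt (hmaps hθ)) (hasDerivWithinAt_mul_add (t - s) s _ θ) hmaps⟩
  exact (g.modelNorm_smul _ _ _).trans_le <|
    (mul_le_mul_of_nonneg_left (hK _ (hmaps hθ)) (abs_nonneg _)).trans hst

end IsTangentArc

namespace IsLocalFlow

variable {p : M} {ℓ : E3 →L[ℝ] ℝ} {u : E3} {ε l T : ℝ} {U : Set M} {Φ : ℝ → M → M}

theorem continuousAt (hΦ : IsLocalFlow g D p ℓ u ε l U T Φ) {q : M} (hq : q ∈ U) {τ : ℝ}
    (hτ : τ ∈ Icc (-T) T) : ContinuousAt (Φ τ) q := by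
  have hcont : ContinuousOn (fun q => Φ τ q) U :=
    hΦ.continuousOn.comp (f := fun q => (τ, q)) (by fun_prop) fun q hq => ⟨hτ, hq⟩
  exact hcont.continuousAt (hΦ.isOpen.mem_nhds hq)

theorem mem_interior_of_isSlowArc (hΦ : IsLocalFlow g D p ℓ u ε l U T Φ) {A : Set M}
    (hA : ∀ x ∈ A, ∀ y, JoinedByArc D x y → y ∈ A) {c : ℝ → M} (hc : IsSlowArc g D c l)
    (h0 : c 0 ∈ U) (h1 : c 1 ∈ U) (hcA : c 1 ∈ interior A) : c 0 ∈ interior A := by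
  obtain ⟨τ, hτ, hend⟩ := hΦ.slowArc c hc h0 h1
  rw [mem_interior_iff_mem_nhds]
  have hflow : ∀ᶠ q in 𝓝 (c 0), Φ τ q ∈ interior A :=
    (hΦ.continuousAt h0 hτ).eventually_mem (by rw [hend]; exact isOpen_interior.mem_nhds hcA)
  filter_upwards [hflow, hΦ.isOpen.mem_nhds h0] with q hq hqU
  exact hA _ (interior_subset hq) _ (hΦ.joined q hqU τ hτ).symm

end IsLocalFlow

theorem mem_interior_of_joinedByArc {ℓ : M → E3 →L[ℝ] ℝ} {u : M → E3} {ε l : ℝ} (hl : 0 < l)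
    (hflow : ∀ p, ∃ U T Φ, IsLocalFlow g D p (ℓ p) (u p) ε l U T Φ) {A : Set M}
    (hA : ∀ x ∈ A, ∀ y, JoinedByArc D x y → y ∈ A) {x y : M} (hxy : JoinedByArc D x y)
    (hx : x ∈ interior A) : y ∈ interior A := by
  obtain ⟨c, hc, rfl, rfl⟩ := hxy
  obtain ⟨K, hK⟩ := hc.exists_speed_le g
  refine isPreconnected_Icc.induction₂' (s := Icc (0 : ℝ) 1)
    (fun s t => c s ∈ interior A → c t ∈ interior A) (fun t₀ ht₀ => ?_)
    (fun r s t _ _ _ hrs hst h => hst (hrs h)) (by simp) (by simp) hx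
  obtain ⟨U, T, Φ, hΦ⟩ := hflow (c t₀)
  have hlocal {s t : ℝ} (hs : s ∈ Icc (0 : ℝ) 1) (ht : t ∈ Icc (0 : ℝ) 1) (hsU : c s ∈ U)
      (htU : c t ∈ U) (hst : |t - s| * K ≤ l) (htA : c t ∈ interior A) : c s ∈ interior A := by
    have hstep := hΦ.mem_interior_of_isSlowArc hA (hc.isSlowArc_reparam hK hs ht hst)
    simp only [mul_zero, zero_add, mul_one, sub_add_cancel] at hstep
    exact hstep hsU htU htA
  have hnear : ∀ᶠ t in 𝓝[Icc 0 1] t₀, c t ∈ U :=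
    (hc.1.continuousOn t₀ ht₀).eventually_mem (hΦ.isOpen.mem_nhds hΦ.mem)
  have hshort : ∀ᶠ t in 𝓝[Icc 0 1] t₀, |t - t₀| * K < l := by
    have hcont : Continuous fun t : ℝ => |t - t₀| * K := by fun_prop
    refine nhdsWithin_le_nhds ((hcont.tendsto t₀).eventually_lt_const ?_)
    rwa [sub_self, abs_zero, zero_mul]
  filter_upwards [hnear, hshort, self_mem_nhdsWithin] with t htU htK ht
  exact ⟨hlocal ht ht₀ htU hΦ.mem (abs_sub_comm t t₀ ▸ htK.le),
    hlocal ht₀ ht hΦ.mem htU htK.le⟩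

end Interior

section Transverse

theorem exists_zero_of_abs_sub_lt {κ t₀ r : ℝ} {F G : ℝ × ℝ → ℝ} (hκ : κ ≠ 0) (hr : 0 < r)
    (hF : ContinuousOn F (Icc (t₀ - r) (t₀ + r) ×ˢ Icc (-r) r))
    (hG : ContinuousOn G (Icc (t₀ - r) (t₀ + r) ×ˢ Icc (-r) r))
    (hFnear : ∀ z ∈ Icc (t₀ - r) (t₀ + r) ×ˢ Icc (-r) r, |F z - (z.1 - t₀) * κ| < r * |κ|)
    (hGnear : ∀ z ∈ Icc (t₀ - r) (t₀ + r) ×ˢ Icc (-r) r, |G z - z.2| < r) :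
    ∃ z ∈ Icc (t₀ - r) (t₀ + r) ×ˢ Icc (-r) r, F z = 0 ∧ G z = 0 := by
  have hκF : ∀ z ∈ Icc (t₀ - r) (t₀ + r) ×ˢ Icc (-r) r,
      |κ * F z - (z.1 - t₀) * (κ * κ)| < r * (κ * κ) := fun z hz =>
    calc |κ * F z - (z.1 - t₀) * (κ * κ)| = |κ| * |F z - (z.1 - t₀) * κ| := by
          rw [← abs_mul]; ring_nf
      _ < |κ| * (r * |κ|) := mul_lt_mul_of_pos_left (hFnear z hz) (abs_pos.2 hκ)
      _ = r * (κ * κ) := by rw [← abs_mul_abs_self κ]; ring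
  have hleft : t₀ - r ≤ t₀ + r := by linarith
  have hbot : -r ≤ r := by linarith
  have hzero := exists_zero_of_sign_changes hleft hbot
    (F := fun z => κ * F z) (continuousOn_const.mul hF) hG
    (fun w hw => ?_) (fun w hw => ?_) (fun t ht => ?_) (fun t ht => ?_)
  · obtain ⟨z, hz, hFz, hGz⟩ := hzero
    exact ⟨z, hz, (mul_eq_zero.1 hFz).resolve_left hκ, hGz⟩
  · linarith [(abs_lt.1 (hκF (t₀ - r, w) ⟨left_mem_Icc.2 hleft, hw⟩)).2]
  · linarith [(abs_lt.1 (hκF (t₀ + r, w) ⟨right_mem_Icc.2 hleft, hw⟩)).1]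
  · linarith [(abs_lt.1 (hGnear (t, -r) ⟨ht, left_mem_Icc.2 hbot⟩)).2]
  · linarith [(abs_lt.1 (hGnear (t, r) ⟨ht, right_mem_Icc.2 hbot⟩)).1]

theorem exists_eq_of_near_frame {F : Type*} [NormedAddCommGroup F] [InnerProductSpace ℝ F]
    {v : Fin 3 → F} (hv : LinearIndependent ℝ v) (hspan : Submodule.span ℝ (range v) = ⊤)
    {K η κ t₀ r : ℝ} (hK : ∀ i, ‖dualFunctional v i‖ ≤ K) (hκ : κ ≠ 0) (hr : 0 < r)
    (hη : K * (2 * η) < r * min 1 |κ|) {x₀ : F} {P : ℝ × ℝ → F} {Q : ℝ → F} {a : ℝ × ℝ → ℝ}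
    (hP : ContinuousOn P (Icc (t₀ - r) (t₀ + r) ×ˢ Icc (-r) r)) (hQ : ContinuousOn Q (Icc (-r) r))
    (hPnear : ∀ z ∈ Icc (t₀ - r) (t₀ + r) ×ˢ Icc (-r) r,
      ‖P z - x₀ - ((z.1 - t₀) * κ) • v 1 - a z • v 0‖ ≤ η)
    (hQnear : ∀ w ∈ Icc (-r) r, ‖Q w - x₀ - w • v 2‖ ≤ η)
    (hcoord : ∀ z ∈ Icc (t₀ - r) (t₀ + r) ×ˢ Icc (-r) r,
      dualFunctional v 0 (P z) = dualFunctional v 0 (Q z.2)) :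
    ∃ z ∈ Icc (t₀ - r) (t₀ + r) ×ˢ Icc (-r) r, P z = Q z.2 := by
  have hnear : ∀ z ∈ Icc (t₀ - r) (t₀ + r) ×ˢ Icc (-r) r, ∀ i, |dualFunctional v i
      (P z - Q z.2 - (((z.1 - t₀) * κ) • v 1 + a z • v 0 - z.2 • v 2))| < r * min 1 |κ| := by
    intro z hz i
    have hdiff : ‖P z - Q z.2 - (((z.1 - t₀) * κ) • v 1 + a z • v 0 - z.2 • v 2)‖ ≤ 2 * η := by
      rw [two_mul]
      refine (norm_sub_le_of_le (hPnear z hz) (hQnear z.2 hz.2)).trans_eq' ?_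
      congr 1
      abel
    exact ((dualFunctional v i).le_of_opNorm_le_of_le (hK i) hdiff).trans_lt hη
  have hPQ : ContinuousOn (fun z => P z - Q z.2) (Icc (t₀ - r) (t₀ + r) ×ˢ Icc (-r) r) :=
    hP.sub (hQ.comp continuousOn_snd fun z hz => hz.2)
  have hzero := exists_zero_of_abs_sub_lt hκ hr
    ((dualFunctional v 1).continuous.comp_continuousOn hPQ)
    ((dualFunctional v 2).continuous.comp_continuousOn hPQ).neg (fun z hz => ?_) (fun z hz => ?_)
  · obtain ⟨z, hz, hzero₁, hzero₂⟩ := hzero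
    refine ⟨z, hz, ?_⟩
    have hzero₀ : dualFunctional v 0 (P z - Q z.2) = 0 := by
      rw [map_sub, hcoord z hz, sub_self]
    rw [← sub_eq_zero, ← sum_dualFunctional hv (hspan ▸ Submodule.mem_top : P z - Q z.2 ∈ _),
      Fin.sum_univ_three, hzero₀, show dualFunctional v 1 (P z - Q z.2) = 0 from hzero₁,
      show dualFunctional v 2 (P z - Q z.2) = 0 from neg_eq_zero.1 hzero₂]
    simp only [zero_smul, add_zero]
  · have hcoord₁ := (hnear z hz 1).trans_le
      (mul_le_mul_of_nonneg_left (min_le_right 1 |κ|) hr.le)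
    simpa [dualFunctional_apply_self hv] using hcoord₁
  · have hcoord₂ := (hnear z hz 2).trans_le (mul_le_mul_of_nonneg_left (min_le_left 1 |κ|) hr.le)
    have hsplit : dualFunctional v 2
        (P z - Q z.2 - (((z.1 - t₀) * κ) • v 1 + a z • v 0 - z.2 • v 2)) =
        dualFunctional v 2 (P z - Q z.2) + z.2 := by
      simp [dualFunctional_apply_self hv]
    rw [mul_one, hsplit, ← abs_neg, neg_add'] at hcoord₂
    exact hcoord₂

variable {M : Type*} [TopologicalSpace M] [ChartedSpace E3 M] [IsManifold (𝓡 3) ∞ M]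

/-- A curve `γ` through `p` in the direction `v 1`, together with local flows near `p` along line
fields in the directions `v 0` and `v 2`, on a time interval of radius `r` so small that the three
of them look like the axes of the frame `v` up to the relative error `ε`. -/
structure IsTransverseBox (g : SmoothMetric M) (D D' : TangentField M) (p : M) (v : Fin 3 → E3)
    (γ : ℝ → M) (t₀ κ ε r l l' : ℝ) (U : Set M) (T : ℝ) (Φ : ℝ → M → M) (U' : Set M) (T' : ℝ)
    (Ψ : ℝ → M → M) : Prop where
  flow : IsLocalFlow g D p (dualFunctional v 0) (v 0) ε l U T Φ
  flow' : IsLocalFlow g D' p (dualFunctional v 2) (v 2) ε l' U' T' Ψ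
  linearIndependent : LinearIndependent ℝ v
  ne_zero : κ ≠ 0
  error_pos : 0 < ε
  error_le : 12 * ((∑ i, ‖dualFunctional v i‖) * ε) ≤ min 1 |κ|
  radius_pos : 0 < r
  radius_le : r ≤ T
  radius_le' : r ≤ T'
  continuousOn : ContinuousOn γ (Icc (t₀ - r) (t₀ + r))
  mem : ∀ t ∈ Icc (t₀ - r) (t₀ + r), γ t ∈ U
  displacement : ∀ t ∈ Icc (t₀ - r) (t₀ + r),
    ‖extChartAt (𝓡 3) p (γ t) - extChartAt (𝓡 3) p p - ((t - t₀) * κ) • v 1‖ ≤ ε * r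

namespace IsTransverseBox

variable {g : SmoothMetric M} {D D' : TangentField M} {p : M} {v : Fin 3 → E3} {γ : ℝ → M}
  {t₀ κ ε r l l' : ℝ} {U U' : Set M} {T T' : ℝ} {Φ Ψ : ℝ → M → M} {q : M} {w : ℝ}

theorem mem_time' (h : IsTransverseBox g D D' p v γ t₀ κ ε r l l' U T Φ U' T' Ψ)
    (hw : w ∈ Icc (-r) r) : w ∈ Icc (-T') T' :=
  Icc_subset_Icc (neg_le_neg h.radius_le') h.radius_le' hw

theorem displacement' (h : IsTransverseBox g D D' p v γ t₀ κ ε r l l' U T Φ U' T' Ψ)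
    (hqU : q ∈ U') (hq : ‖extChartAt (𝓡 3) p q - extChartAt (𝓡 3) p p‖ ≤ ε * r)
    (hw : w ∈ Icc (-r) r) :
    ‖extChartAt (𝓡 3) p (Ψ w q) - extChartAt (𝓡 3) p p - w • v 2‖ ≤ 2 * (ε * r) := by
  have hflow := (h.flow'.displacement q hqU w (h.mem_time' hw)).trans
    (mul_le_mul_of_nonneg_left (abs_le.2 hw) h.error_pos.le)
  rw [two_mul]
  refine (norm_add_le_of_le hflow hq).trans_eq' ?_
  congr 1
  abel

/-- The time for which `γ t` has to flow along `D` to reach the same `0`-th coordinate as the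
point `Ψ w q`. -/
noncomputable def correctionTime (v : Fin 3 → E3) (p : M) (γ : ℝ → M) (Ψ : ℝ → M → M) (q : M)
    (z : ℝ × ℝ) : ℝ :=
  dualFunctional v 0 (extChartAt (𝓡 3) p (Ψ z.2 q)) -
    dualFunctional v 0 (extChartAt (𝓡 3) p (γ z.1))

variable {z : ℝ × ℝ}

theorem abs_correctionTime_le (h : IsTransverseBox g D D' p v γ t₀ κ ε r l l' U T Φ U' T' Ψ)
    (hqU : q ∈ U') (hq : ‖extChartAt (𝓡 3) p q - extChartAt (𝓡 3) p p‖ ≤ ε * r)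
    (hz : z ∈ Icc (t₀ - r) (t₀ + r) ×ˢ Icc (-r) r) : |correctionTime v p γ Ψ q z| ≤ r := by
  have hsplit : correctionTime v p γ Ψ q z = dualFunctional v 0
      ((extChartAt (𝓡 3) p (Ψ z.2 q) - extChartAt (𝓡 3) p p - z.2 • v 2) -
        (extChartAt (𝓡 3) p (γ z.1) - extChartAt (𝓡 3) p p - ((z.1 - t₀) * κ) • v 1)) := by
    simp [correctionTime, dualFunctional_apply_self h.linearIndependent]
  have hnorm := (dualFunctional v 0).le_of_opNorm_le_of_le
    (Finset.single_le_sum (f := fun i => ‖dualFunctional v i‖) (fun _ _ => norm_nonneg _)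
      (Finset.mem_univ 0))
    (norm_sub_le_of_le (h.displacement' hqU hq hz.2) (h.displacement z.1 hz.1))
  rw [hsplit, ← Real.norm_eq_abs]
  refine hnorm.trans ?_
  nlinarith [h.error_le.trans (min_le_left 1 |κ|), h.radius_pos]

theorem correctionTime_mem (h : IsTransverseBox g D D' p v γ t₀ κ ε r l l' U T Φ U' T' Ψ)
    (hqU : q ∈ U') (hq : ‖extChartAt (𝓡 3) p q - extChartAt (𝓡 3) p p‖ ≤ ε * r)
    (hz : z ∈ Icc (t₀ - r) (t₀ + r) ×ˢ Icc (-r) r) :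
    correctionTime v p γ Ψ q z ∈ Icc (-T) T :=
  abs_le.1 ((h.abs_correctionTime_le hqU hq hz).trans h.radius_le)

theorem norm_corrected_sub_le (h : IsTransverseBox g D D' p v γ t₀ κ ε r l l' U T Φ U' T' Ψ)
    (hqU : q ∈ U') (hq : ‖extChartAt (𝓡 3) p q - extChartAt (𝓡 3) p p‖ ≤ ε * r)
    (hz : z ∈ Icc (t₀ - r) (t₀ + r) ×ˢ Icc (-r) r) :
    ‖extChartAt (𝓡 3) p (Φ (correctionTime v p γ Ψ q z) (γ z.1)) - extChartAt (𝓡 3) p p -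
      ((z.1 - t₀) * κ) • v 1 - correctionTime v p γ Ψ q z • v 0‖ ≤ 2 * (ε * r) := by
  have hflow := (h.flow.displacement _ (h.mem z.1 hz.1) _ (h.correctionTime_mem hqU hq hz)).trans
    (mul_le_mul_of_nonneg_left (h.abs_correctionTime_le hqU hq hz) h.error_pos.le)
  rw [two_mul]
  refine (norm_add_le_of_le hflow (h.displacement z.1 hz.1)).trans_eq' ?_
  congr 1
  abel

theorem continuousOn_flow' (h : IsTransverseBox g D D' p v γ t₀ κ ε r l l' U T Φ U' T' Ψ)
    (hqU : q ∈ U') : ContinuousOn (fun w => extChartAt (𝓡 3) p (Ψ w q)) (Icc (-r) r) :=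
  (continuousOn_extChartAt p).comp
    (h.flow'.continuousOn.comp (f := fun w => (w, q)) (by fun_prop)
      fun _ hw => ⟨h.mem_time' hw, hqU⟩)
    fun w hw => h.flow'.mem_source q hqU w (h.mem_time' hw)

theorem continuousOn_corrected (h : IsTransverseBox g D D' p v γ t₀ κ ε r l l' U T Φ U' T' Ψ)
    (hqU : q ∈ U') (hq : ‖extChartAt (𝓡 3) p q - extChartAt (𝓡 3) p p‖ ≤ ε * r) :
    ContinuousOn (fun z => extChartAt (𝓡 3) p (Φ (correctionTime v p γ Ψ q z) (γ z.1)))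
      (Icc (t₀ - r) (t₀ + r) ×ˢ Icc (-r) r) := by
  have hγ : ContinuousOn (fun z : ℝ × ℝ => γ z.1) (Icc (t₀ - r) (t₀ + r) ×ˢ Icc (-r) r) :=
    h.continuousOn.comp continuousOn_fst fun z hz => hz.1
  have hγchart := (continuousOn_extChartAt (I := 𝓡 3) p).comp hγ fun z hz =>
    h.flow.subset_source (h.mem z.1 hz.1)
  have htime : ContinuousOn (correctionTime v p γ Ψ q)
      (Icc (t₀ - r) (t₀ + r) ×ˢ Icc (-r) r) :=
    ((dualFunctional v 0).continuous.comp_continuousOn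
      ((h.continuousOn_flow' hqU).comp continuousOn_snd fun z hz => hz.2)).sub
      ((dualFunctional v 0).continuous.comp_continuousOn hγchart)
  refine (continuousOn_extChartAt p).comp
    (h.flow.continuousOn.comp (f := fun z => (correctionTime v p γ Ψ q z, γ z.1))
      (htime.prodMk hγ) fun z hz => ⟨h.correctionTime_mem hqU hq hz, h.mem z.1 hz.1⟩)
    fun z hz => h.flow.mem_source _ (h.mem z.1 hz.1) _ (h.correctionTime_mem hqU hq hz)

theorem exists_flow_eq_flow' (h : IsTransverseBox g D D' p v γ t₀ κ ε r l l' U T Φ U' T' Ψ)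
    (hqU : q ∈ U') (hq : ‖extChartAt (𝓡 3) p q - extChartAt (𝓡 3) p p‖ ≤ ε * r) :
    ∃ t ∈ Icc (t₀ - r) (t₀ + r), ∃ τ ∈ Icc (-T) T, ∃ w ∈ Icc (-T') T', Φ τ (γ t) = Ψ w q := by
  have hspan : Submodule.span ℝ (range v) = ⊤ :=
    h.linearIndependent.span_eq_top_of_card_eq_finrank' (by simp)
  have hsmall : (∑ i, ‖dualFunctional v i‖) * (2 * (2 * (ε * r))) < r * min 1 |κ| := by
    have hpos : 0 < r * min 1 |κ| :=
      mul_pos h.radius_pos (lt_min one_pos (abs_pos.2 h.ne_zero))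
    linarith [mul_le_mul_of_nonneg_left h.error_le h.radius_pos.le]
  obtain ⟨z, hz, hPQ⟩ := exists_eq_of_near_frame h.linearIndependent hspan
    (fun i => Finset.single_le_sum (f := fun i => ‖dualFunctional v i‖)
      (fun _ _ => norm_nonneg _) (Finset.mem_univ i))
    h.ne_zero h.radius_pos hsmall (h.continuousOn_corrected hqU hq) (h.continuousOn_flow' hqU)
    (fun z hz => h.norm_corrected_sub_le hqU hq hz) (fun w hw => h.displacement' hqU hq hw)
    fun z hz => by
      rw [h.flow.coord _ (h.mem z.1 hz.1) _ (h.correctionTime_mem hqU hq hz), correctionTime]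
      ring
  have hτ := h.correctionTime_mem hqU hq hz
  have hw := h.mem_time' hz.2
  exact ⟨z.1, hz.1, _, hτ, z.2, hw, (extChartAt (𝓡 3) p).injOn
    (h.flow.mem_source _ (h.mem z.1 hz.1) _ hτ) (h.flow'.mem_source q hqU _ hw) hPQ⟩

theorem mem_nhds (h : IsTransverseBox g D D' p v γ t₀ κ ε r l l' U T Φ U' T' Ψ) {A : Set M}
    (hD : ∀ x ∈ A, ∀ y, JoinedByArc D x y → y ∈ A)
    (hD' : ∀ x ∈ A, ∀ y, JoinedByArc D' x y → y ∈ A)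
    (hγA : ∀ t ∈ Icc (t₀ - r) (t₀ + r), γ t ∈ A) : A ∈ 𝓝 p := by
  have hnear : ∀ᶠ q in 𝓝 p, ‖extChartAt (𝓡 3) p q - extChartAt (𝓡 3) p p‖ < ε * r := by
    have hcont : ContinuousAt (fun q => ‖extChartAt (𝓡 3) p q - extChartAt (𝓡 3) p p‖) p :=
      ((continuousAt_extChartAt p).sub continuousAt_const).norm
    exact hcont.tendsto.eventually_lt_const (by simpa using mul_pos h.error_pos h.radius_pos)
  filter_upwards [hnear, h.flow'.isOpen.mem_nhds h.flow'.mem] with q hq hqU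
  obtain ⟨t, ht, τ, hτ, w, hw, heq⟩ := h.exists_flow_eq_flow' hqU hq.le
  have hmem : Ψ w q ∈ A :=
    heq ▸ hD _ (hγA t ht) _ (h.flow.joined _ (h.mem t ht) τ hτ)
  exact hD' _ hmem _ (h.flow'.joined q hqU w hw).symm

end IsTransverseBox

theorem HasVelocityWithinAt.hasDerivAt_extChartAt {γ : ℝ → M} {t₀ : ℝ} {v : E3}
    (hγ : HasVelocityWithinAt γ univ t₀ v) :
    HasDerivAt (fun t => extChartAt (𝓡 3) (γ t₀) (γ t)) v t₀ := by
  have hcomp := hγ.comp_fun (mdifferentiableAt_extChartAt (mem_chart_source E3 (γ t₀)))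
  rw [hasDerivWithinAt_univ, chartDeriv_extChartAt_self] at hcomp
  exact hcomp

theorem exists_isTransverseBox {g : SmoothMetric M} {D D' : TangentField M} {v : Fin 3 → E3}
    {γ : ℝ → M} {t₀ κ l l' : ℝ} {N : Set ℝ} (hv : LinearIndependent ℝ v) (hκ : κ ≠ 0)
    (hγ : HasVelocityWithinAt γ univ t₀ (κ • v 1)) (hγc : ∀ᶠ t in 𝓝 t₀, ContinuousAt γ t)
    (hflow : ∀ ε > 0, ∃ U T Φ,
      IsLocalFlow g D (γ t₀) (dualFunctional v 0) (v 0) ε l U T Φ)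
    (hflow' : ∀ ε > 0, ∃ U T Φ,
      IsLocalFlow g D' (γ t₀) (dualFunctional v 2) (v 2) ε l' U T Φ) (hN : N ∈ 𝓝 t₀) :
    ∃ ε r U T Φ U' T' Ψ, IsTransverseBox g D D' (γ t₀) v γ t₀ κ ε r l l' U T Φ U' T' Ψ ∧
      Icc (t₀ - r) (t₀ + r) ⊆ N := by
  set K := ∑ i, ‖dualFunctional v i‖
  have hK : 0 ≤ K := Finset.sum_nonneg fun _ _ => norm_nonneg _
  have hm : 0 < min 1 |κ| := lt_min one_pos (abs_pos.2 hκ)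
  obtain ⟨ε, hε, hKε⟩ : ∃ ε > 0, 12 * (K * ε) ≤ min 1 |κ| := by
    refine ⟨min 1 |κ| / (12 * (K + 1)), by positivity, ?_⟩
    rw [← mul_assoc, mul_div_assoc', div_le_iff₀ (by positivity)]
    nlinarith [hm, hK]
  obtain ⟨U, T, Φ, hΦ⟩ := hflow ε hε
  obtain ⟨U', T', Ψ, hΨ⟩ := hflow' ε hε
  have hlin : ∀ᶠ t in 𝓝 t₀, ‖extChartAt (𝓡 3) (γ t₀) (γ t) - extChartAt (𝓡 3) (γ t₀) (γ t₀) -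
      (t - t₀) • κ • v 1‖ ≤ ε * ‖t - t₀‖ :=
    (hasDerivAt_iff_isLittleO.1 hγ.hasDerivAt_extChartAt).def hε
  have hU : ∀ᶠ t in 𝓝 t₀, γ t ∈ U :=
    hγc.self_of_nhds.eventually_mem (hΦ.isOpen.mem_nhds hΦ.mem)
  obtain ⟨r₀, hr₀, hball⟩ := Metric.nhds_basis_closedBall.eventually_iff.1
    (hlin.and (hU.and (hγc.and hN)))
  have hr : 0 < min r₀ (min T T') := lt_min hr₀ (lt_min hΦ.time_pos hΨ.time_pos)
  have hsub : Icc (t₀ - min r₀ (min T T')) (t₀ + min r₀ (min T T')) ⊆ Metric.closedBall t₀ r₀ := by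
    rw [← Real.closedBall_eq_Icc]
    exact Metric.closedBall_subset_closedBall (min_le_left _ _)
  refine ⟨ε, min r₀ (min T T'), U, T, Φ, U', T', Ψ,
    ⟨hΦ, hΨ, hv, hκ, hε, hKε, hr, (min_le_right _ _).trans (min_le_left _ _),
      (min_le_right _ _).trans (min_le_right _ _),
      fun t ht => (hball (hsub ht)).2.2.1.continuousWithinAt, fun t ht => (hball (hsub ht)).2.1,
      fun t ht => ?_⟩, fun t ht => (hball (hsub ht)).2.2.2⟩
  rw [← smul_smul]
  refine (hball (hsub ht)).1.trans (mul_le_mul_of_nonneg_left ?_ hε.le)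
  rwa [← Real.closedBall_eq_Icc, mem_closedBall_iff_norm] at ht

theorem mem_nhds_of_transverse_curve {g : SmoothMetric M} {E : Fin 3 → TangentField M}
    {b : M → Fin 3 → E3} (hb : IsUnitFrame g E b) {l l' : ℝ} {γ : ℝ → M} {t₀ : ℝ}
    {v : E3} (hγ : HasVelocityWithinAt γ univ t₀ v) (hv : v ∈ modelFiber (E 1) (γ t₀))
    (hv0 : v ≠ 0) (hγc : ∀ᶠ t in 𝓝 t₀, ContinuousAt γ t)
    (hflow : ∀ ε > 0, ∃ U T Φ, IsLocalFlow g (E 0) (γ t₀) (dualFunctional (b (γ t₀)) 0)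
      (b (γ t₀) 0) ε l U T Φ)
    (hflow' : ∀ ε > 0, ∃ U T Φ, IsLocalFlow g (E 2) (γ t₀) (dualFunctional (b (γ t₀)) 2)
      (b (γ t₀) 2) ε l' U T Φ) {A : Set M}
    (hA : ∀ x ∈ A, ∀ y, JoinedByArc (E 0) x y → y ∈ A)
    (hA' : ∀ x ∈ A, ∀ y, JoinedByArc (E 2) x y → y ∈ A)
    (hγA : ∀ᶠ t in 𝓝 t₀, γ t ∈ A) : A ∈ 𝓝 (γ t₀) := by
  obtain ⟨κ, rfl, -⟩ := hb.exists_smul hv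
  obtain ⟨ε, r, U, T, Φ, U', T', Ψ, hbox, hsub⟩ := exists_isTransverseBox
    (hb.linearIndependent _) (left_ne_zero_of_smul hv0) hγ hγc hflow hflow' hγA
  exact hbox.mem_nhds hA hA' hsub

end Transverse

section CenterCurves

theorem isEmbedding_domRestrict_of_leftInvOn {X Y : Type*} [TopologicalSpace X]
    [TopologicalSpace Y] {γ : X → Y} {h : Y → X} {s : Set X} {t : Set Y} (hγ : ContinuousOn γ s)
    (hh : ContinuousOn h t) (hst : MapsTo γ s t) (hleft : LeftInvOn h γ s) :
    IsEmbedding (s.domRestrict γ) := by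
  have hid : t.domRestrict h ∘ hst.restrict = Subtype.val := funext fun x => hleft x.2
  have hembed : IsEmbedding (hst.restrict γ s t) :=
    IsEmbedding.of_comp (hγ.mapsToRestrict hst) hh.domRestrict (hid ▸ IsEmbedding.subtypeVal)
  exact IsEmbedding.subtypeVal.comp hembed

theorem hasInteriorIn_of_isOpen {X : Type*} [TopologicalSpace X] {A W : Set X} {x : X}
    (hA : IsOpen A) (hxA : x ∈ A) (hxW : x ∈ W) : HasInteriorIn A W :=
  ⟨⟨x, hxW⟩, by rwa [(hA.preimage continuous_subtype_val).interior_eq]⟩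

theorem HasInteriorIn.exists_eventually_mem {X Y : Type*} [TopologicalSpace X]
    [TopologicalSpace Y] {γ : X → Y} {s : Set X} {A : Set Y} (hγ : ContinuousOn γ s)
    (hs : IsOpen s) (h : HasInteriorIn A (γ '' s)) : ∃ t₀ ∈ s, ∀ᶠ t in 𝓝 t₀, γ t ∈ A := by
  obtain ⟨⟨_, t₀, ht₀, rfl⟩, hmem⟩ := h
  obtain ⟨V, hV, hVA⟩ := (mem_nhds_subtype _ _ _).1 (mem_interior_iff_mem_nhds.1 hmem)
  refine ⟨t₀, ht₀, ?_⟩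
  filter_upwards [(hγ.continuousAt (hs.mem_nhds ht₀)).eventually_mem hV, hs.mem_nhds ht₀] with
    t htV ht
  exact @hVA ⟨γ t, mem_image_of_mem γ ht⟩ htV

variable {M : Type*} [TopologicalSpace M] [ChartedSpace E3 M]

theorem HasVelocityWithinAt.mfderiv_apply_one {c : ℝ → M} {t : ℝ} {v : E3}
    (hc : HasVelocityWithinAt c univ t v) :
    (mfderiv 𝓘(ℝ, ℝ) (𝓡 3) c t (1 : ℝ) : E3) = v := by
  rw [(hasMFDerivWithinAt_univ.1 hc).mfderiv]
  exact ContinuousLinearMap.toSpanSingleton_apply_one ℝ v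

theorem IsLocalCenterCurve.mem {Ec : TangentField M} {x : M} {W : Set M}
    (hW : IsLocalCenterCurve Ec x W) : x ∈ W := by
  obtain ⟨ε, γ, hε, rfl, rfl, -⟩ := hW
  exact ⟨0, ⟨neg_lt_zero.2 hε, hε⟩, rfl⟩

variable [IsManifold (𝓡 3) ∞ M] {g : SmoothMetric M} {D : TangentField M} {p : M}
  {ℓ : E3 →L[ℝ] ℝ} {u : E3} {ε : ℝ} {X : E3 → E3} {L R : ℝ}

namespace IsChartField

theorem exists_isIntegralCurve_mem_closedBall (hX : IsChartField g D p ℓ u ε X L R) :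
    ∃ δ > 0, ∃ y : ℝ → E3, y 0 = extChartAt (𝓡 3) p p ∧ (IsIntegralCurve y fun _ => X) ∧
      ∀ t ∈ Ioo (-δ) δ, y t ∈ Metric.closedBall (extChartAt (𝓡 3) p p) R := by
  obtain ⟨y, hy₀, hy⟩ := exists_isIntegralCurve hX.uniformContinuous hX.norm_le
    (extChartAt (𝓡 3) p p)
  have hL : 0 ≤ L := (norm_nonneg _).trans (hX.norm_le 0)
  refine ⟨R / (L + 1), div_pos hX.radius_pos (by linarith), y, hy₀, hy, fun t ht => ?_⟩
  rw [mem_closedBall_iff_norm, ← hy₀]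
  calc ‖y t - y 0‖ ≤ L * |t - 0| := norm_sub_le_of_isIntegralCurve hy hX.norm_le 0 t
    _ ≤ (L + 1) * (R / (L + 1)) := by
      rw [sub_zero]
      exact mul_le_mul (by linarith) (abs_lt.2 ht).le (abs_nonneg t) (by linarith)
    _ = R := mul_div_cancel₀ R (by linarith)

theorem mfderiv_ne_zero_and_mem (hX : IsChartField g D p ℓ u ε X L R) {y : ℝ → E3}
    (hy : IsIntegralCurve y fun _ => X) {t : ℝ}
    (ht : y t ∈ Metric.closedBall (extChartAt (𝓡 3) p p) R) :
    mfderiv 𝓘(ℝ, ℝ) (𝓡 3) ((extChartAt (𝓡 3) p).symm ∘ y) t (1 : ℝ) ≠ 0 ∧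
      mfderiv 𝓘(ℝ, ℝ) (𝓡 3) ((extChartAt (𝓡 3) p).symm ∘ y) t (1 : ℝ) ∈
        D ((extChartAt (𝓡 3) p).symm (y t)) := by
  obtain ⟨v, hv, -, hvX⟩ := hX.tangent _ ht
  have hvelocity := (hasVelocityWithinAt_extChartAt_symm_comp (s := univ)
    (hy t).hasDerivWithinAt (hX.ball_subset ht) hvX).mfderiv_apply_one
  have hv₀ : v ≠ 0 := by
    rintro rfl
    have hcoord := hX.coord_eq_one _ ht
    rw [← hvX, map_zero, map_zero] at hcoord
    exact zero_ne_one hcoord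
  exact ⟨fun hzero => hv₀ (hvelocity.symm.trans hzero),
    (congrArg (· ∈ modelFiber D ((extChartAt (𝓡 3) p).symm (y t))) hvelocity).mpr hv⟩

theorem exists_isLocalCenterCurve (hX : IsChartField g D p ℓ u ε X L R) :
    ∃ W, IsLocalCenterCurve D p W := by
  set φ := extChartAt (𝓡 3) p
  obtain ⟨δ, hδ, y, hy₀, hy, hmem⟩ := hX.exists_isIntegralCurve_mem_closedBall
  have hsmooth : ContMDiffOn 𝓘(ℝ, ℝ) (𝓡 3) 1 (φ.symm ∘ y) (Ioo (-δ) δ) := by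
    have hscaled := hX.contMDiffOn hy (τ := 1) fun t ht => (mul_one t).symm ▸ hmem t ht
    simp only [mul_one] at hscaled
    exact hscaled
  refine ⟨_, δ, φ.symm ∘ y, hδ, ?_, rfl, hsmooth, ?_,
    fun t ht => hX.mfderiv_ne_zero_and_mem hy (hmem t ht)⟩
  · rw [Function.comp_apply, hy₀]
    exact φ.left_inv (mem_extChartAt_source p)
  · refine isEmbedding_domRestrict_of_leftInvOn (h := fun q => ℓ (φ q) - ℓ (y 0))
      hsmooth.continuousOn
      ((ℓ.continuous.comp_continuousOn (continuousOn_extChartAt p)).sub continuousOn_const)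
      (fun t ht => φ.map_target (hX.ball_subset (hmem t ht))) fun t ht => ?_
    change ℓ (φ (φ.symm (y t))) - ℓ (y 0) = t
    rw [φ.right_inv (hX.ball_subset (hmem t ht)),
      hX.coord_eq_add hy (convex_Ioo _ _) ⟨neg_lt_zero.2 hδ, hδ⟩ hmem ht, add_sub_cancel_left]

end IsChartField

theorem IsUnitFrame.exists_isLocalCenterCurve {E : Fin 3 → TangentField M} {b : M → Fin 3 → E3}
    (hb : IsUnitFrame g E b) (i : Fin 3) (x : M) : ∃ W, IsLocalCenterCurve (E i) x W := by
  obtain ⟨X, L, R, hX, -⟩ := hb.exists_isChartField x i one_pos univ_mem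
  exact hX.exists_isLocalCenterCurve

end CenterCurves

section AccessibilityClasses

variable {M : Type*} [TopologicalSpace M] [ChartedSpace E3 M] [IsManifold (𝓡 3) ∞ M]
  {g : SmoothMetric M}

theorem IsLocalCenterCurve.interior_nonempty {E : Fin 3 → TangentField M} {b : M → Fin 3 → E3}
    (hb : IsUnitFrame g E b) {l l' : ℝ}
    (hflow : ∀ p, ∀ ε > 0, ∃ U T Φ,
      IsLocalFlow g (E 0) p (dualFunctional (b p) 0) (b p 0) ε l U T Φ)
    (hflow' : ∀ p, ∀ ε > 0, ∃ U T Φ,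
      IsLocalFlow g (E 2) p (dualFunctional (b p) 2) (b p 2) ε l' U T Φ)
    {A : Set M} (hA : ∀ x ∈ A, ∀ y, JoinedByArc (E 0) x y → y ∈ A)
    (hA' : ∀ x ∈ A, ∀ y, JoinedByArc (E 2) x y → y ∈ A) {x : M} {W : Set M}
    (hW : IsLocalCenterCurve (E 1) x W) (hAW : HasInteriorIn A W) : (interior A).Nonempty := by
  obtain ⟨ε, γ, -, -, rfl, hγ, -, htangent⟩ := hW
  obtain ⟨t₀, ht₀, hγA⟩ := hAW.exists_eventually_mem hγ.continuousOn isOpen_Ioo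
  have hderiv : HasMFDerivAt 𝓘(ℝ, ℝ) (𝓡 3) γ t₀ (mfderiv 𝓘(ℝ, ℝ) (𝓡 3) γ t₀) :=
    ((hγ.contMDiffAt (isOpen_Ioo.mem_nhds ht₀)).mdifferentiableAt one_ne_zero).hasMFDerivAt
  have hcont : ∀ᶠ t in 𝓝 t₀, ContinuousAt γ t := by
    filter_upwards [isOpen_Ioo.mem_nhds ht₀] with t ht
    exact hγ.continuousOn.continuousAt (isOpen_Ioo.mem_nhds ht)
  exact ⟨γ t₀, mem_interior_iff_mem_nhds.2 (mem_nhds_of_transverse_curve hb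
    (hasVelocityWithinAt_of_hasMFDerivWithinAt hderiv.hasMFDerivWithinAt) (htangent t₀ ht₀).2
    (htangent t₀ ht₀).1 hcont (hflow (γ t₀)) (hflow' (γ t₀)) hA hA' hγA)⟩

theorem isOpen_accessibilityClass {Es Eu : TangentField M} {ℓ ℓ' : M → E3 →L[ℝ] ℝ} {u u' : M → E3}
    {ε l l' : ℝ} (hl : 0 < l) (hl' : 0 < l')
    (hflow : ∀ p, ∃ U T Φ, IsLocalFlow g Es p (ℓ p) (u p) ε l U T Φ)
    (hflow' : ∀ p, ∃ U T Φ, IsLocalFlow g Eu p (ℓ' p) (u' p) ε l' U T Φ) {x : M}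
    (hne : (interior (accessibilityClass Es Eu x)).Nonempty) :
    IsOpen (accessibilityClass Es Eu x) := by
  have hstep {p q : M} (hpq : SuStep Es Eu p q)
      (hp : p ∈ interior (accessibilityClass Es Eu x)) :
      q ∈ interior (accessibilityClass Es Eu x) := by
    rcases hpq with hs | hu
    · exact mem_interior_of_joinedByArc hl hflow
        (fun _ hy _ h => SuStep.mem_accessibilityClass (Or.inl h) hy) hs hp
    · exact mem_interior_of_joinedByArc hl' hflow'
        (fun _ hy _ h => SuStep.mem_accessibilityClass (Or.inr h) hy) hu hp
  have hpath {p q : M} (hpq : Relation.ReflTransGen (SuStep Es Eu) p q)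
      (hp : p ∈ interior (accessibilityClass Es Eu x)) :
      q ∈ interior (accessibilityClass Es Eu x) := by
    induction hpq with
    | refl => exact hp
    | tail _ hqr ih => exact hstep hqr ih
  have : Std.Symm (SuStep Es Eu) := ⟨fun _ _ => SuStep.symm⟩
  obtain ⟨y, hy⟩ := hne
  have hx : x ∈ interior (accessibilityClass Es Eu x) :=
    hpath (Std.Symm.symm _ _ (mem_accessibilityClass_iff_reflTransGen.1 (interior_subset hy))) hy
  exact interior_eq_iff_isOpen.1 (interior_subset.antisymm fun z hz =>
    hpath (mem_accessibilityClass_iff_reflTransGen.1 hz) hx)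

end AccessibilityClasses

section PartiallyHyperbolic

variable {M : Type*} [TopologicalSpace M] [ChartedSpace E3 M]

theorem chartMapDeriv_symm_apply (f : M ≃ₘ^1⟮𝓡 3, 𝓡 3⟯ M) (x : M) (v : E3) :
    chartMapDeriv f.symm (f x) (chartMapDeriv f x v) = v := by
  have hcomp : mfderiv (𝓡 3) (𝓡 3) (f.symm ∘ f) x
      = (mfderiv (𝓡 3) (𝓡 3) f.symm (f x)).comp (mfderiv (𝓡 3) (𝓡 3) f x) :=
    mfderiv_comp x (f.symm.contMDiff.mdifferentiable one_ne_zero (f x))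
      (f.contMDiff.mdifferentiable one_ne_zero x)
  rw [show f.symm ∘ f = id from funext f.symm_apply_apply, mfderiv_id] at hcomp
  exact (DFunLike.congr_fun hcomp v).symm

theorem chartMapDeriv_mem_of_map_eq {f : M → M} {E : TangentField M} {x : M}
    (hmap : (E x).map (mfderiv (𝓡 3) (𝓡 3) f x).toLinearMap = E (f x)) {v : E3}
    (hv : v ∈ modelFiber E x) : chartMapDeriv f x v ∈ modelFiber E (f x) := by
  have hmem := Submodule.mem_map_of_mem (f := (mfderiv (𝓡 3) (𝓡 3) f x).toLinearMap)
    (p := E x) hv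
  rw [hmap] at hmem
  exact hmem

theorem chartMapDeriv_symm_mem_of_map_eq {f : M ≃ₘ^1⟮𝓡 3, 𝓡 3⟯ M} {E : TangentField M} {x : M}
    (hmap : (E x).map (mfderiv (𝓡 3) (𝓡 3) f x).toLinearMap = E (f x)) {v : E3}
    (hv : v ∈ modelFiber E (f x)) : chartMapDeriv f.symm (f x) v ∈ modelFiber E x := by
  have hv' : v ∈ (E x).map (mfderiv (𝓡 3) (𝓡 3) f x).toLinearMap := by
    rw [hmap]
    exact hv
  obtain ⟨w, hw, rfl⟩ := hv'
  have hinverse : chartMapDeriv f.symm (f x) (mfderiv (𝓡 3) (𝓡 3) f x w) = w :=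
    chartMapDeriv_symm_apply f x w
  exact hinverse.symm ▸ hw

variable [IsManifold (𝓡 3) ∞ M]

theorem stretch_symm_mul_stretch {g : SmoothMetric M} {E : Fin 3 → TangentField M}
    {b : M → Fin 3 → E3} {f : M ≃ₘ^1⟮𝓡 3, 𝓡 3⟯ M} (hb : IsUnitFrame g E b) {x : M} {i : Fin 3}
    (hmap : chartMapDeriv f x (b x i) ∈ modelFiber (E i) (f x)) :
    stretch g b f.symm i (f x) * stretch g b f i x = 1 := by
  obtain ⟨a, ha, hnorm⟩ := hb.exists_smul hmap
  have hinverse := chartMapDeriv_symm_apply f x (b x i)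
  rw [ha, map_smul] at hinverse
  have hone := congrArg (g.modelNorm x) hinverse
  rw [g.modelNorm_smul, hb.norm_eq] at hone
  rw [stretch, stretch, hnorm, f.symm_apply_apply, mul_comm]
  exact hone

/-- The splitting `TM = Es ⊕ Ec ⊕ Eu`, indexed so that `0`, `1`, `2` stand for `s`, `c`, `u`. -/
def splittingFamily (Es Ec Eu : TangentField M) : Fin 3 → TangentField M := ![Es, Ec, Eu]

namespace IsPartiallyHyperbolic

variable {f : M ≃ₘ^1⟮𝓡 3, 𝓡 3⟯ M} {Es Ec Eu : TangentField M}

theorem isContinuousLineBundle (hf : IsPartiallyHyperbolic f Es Ec Eu) (i : Fin 3) :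
    IsContinuousLineBundle (splittingFamily Es Ec Eu i) := by
  fin_cases i
  exacts [hf.lineBundle_s, hf.lineBundle_c, hf.lineBundle_u]

theorem isInternal (hf : IsPartiallyHyperbolic f Es Ec Eu) (x : M) :
    DirectSum.IsInternal fun i => splittingFamily Es Ec Eu i x := by
  have hfamily : (fun i => splittingFamily Es Ec Eu i x) = ![Es x, Ec x, Eu x] := by
    funext i
    fin_cases i <;> rfl
  rw [hfamily]
  exact hf.splitting x

theorem map_eq (hf : IsPartiallyHyperbolic f Es Ec Eu) (x : M) (i : Fin 3) :
    (splittingFamily Es Ec Eu i x).map (mfderiv (𝓡 3) (𝓡 3) f x).toLinearMap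
      = splittingFamily Es Ec Eu i (f x) := by
  fin_cases i
  exacts [hf.invariant_s x, hf.invariant_c x, hf.invariant_u x]

theorem stretch_symm (hf : IsPartiallyHyperbolic f Es Ec Eu) {g : SmoothMetric M}
    {b : M → Fin 3 → E3} (hb : IsUnitFrame g (splittingFamily Es Ec Eu) b) (x : M) (i : Fin 3) :
    0 < stretch g b f i x ∧ stretch g b f.symm i (f x) = (stretch g b f i x)⁻¹ := by
  have hmul := stretch_symm_mul_stretch (f := f) hb
    (chartMapDeriv_mem_of_map_eq (hf.map_eq x i) (hb.mem x i))
  exact ⟨(stretch_nonneg i x).lt_of_ne' (right_ne_zero_of_mul_eq_one hmul),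
    eq_inv_of_mul_eq_one_left hmul⟩

theorem exists_isUnitFrame_stretch_lt (hf : IsPartiallyHyperbolic f Es Ec Eu) :
    ∃ (g : SmoothMetric M) (b : M → Fin 3 → E3), IsUnitFrame g (splittingFamily Es Ec Eu) b ∧
      ∀ x, stretch g b f 0 x < 1 ∧ 1 < stretch g b f 2 x ∧
        stretch g b f 0 x < stretch g b f 1 x ∧ stretch g b f 1 x < stretch g b f 2 x := by
  obtain ⟨g, hg⟩ := hf.hyperbolicity
  obtain ⟨b, hb⟩ := exists_isUnitFrame g hf.isContinuousLineBundle hf.isInternal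
  exact ⟨g, b, hb, fun x => hg x (b x 0) (hb.mem x 0) (b x 1) (hb.mem x 1) (b x 2) (hb.mem x 2)
    (hb.norm_eq x 0) (hb.norm_eq x 1) (hb.norm_eq x 2)⟩

theorem exists_contractsDominated (hf : IsPartiallyHyperbolic f Es Ec Eu) :
    ∃ g b, IsUnitFrame g (splittingFamily Es Ec Eu) b ∧
      ContractsDominated g (splittingFamily Es Ec Eu) b f 0 ∧
      ContractsDominated g (splittingFamily Es Ec Eu) b f.symm 2 := by
  obtain ⟨g, b, hb, hrate⟩ := hf.exists_isUnitFrame_stretch_lt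
  have hsurj : Function.Surjective (f : M → M) := f.surjective
  have hmap_symm : ∀ y i, ∀ v ∈ modelFiber (splittingFamily Es Ec Eu i) y,
      chartMapDeriv f.symm y v ∈ modelFiber (splittingFamily Es Ec Eu i) (f.symm y) := by
    refine hsurj.forall.2 fun x i v hv => ?_
    rw [f.symm_apply_apply]
    exact chartMapDeriv_symm_mem_of_map_eq (hf.map_eq x i) hv
  refine ⟨g, b, hb, ⟨f.contMDiff, fun x i v => chartMapDeriv_mem_of_map_eq (hf.map_eq x i),
    fun x => (hrate x).1, fun x j hj => ?_⟩, ⟨f.symm.contMDiff, hmap_symm,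
    hsurj.forall.2 fun x => ?_, hsurj.forall.2 fun x j hj => ?_⟩⟩
  · obtain ⟨-, -, hsc, hcu⟩ := hrate x
    fin_cases j
    exacts [absurd rfl hj, hsc, hsc.trans hcu]
  · rw [(hf.stretch_symm hb x 2).2]
    exact inv_lt_one_of_one_lt₀ (hrate x).2.1
  · rw [(hf.stretch_symm hb x 2).2, (hf.stretch_symm hb x j).2]
    refine inv_strictAnti₀ (hf.stretch_symm hb x j).1 ?_
    obtain ⟨-, -, hsc, hcu⟩ := hrate x
    fin_cases j
    exacts [hsc.trans hcu, hcu, absurd rfl hj]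

end IsPartiallyHyperbolic

end PartiallyHyperbolic

theorem mainTheorem5 {M : Type*} [TopologicalSpace M] [ChartedSpace E3 M]
    [IsManifold (𝓡 3) ∞ M] [CompactSpace M] [T2Space M]
    (f : M ≃ₘ^1⟮𝓡 3, 𝓡 3⟯ M) (Es Ec Eu : TangentField M)
    (hf : IsPartiallyHyperbolic f Es Ec Eu) (x : M) :
    List.TFAE [
      IsOpen (accessibilityClass Es Eu x),
      (interior (accessibilityClass Es Eu x)).Nonempty,
      ∀ W : Set M, IsLocalCenterCurve Ec x W →
        HasInteriorIn (accessibilityClass Es Eu x) W,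
      ∃ W : Set M, IsLocalCenterCurve Ec x W ∧
        HasInteriorIn (accessibilityClass Es Eu x) W] := by
  obtain ⟨g, b, hb, hs, hu⟩ := hf.exists_contractsDominated
  obtain ⟨l, hl, hflow_s⟩ := hs.exists_isLocalFlow hb
  obtain ⟨l', hl', hflow_u⟩ := hu.exists_isLocalFlow hb
  have hx := mem_accessibilityClass_self (Es := Es) (Eu := Eu) x
  tfae_have 1 → 2 := fun hopen => ⟨x, hopen.interior_eq.symm ▸ hx⟩
  tfae_have 2 → 1 :=
    isOpen_accessibilityClass hl hl' (hflow_s · 1 one_pos) (hflow_u · 1 one_pos)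
  tfae_have 1 → 3 := fun hopen W hW => hasInteriorIn_of_isOpen hopen hx hW.mem
  tfae_have 3 → 4 := fun hall =>
    (hb.exists_isLocalCenterCurve 1 x).imp fun W hW => ⟨hW, hall W hW⟩
  tfae_have 4 → 2 := fun ⟨W, hW, hint⟩ =>
    IsLocalCenterCurve.interior_nonempty hb hflow_s hflow_u
      (fun _ hy _ hyz => SuStep.mem_accessibilityClass (Or.inl hyz) hy)
      (fun _ hy _ hyz => SuStep.mem_accessibilityClass (Or.inr hyz) hy) hW hint
  tfae_finish
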